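/- Let $N\ge 1$ and consider the eigenphases in $(-\pi,\pi]$ of a Haar-distributed matrix in $\mathrm U(N)$ (CUE$_N$), with joint density proportional to $\prod_{i<j}|e^{ix_i}-e^{ix_j}|^2$, conditioned on one eigenphase being at $0$: the other $N-1$ have joint density on $(-\pi,\pi]^{N-1}$ proportional to $\prod_{i<j}|e^{ix_i}-e^{ix_j}|^2\prod_j|e^{ix_j}-1|^2$. For $0<t<\pi$ let $\tilde J_1(t)=\tilde J_1(0;[-t,t])$ be the conditional probability that none of these $N-1$ eigenphases lies in $I=[-t,t]$. Put $$K(x,y)=\frac{\sin(N(x-y)/2)}{2\pi\sin((x-y)/2)},\qquad \tilde K(x,y)=K(x,y)-K(x,0)K(0,0)^{-1}K(0,y),$$ $$\left.\begin{matrix}\tilde\varphi(x)\\ \tilde\psi(x)\end{matrix}\right\}=\frac{e^{ix/2}}{\sqrt{2\pi}}\Bigl(e^{\pm iNx/2}-\frac{e^{iNx/2}-e^{-iNx/2}}{N(e^{ix}-1)}\Bigr)$$ (upper sign for $\tilde\varphi$, lower sign for $\tilde\psi$; removable singularities removed), and let $\tilde{\mathbb K}_I$ be the integral operator on $I$ with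 kernel $\tilde K$. Then for every $t\in(0,\pi)$ the operator $\mathbb I-\tilde{\mathbb K}_I$ is invertible on continuous functions on $I$, its inverse being given by the Neumann series, and $\tilde J_1(t)=\det(\mathbb I-\tilde{\mathbb K}_I)>0$ (Fredholm determinant). Define $Q=(\mathbb I-\tilde{\mathbb K}_I)^{-1}\tilde\varphi$, $P=(\mathbb I-\tilde{\mathbb K}_I)^{-1}\tilde\psi$, $q(t)=q_2=Q(t)$, $q_1=Q(-t)$, $p(t)=p_2=P(t)$, $p_1=P(-t)$, and $$u(t)=\int_{-t}^t\tilde\varphi\,Q\,dx,\qquad w(t)=\int_{-t}^t\tilde\psi\,P\,dx,\qquad v(t)=\int_{-t}^t\tilde\psi\,Q\,dx .$$ Then $q=\overline{q_1}$, $p=\overline{p_1}$, $u,w,v\in\mathbb R$; all these functions and $\log\tilde J_1$ are differentiable on $(0,\pi)$, and, with $'=d/dt$, $$i(1-e^{it})q'=-\Bigl\{\tfrac{N+1}{2}(1-e^{it})+v-\tfrac1N\Bigr\}q+(N+1)\Bigl(u-\tfrac1N\Bigr)p+\tan\tfrac t2\,(q\bar p-p\bar q)\,\bar q,$$ $$i(1-e^{it})p'=\Bigl\{\tfrac{N-1}{2}(1-e^{it})+v-\tfrac1N\Bigr\}p+(N-1)\Bigl(w-\tfrac1N\Bigr)q+\tan\tfrac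 t2\,(q\bar p-p\bar q)\,\bar p,$$ $$u'=q^2+\bar q^2,\qquad w'=p^2+\bar p^2,\qquad v'=qp+\bar q\bar p,$$ $$(\log\tilde J_1)'=i e^{-it}(pq'-qp')-i e^{it}(\bar p\bar q'-\bar q\bar p')+\cot t\,(q\bar p-p\bar q)^2 .$$ The boundary conditions as $t\to0^+$ are, up to errors $O(t^4)$, $$q=\tfrac{i(N+1)}{2\sqrt{2\pi}}t-\tfrac{(N+1)(N+2)}{12\sqrt{2\pi}}t^2-\tfrac{i(N+1)^3}{48\sqrt{2\pi}}t^3,\qquad p=-\tfrac{i(N-1)}{2\sqrt{2\pi}}t-\tfrac{(N-1)(N-2)}{12\sqrt{2\pi}}t^2+\tfrac{i(N-1)^3}{48\sqrt{2\pi}}t^3,$$ $$u=-\tfrac{(N+1)^2}{12\pi}t^3,\qquad w=-\tfrac{(N-1)^2}{12\pi}t^3,\qquad v=\tfrac{N^2-1}{12\pi}t^3,\qquad \log\tilde J_1=-\tfrac{N(N^2-1)}{36\pi}t^3 .$$ Moreover, with $P_{\mathrm{nn}}(t):=-\,d\tilde J_1/dt$ one has $P_{\mathrm{nn}}=-\tilde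 J_1\,(\log\tilde J_1)'$ on $(0,\pi)$, and if $N\ge2$, the distance $\min_j|x_j|$ from the eigenphase at $0$ to its nearest neighbor has, under the conditional law, the density $P_{\mathrm{nn}}$ on $(0,\pi)$. -/

import Mathlib

open MeasureTheory Set Filter Topology Asymptotics
open scoped Real ComplexConjugate

noncomputable section

/-! ### The conditioned circular unitary ensemble -/

/-- The unnormalised joint density `∏_{i<j} |e^{i x_i} - e^{i x_j}|²` of the eigenphases of a
Haar-distributed unitary matrix. -/
def cueWeight {n : ℕ} (x : Fin n → ℝ) : ℝ :=
  ∏ i : Fin n, ∏ j ∈ Finset.Ioi i,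
    ‖Complex.exp (Complex.I * (x i : ℂ)) - Complex.exp (Complex.I * (x j : ℂ))‖ ^ 2

/-- The unnormalised law, on `(-π, π]^(N-1)`, of the other `N - 1` eigenphases of `CUE_N`
when one eigenphase is fixed at `0`. -/
def cueCondWeightMeasure (N : ℕ) : Measure (Fin (N - 1) → ℝ) :=
  (volume.restrict (Set.univ.pi fun _ => Set.Ioc (-π) π)).withDensity
    fun x => ENNReal.ofReal (cueWeight (Fin.cons 0 x : Fin (N - 1 + 1) → ℝ))

/-- The conditional law of the other `N - 1` eigenphases of `CUE_N` given an eigenphase at `0`. -/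
def cueCondLaw (N : ℕ) : Measure (Fin (N - 1) → ℝ) :=
  (cueCondWeightMeasure N Set.univ)⁻¹ • cueCondWeightMeasure N

/-- `J̃₁(0; [a, b])`: the conditional probability, given an eigenphase at `0`, that `[a, b]`
contains none of the other eigenphases. -/
def condJanossy (N : ℕ) (a b : ℝ) : ℝ :=
  (cueCondLaw N).real {x | ∀ j, x j ∉ Set.Icc a b}

/-- The distance from the eigenphase at `0` to the nearest of the others, for phases in
`(-π, π]` (meaningful for `2 ≤ N`). -/
def nearestDist {n : ℕ} (x : Fin n → ℝ) : ℝ := ⨅ j, |x j|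

/-- `P_nn(t) = - d J̃₁(0; [-t, t]) / dt`. -/
def nnSpacingDensity (N : ℕ) (t : ℝ) : ℝ :=
  -deriv (fun s => condJanossy N (-s) s) t

/-! ### The kernel -/

/-- The `CUE_N` kernel `sin (N (x - y) / 2) / (2π sin ((x - y) / 2))`, continued by its limit
to the points where the denominator vanishes. -/
def cueKernel (N : ℕ) (x y : ℝ) : ℝ :=
  if Real.sin ((x - y) / 2) = 0 then
    N * Real.cos (N * (x - y) / 2) / (2 * π * Real.cos ((x - y) / 2))
  else
    Real.sin (N * (x - y) / 2) / (2 * π * Real.sin ((x - y) / 2))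

/-- The kernel `K̃` conditioned on an eigenphase at `0`. -/
def condKernel (N : ℕ) (x y : ℝ) : ℝ :=
  cueKernel N x y - cueKernel N x 0 * (cueKernel N 0 0)⁻¹ * cueKernel N 0 y

/-- `φ̃`, continued by its limit `0` to the points where `e^{ix} = 1`. -/
def phiTilde (N : ℕ) (x : ℝ) : ℂ :=
  if Complex.exp (Complex.I * x) = 1 then 0 else
    Complex.exp (Complex.I * x / 2) / (Real.sqrt (2 * π) : ℂ) *
      (Complex.exp (Complex.I * N * x / 2) -
        (Complex.exp (Complex.I * N * x / 2) - Complex.exp (-(Complex.I * N * x / 2))) /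
          (N * (Complex.exp (Complex.I * x) - 1)))

/-- `ψ̃`, continued by its limit `0` to the points where `e^{ix} = 1`. -/
def psiTilde (N : ℕ) (x : ℝ) : ℂ :=
  if Complex.exp (Complex.I * x) = 1 then 0 else
    Complex.exp (Complex.I * x / 2) / (Real.sqrt (2 * π) : ℂ) *
      (Complex.exp (-(Complex.I * N * x / 2)) -
        (Complex.exp (Complex.I * N * x / 2) - Complex.exp (-(Complex.I * N * x / 2))) /
          (N * (Complex.exp (Complex.I * x) - 1)))

/-! ### Fredholm determinant and resolvent on an interval -/

/-- The `n`-th term `(-1)^n / n! ∫_{[a,b]^n} det [K(x_i, x_j)] dx` of the Fredholm expansion of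
`det (1 - K)` on `L²([a, b])`. -/
def fredholmTerm (K : ℝ → ℝ → ℝ) (a b : ℝ) (n : ℕ) : ℝ :=
  (-1) ^ n / (n.factorial : ℝ) *
    ∫ x in Set.univ.pi fun _ : Fin n => Set.Icc a b,
      (Matrix.of fun i j => K (x i) (x j)).det

/-- `(K_I)^n f`, where `K_I` is the integral operator with kernel `K` on `I = [a, b]`. -/
def neumannTerm (K : ℝ → ℝ → ℝ) (a b : ℝ) (f : ℝ → ℂ) : ℕ → ℝ → ℂ
  | 0 => f
  | n + 1 => fun x => ∫ y in a..b, (K x y : ℂ) * neumannTerm K a b f n y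

/-- `(1 - K_I)⁻¹ f`, as the sum of its Neumann series. -/
def resolventApply (K : ℝ → ℝ → ℝ) (a b : ℝ) (f : ℝ → ℂ) (x : ℝ) : ℂ :=
  ∑' n, neumannTerm K a b f n x

/-- The Neumann series inverts `1 - K_I` on continuous functions on `I = [a, b]`: for continuous
`f` it converges on `I`, and its sum is the unique continuous solution `g` of `g - K_I g = f`. -/
def NeumannInverts (K : ℝ → ℝ → ℝ) (a b : ℝ) : Prop :=
  ∀ f : ℝ → ℂ, ContinuousOn f (Set.Icc a b) →
    (∀ x ∈ Set.Icc a b, Summable fun n => neumannTerm K a b f n x) ∧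
    ContinuousOn (resolventApply K a b f) (Set.Icc a b) ∧
    (∀ x ∈ Set.Icc a b,
      resolventApply K a b f x - ∫ y in a..b, (K x y : ℂ) * resolventApply K a b f y = f x) ∧
    ∀ g : ℝ → ℂ, ContinuousOn g (Set.Icc a b) →
      (∀ x ∈ Set.Icc a b, g x - ∫ y in a..b, (K x y : ℂ) * g y = f x) →
      ∀ x ∈ Set.Icc a b, g x = resolventApply K a b f x

/-! ### The Tracy-Widom quantities, as functions of the end points `a₁, a₂` -/

/-- `Q(x) = ((1 - K̃_I)⁻¹ φ̃)(x)`; thus `q_j = twQ N a₁ a₂ a_j`. -/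
def twQ (N : ℕ) (a₁ a₂ x : ℝ) : ℂ := resolventApply (condKernel N) a₁ a₂ (phiTilde N) x

/-- `P(x) = ((1 - K̃_I)⁻¹ ψ̃)(x)`; thus `p_j = twP N a₁ a₂ a_j`. -/
def twP (N : ℕ) (a₁ a₂ x : ℝ) : ℂ := resolventApply (condKernel N) a₁ a₂ (psiTilde N) x

def twU (N : ℕ) (a₁ a₂ : ℝ) : ℂ := ∫ x in a₁..a₂, phiTilde N x * twQ N a₁ a₂ x

def twW (N : ℕ) (a₁ a₂ : ℝ) : ℂ := ∫ x in a₁..a₂, psiTilde N x * twP N a₁ a₂ x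

def twV (N : ℕ) (a₁ a₂ : ℝ) : ℂ := ∫ x in a₁..a₂, psiTilde N x * twQ N a₁ a₂ x

/-! ### The symmetric interval `[-t, t]` -/

def symQ (N : ℕ) (t : ℝ) : ℂ := twQ N (-t) t t

def symP (N : ℕ) (t : ℝ) : ℂ := twP N (-t) t t

def symU (N : ℕ) (t : ℝ) : ℂ := twU N (-t) t

def symW (N : ℕ) (t : ℝ) : ℂ := twW N (-t) t

def symV (N : ℕ) (t : ℝ) : ℂ := twV N (-t) t

def symJ (N : ℕ) (t : ℝ) : ℝ := condJanossy N (-t) t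

end

/-! `K̃` is the orthogonal projection kernel onto the trigonometric polynomials with the `N`
frequencies `freq N a` that vanish at `0`. The translates of the Dirichlet kernel to the nodes
`2πk/N`, `1 ≤ k < N`, form an orthonormal basis `cueBasis` of this space, so `K̃` is a finite rank
kernel (`condKernel_eq_finKer`) and all operator theory on `[-t, t]` reduces to the Gram matrix `G`
of the basis there. The Fredholm series ends and equals `det (1 - G)`, and the resolvent is `f + c ·
(1 - G)⁻¹ m(f)`, where `c` is the vector of basis functions and `m(f)` the vector of moments of `f`.
Orthonormality makes `1 - G` the Gram matrix of the complement of `[-t, t]`; it is positive definite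
because a nonzero analytic function cannot vanish on an interval. Hence `0 ≤ G < 1` and the Neumann
series converges. The conditioned density is a constant times `det [c_k(x_i)]²`, so Andréief's
identity identifies the gap probability with the same determinant.

The differential system is the Tracy–Widom argument. Two identities for `K̃` say that its
commutators with multiplication by `e^{ix}` (`unitExp_sub_mul_condKernel`) and with `i(1 - e^{ix})
d/dx` (`condKernel_derivation`) are built from `φ̃` and `ψ̃`, up to boundary terms; moreover `φ̃,
ψ̃` satisfy a first order linear system. Uniqueness for `g - K̃ g = f` carries these facts over to
`Q`, `P` and the resolvent kernel `R`, giving a differential equation in `x` and a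
Christoffel–Darboux form of `R`. Moving the end points adds `R(t, ±t)` times boundary values: the
`R(t, t)` terms cancel, `R(t, -t)` is expressed by `q, p`, and `(log J̃₁)' = -2 R(t, t)`.

Near `t = 0` the basis functions, `φ̃` and `ψ̃` all vanish to first order, so moments are `O(t³)`
and the resolvent corrections do not reach the stated terms. Finally, `J̃₁` is the tail of the law
of the nearest distance, and comparing distribution functions gives the density. -/

/-! ### Principal minors and the Fredholm expansion of a finite rank kernel -/

section Minors

variable {m : Type*} [Fintype m] [DecidableEq m]

/-- A non-injective `f` repeats a row and contributes `0`. The injective ones are grouped by their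
image; each image of size `n` is reached by `n!` bijections, all with the same principal minor. -/
theorem sum_det_submatrix_fun {R : Type*} [CommRing R] (G : Matrix m m R) (n : ℕ) :
    ∑ f : Fin n → m, (G.submatrix f f).det =
      (n.factorial : R) * ∑ s ∈ Finset.univ.powersetCard n,
        (G.submatrix (Subtype.val : s → m) (Subtype.val : s → m)).det := by
  classical
  have h0 : ∑ f : Fin n → m, (G.submatrix f f).det =
      ∑ f ∈ Finset.univ.filter (fun f : Fin n → m => Function.Injective f),
        (G.submatrix f f).det := by
    symm
    apply Finset.sum_filter_of_ne
    intro f _ hf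
    by_contra hinj
    simp only [Function.Injective, not_forall] at hinj
    obtain ⟨i, j, hij, hne⟩ := hinj
    exact hf (Matrix.det_zero_of_row_eq hne (by ext k; simp [hij]))
  rw [h0, ← Finset.sum_fiberwise_of_maps_to (g := fun f : Fin n → m => Finset.univ.image f)
    (t := Finset.univ.powersetCard n), Finset.mul_sum]
  · refine Finset.sum_congr rfl fun s hs => ?_
    have hcard := (Finset.mem_powersetCard.mp hs).2
    rw [Finset.sum_eq_card_nsmul
      (b := (G.submatrix (Subtype.val : s → m) (Subtype.val : s → m)).det), nsmul_eq_mul]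
    · congr 2
      have : Fintype.card (Fin n ≃ s) = n.factorial := by
        rw [Fintype.card_equiv (Fintype.equivFinOfCardEq (by simpa using hcard)).symm]
        simp
      rw [← this, ← Finset.card_univ]
      symm
      refine Finset.card_bij (fun e _ i => (e i : m)) ?_ ?_ ?_
      · intro e _
        simp only [Finset.mem_filter, Finset.mem_univ, true_and]
        refine ⟨Subtype.val_injective.comp e.injective, ?_⟩
        ext x
        simp only [Finset.mem_image, Finset.mem_univ, true_and]
        exact ⟨fun ⟨i, hi⟩ => hi ▸ (e i).2, fun hx => ⟨e.symm ⟨x, hx⟩, by simp⟩⟩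
      · intro e _ e' _ h
        ext i
        exact congrFun h i
      · intro f hf
        simp only [Finset.mem_filter, Finset.mem_univ, true_and] at hf
        obtain ⟨hf, himg⟩ := hf
        have hmem : ∀ i, f i ∈ s := fun i => himg ▸ Finset.mem_image_of_mem f (Finset.mem_univ i)
        refine ⟨Equiv.ofBijective (fun i => (⟨f i, hmem i⟩ : s)) ?_, Finset.mem_univ _, rfl⟩
        refine ⟨fun i j h => hf (congrArg Subtype.val h), fun ⟨x, hx⟩ => ?_⟩
        rw [← himg] at hx
        obtain ⟨i, _, hi⟩ := Finset.mem_image.mp hx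
        exact ⟨i, Subtype.ext hi⟩
    · intro f hf
      simp only [Finset.mem_filter, Finset.mem_univ, true_and] at hf
      obtain ⟨hf, himg⟩ := hf
      have hmem : ∀ i, f i ∈ s := fun i => himg ▸ Finset.mem_image_of_mem f (Finset.mem_univ i)
      let e : Fin n ≃ s := Equiv.ofBijective (fun i => (⟨f i, hmem i⟩ : s)) <| by
        refine ⟨fun i j h => hf (congrArg Subtype.val h), fun ⟨x, hx⟩ => ?_⟩
        rw [← himg] at hx
        obtain ⟨i, _, hi⟩ := Finset.mem_image.mp hx
        exact ⟨i, Subtype.ext hi⟩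
      exact Matrix.det_submatrix_equiv_self e
        (G.submatrix (Subtype.val : s → m) (Subtype.val : s → m))
  · intro f hf
    simp only [Finset.mem_filter, Finset.mem_univ, true_and] at hf
    rw [Finset.mem_powersetCard]
    exact ⟨Finset.subset_univ _, by simp [Finset.card_image_of_injective _ hf]⟩

/-- This is the characteristic polynomial at `1`: its coefficients are signed sums of principal
minors. -/
theorem det_one_sub_eq_sum_minors {R : Type*} [CommRing R] [Nontrivial R] (G : Matrix m m R) :
    (1 - G).det = ∑ k ∈ Finset.range (Fintype.card m + 1),
      (-1) ^ k * ∑ s ∈ Finset.univ.powersetCard k,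
        (G.submatrix (Subtype.val : s → m) (Subtype.val : s → m)).det := by
  have h1 : (1 - G).det = G.charpoly.eval 1 := by
    rw [Matrix.eval_charpoly]; simp
  rw [h1, Polynomial.eval_eq_sum_range, Matrix.charpoly_natDegree_eq_dim,
    ← Finset.sum_range_reflect]
  refine Finset.sum_congr rfl fun k hk => ?_
  have hk' : k ≤ Fintype.card m := Nat.lt_succ_iff.mp (Finset.mem_range.mp hk)
  rw [one_pow, mul_one, Nat.add_sub_cancel, Matrix.charpoly_coeff_eq_sum_minors G k hk']

/-- Integral version of the Cauchy–Binet formula. -/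
theorem integral_det_finiteRank {m : Type*} [Fintype m] (μ : Measure ℝ) [SigmaFinite μ]
    (c : m → ℝ → ℝ)
    (hc : ∀ k l, Integrable (fun x => c k x * c l x) μ) (n : ℕ) :
    ∫ x : Fin n → ℝ, (Matrix.of fun i j => ∑ k, c k (x i) * c k (x j)).det
        ∂(Measure.pi fun _ => μ) =
      ∑ f : Fin n → m,
        ((Matrix.of fun k l => ∫ x, c k x * c l x ∂μ).submatrix f f).det := by
  have hexp : ∀ x : Fin n → ℝ, (Matrix.of fun i j => ∑ k, c k (x i) * c k (x j)).det =
      ∑ f : Fin n → m, ∑ σ : Equiv.Perm (Fin n),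
        ((Equiv.Perm.sign σ : ℤ) : ℝ) * ∏ i, (c (f (σ i)) (x i) * c (f i) (x i)) := by
    intro x
    rw [Matrix.det_apply', Finset.sum_comm]
    refine Finset.sum_congr rfl fun σ _ => ?_
    rw [← Finset.mul_sum]
    congr 1
    simp only [Matrix.of_apply]
    rw [Finset.prod_univ_sum, Fintype.piFinset_univ]
    -- Reindexing `f` by `σ⁻¹` moves the permutation from the variables to the indices, so that the
    -- `i`-th factor depends on `x i` alone and the integral factorises.
    refine Finset.sum_bij' (fun f _ i => f (σ⁻¹ i)) (fun f _ i => f (σ i)) ?_ ?_ ?_ ?_ ?_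
    · simp
    · simp
    · intro f _; ext i; simp
    · intro f _; ext i; simp
    · intro f _
      have h2 : ∀ i, σ⁻¹ (σ i) = i := fun i => σ.symm_apply_apply i
      simp only [Finset.prod_mul_distrib, h2]
      rw [mul_comm]
      congr 1
      exact Fintype.prod_equiv σ _ _ (fun i => by simp only [h2])
  simp_rw [hexp]
  have hint : ∀ (f : Fin n → m) (σ : Equiv.Perm (Fin n)), Integrable (fun x : Fin n → ℝ =>
      ((Equiv.Perm.sign σ : ℤ) : ℝ) * ∏ i, (c (f (σ i)) (x i) * c (f i) (x i)))
      (Measure.pi fun _ => μ) := fun f σ =>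
    (Integrable.fintype_prod (f := fun i y => c (f (σ i)) y * c (f i) y)
      fun i => hc _ _).const_mul _
  rw [integral_finsetSum _ fun f _ => integrable_finsetSum _ fun σ _ => hint f σ]
  refine Finset.sum_congr rfl fun f _ => ?_
  rw [integral_finsetSum _ fun σ _ => hint f σ, Matrix.det_apply']
  refine Finset.sum_congr rfl fun σ _ => ?_
  rw [integral_const_mul, integral_fintype_prod_eq_prod (f := fun i y => c (f (σ i)) y * c (f i) y)]
  rfl

/-- Andréief's identity. -/
theorem integral_det_sq {n : ℕ} (μ : Measure ℝ) [SigmaFinite μ] (c : Fin n → ℝ → ℝ)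
    (hc : ∀ k l, Integrable (fun x => c k x * c l x) μ) :
    ∫ x : Fin n → ℝ, (Matrix.of fun i k => c k (x i)).det ^ 2 ∂(Measure.pi fun _ => μ) =
      (n.factorial : ℝ) * (Matrix.of fun k l => ∫ x, c k x * c l x ∂μ).det := by
  have h : ∀ x : Fin n → ℝ, (Matrix.of fun i k => c k (x i)).det ^ 2 =
      (Matrix.of fun i j => ∑ k, c k (x i) * c k (x j)).det := by
    intro x
    rw [pow_two]
    nth_rewrite 2 [← Matrix.det_transpose]
    rw [← Matrix.det_mul]
    rfl
  simp_rw [h]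
  rw [integral_det_finiteRank μ c hc, sum_det_submatrix_fun]
  congr 1
  have hs : (Finset.univ : Finset (Fin n)).powersetCard n = {Finset.univ} := by
    have := Finset.powersetCard_self (Finset.univ : Finset (Fin n))
    rwa [Finset.card_univ, Fintype.card_fin] at this
  rw [hs, Finset.sum_singleton]
  let e : (Finset.univ : Finset (Fin n)) ≃ Fin n := Equiv.subtypeUnivEquiv (by simp)
  exact Matrix.det_submatrix_equiv_self e _

/-- There are no principal minors of order larger than the rank, so the Fredholm series is a finite
sum, namely the expansion of `det (1 - G)` in minors of the Gram matrix. -/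
theorem hasSum_fredholmTerm (K : ℝ → ℝ → ℝ) (c : m → ℝ → ℝ) (hc : ∀ k, Continuous (c k))
    (hK : ∀ x y, K x y = ∑ k, c k x * c k y) {a b : ℝ} (hab : a ≤ b) :
    HasSum (fredholmTerm K a b) (1 - Matrix.of fun k l => ∫ x in a..b, c k x * c l x).det := by
  set G : Matrix m m ℝ := Matrix.of fun k l => ∫ x in a..b, c k x * c l x with hG
  have hterm : ∀ n, fredholmTerm K a b n = (-1) ^ n * ∑ s ∈ Finset.univ.powersetCard n,
        (G.submatrix (Subtype.val : s → m) (Subtype.val : s → m)).det := by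
    intro n
    unfold fredholmTerm
    simp_rw [hK]
    rw [volume_pi, Measure.restrict_pi_pi, integral_det_finiteRank, sum_det_submatrix_fun]
    · have : (Matrix.of fun k l => ∫ x in Set.Icc a b, c k x * c l x) = G := by
        ext k l
        simp [hG, intervalIntegral.integral_of_le hab, integral_Icc_eq_integral_Ioc]
      rw [this, ← mul_assoc, div_mul_cancel₀]
      exact_mod_cast n.factorial_ne_zero
    · intro k l
      exact ((hc k).mul (hc l)).continuousOn.integrableOn_compact isCompact_Icc
  rw [det_one_sub_eq_sum_minors]
  simp_rw [← hterm]
  apply hasSum_sum_of_ne_finset_zero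
  intro n hn
  rw [hterm, Finset.powersetCard_eq_empty.mpr]
  · simp
  · simpa using hn

end Minors

/-! ### The resolvent of a finite rank kernel -/

section FiniteRank

open Matrix

set_option linter.unusedSectionVars false

variable {m : Type*} [Fintype m] [DecidableEq m]

open scoped Matrix.Norms.L2Operator in
-- The eigenvalues of `G` lie in `[0, 1)`. The `ℓ²` operator norm is unitarily invariant, hence
-- equals the largest eigenvalue modulus, and the geometric series applies.
theorem hasSum_pow_of_posSemidef {G : Matrix m m ℝ} (h0 : G.PosSemidef) (h1 : (1 - G).PosDef) :
    HasSum (fun n => G ^ n) (1 - G)⁻¹ := by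
  have hlt : ‖G‖ < 1 := by
    have hH := h0.1
    have hev : ∀ i, hH.eigenvalues i < 1 := by
      intro i
      set v : m → ℝ := ⇑(hH.eigenvectorBasis i) with hv
      have hv0 : v ≠ 0 := by
        intro h
        have : hH.eigenvectorBasis i = 0 := by
          ext j; exact congrFun h j
        have h2 := hH.eigenvectorBasis.orthonormal.1 i
        rw [this] at h2
        simp at h2
      have h3 := h1.dotProduct_mulVec_pos hv0
      rw [Matrix.sub_mulVec, Matrix.one_mulVec, hH.mulVec_eigenvectorBasis i] at h3
      have h4 : star v ⬝ᵥ (v - hH.eigenvalues i • v) = (1 - hH.eigenvalues i) * (star v ⬝ᵥ v) := by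
        rw [dotProduct_sub, dotProduct_smul, smul_eq_mul]; ring
      rw [h4] at h3
      have h5 : 0 < star v ⬝ᵥ v := Matrix.dotProduct_star_self_pos_iff.mpr hv0
      have := (pos_iff_pos_of_mul_pos h3).mpr h5
      linarith
    have hsp := hH.spectral_theorem
    rw [Unitary.conjStarAlgAut_apply] at hsp
    have hn : ‖G‖ = ‖(diagonal (hH.eigenvalues) : Matrix m m ℝ)‖ := by
      conv_lhs => rw [hsp]
      rw [← Unitary.coe_star, CStarRing.norm_mul_coe_unitary, CStarRing.norm_coe_unitary_mul]
      rfl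
    rw [hn, Matrix.l2_opNorm_diagonal, pi_norm_lt_iff one_pos]
    intro i
    rw [Real.norm_eq_abs, abs_of_nonneg (h0.eigenvalues_nonneg i)]
    exact hev i
  rw [Matrix.nonsing_inv_eq_ringInverse]
  exact hasSum_geom_series_inverse G hlt

/-- The kernel `∑ k, c k x * c k y`. -/
noncomputable def finKer (c : m → ℝ → ℝ) (x y : ℝ) : ℝ := ∑ k, c k x * c k y

/-- The Gram matrix of the functions `c k` on `[a, b]`. -/
noncomputable def gramMat (c : m → ℝ → ℝ) (a b : ℝ) : Matrix m m ℝ :=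
  Matrix.of fun k l => ∫ x in a..b, c k x * c l x

noncomputable def resMat (c : m → ℝ → ℝ) (a b : ℝ) : Matrix m m ℝ := (1 - gramMat c a b)⁻¹

noncomputable def cvec (c : m → ℝ → ℝ) (x : ℝ) : m → ℂ := fun k => (c k x : ℂ)

noncomputable def moment (c : m → ℝ → ℝ) (a b : ℝ) (f : ℝ → ℂ) : m → ℂ :=
  fun k => ∫ x in a..b, (c k x : ℂ) * f x

/-- `(1 - K)⁻¹ f` for the kernel `K = finKer c` on `[a, b]`. -/
noncomputable def resApply (c : m → ℝ → ℝ) (a b : ℝ) (f : ℝ → ℂ) (x : ℝ) : ℂ :=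
  f x + cvec c x ⬝ᵥ (resMat c a b).map Complex.ofRealHom *ᵥ moment c a b f

/-- The kernel of `(1 - K)⁻¹ K`. -/
noncomputable def resKer (c : m → ℝ → ℝ) (a b x y : ℝ) : ℂ :=
  cvec c x ⬝ᵥ (resMat c a b).map Complex.ofRealHom *ᵥ cvec c y

theorem gramMat_transpose (c : m → ℝ → ℝ) (a b : ℝ) : (gramMat c a b)ᵀ = gramMat c a b := by
  ext k l
  simp [gramMat, mul_comm]

theorem resMat_transpose (c : m → ℝ → ℝ) (a b : ℝ) : (resMat c a b)ᵀ = resMat c a b := by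
  rw [resMat, Matrix.transpose_nonsing_inv, transpose_sub, gramMat_transpose, transpose_one]

theorem conj_resKer (c : m → ℝ → ℝ) (a b x y : ℝ) :
    conj (resKer c a b x y) = resKer c a b x y := by
  simp [resKer, cvec, dotProduct, mulVec, map_sum]

theorem intervalIntegrable_mul_continuousOn {c : ℝ → ℝ} (hc : Continuous c) {a b : ℝ}
    (hab : a ≤ b) {f : ℝ → ℂ} (hf : ContinuousOn f (Icc a b)) :
    IntervalIntegrable (fun x => (c x : ℂ) * f x) volume a b := by
  apply ContinuousOn.intervalIntegrable
  rw [uIcc_of_le hab]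
  exact (Complex.continuous_ofReal.comp hc).continuousOn.mul hf

variable {c : m → ℝ → ℝ} {a b : ℝ}

/-- The quadratic form is a squared `L²` norm; both the semidefiniteness of `G` and the definiteness
of `1 - G` rest on this. -/
theorem dotProduct_gramMat_mulVec (hc : ∀ k, Continuous (c k)) (v : m → ℝ) :
    v ⬝ᵥ (gramMat c a b *ᵥ v) = ∫ x in a..b, (∑ k, v k * c k x) ^ 2 := by
  have h1 : ∀ x, (∑ k, v k * c k x) ^ 2 = ∑ k, ∑ l, v k * (c k x * c l x * v l) := by
    intro x
    rw [pow_two, Finset.sum_mul_sum]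
    refine Finset.sum_congr rfl fun k _ => Finset.sum_congr rfl fun l _ => by ring
  simp_rw [h1]
  rw [intervalIntegral.integral_finsetSum fun k _ =>
    (by fun_prop : Continuous _).intervalIntegrable _ _]
  simp only [dotProduct, mulVec, gramMat, Matrix.of_apply]
  refine Finset.sum_congr rfl fun k _ => ?_
  rw [intervalIntegral.integral_finsetSum fun l _ =>
    (by fun_prop : Continuous _).intervalIntegrable _ _, Finset.mul_sum]
  refine Finset.sum_congr rfl fun l _ => ?_
  rw [intervalIntegral.integral_const_mul, intervalIntegral.integral_mul_const]

theorem gramMat_isHermitian (c : m → ℝ → ℝ) (a b : ℝ) : (gramMat c a b).IsHermitian := by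
  rw [Matrix.IsHermitian, Matrix.conjTranspose_eq_transpose_of_trivial, gramMat_transpose]

theorem gramMat_posSemidef (hc : ∀ k, Continuous (c k)) (hab : a ≤ b) :
    (gramMat c a b).PosSemidef := by
  refine Matrix.PosSemidef.of_dotProduct_mulVec_nonneg (gramMat_isHermitian c a b) fun v => ?_
  rw [star_trivial, dotProduct_gramMat_mulVec hc]
  exact intervalIntegral.integral_nonneg hab fun x _ => sq_nonneg _

theorem integral_finKer_mul (hc : ∀ k, Continuous (c k)) (hab : a ≤ b) {g : ℝ → ℂ}
    (hg : ContinuousOn g (Icc a b)) (x : ℝ) :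
    ∫ y in a..b, (finKer c x y : ℂ) * g y = cvec c x ⬝ᵥ moment c a b g := by
  have : ∀ y, (finKer c x y : ℂ) * g y = ∑ k, (c k x : ℂ) * ((c k y : ℂ) * g y) := by
    intro y
    simp only [finKer, Complex.ofReal_sum, Complex.ofReal_mul, Finset.sum_mul, mul_assoc]
  simp_rw [this]
  rw [intervalIntegral.integral_finsetSum fun k _ =>
    (intervalIntegrable_mul_continuousOn (hc k) hab hg).const_mul _]
  simp [dotProduct, cvec, moment, intervalIntegral.integral_const_mul]

theorem continuous_cvec_dotProduct (hc : ∀ k, Continuous (c k)) (w : m → ℂ) :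
    Continuous fun x => cvec c x ⬝ᵥ w := by
  unfold cvec dotProduct
  fun_prop

theorem moment_cvec_dotProduct (hc : ∀ k, Continuous (c k)) (w : m → ℂ) :
    moment c a b (fun x => cvec c x ⬝ᵥ w) = (gramMat c a b).map Complex.ofRealHom *ᵥ w := by
  ext k
  simp only [moment, dotProduct, cvec, mulVec, Finset.mul_sum, gramMat, Matrix.map_apply,
    Matrix.of_apply]
  rw [intervalIntegral.integral_finsetSum fun k _ =>
        (by fun_prop : Continuous _).intervalIntegrable _ _]
  refine Finset.sum_congr rfl fun l _ => ?_
  simp only [← mul_assoc]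
  rw [intervalIntegral.integral_mul_const]
  congr 1
  simp only [← Complex.ofReal_mul, Complex.ofRealHom_eq_coe]
  exact intervalIntegral.integral_ofReal

theorem moment_congr (hab : a ≤ b) {f g : ℝ → ℂ} (h : ∀ x ∈ Icc a b, f x = g x) :
    moment c a b f = moment c a b g := by
  ext k
  refine intervalIntegral.integral_congr fun x hx => ?_
  rw [uIcc_of_le hab] at hx
  simp only [h x hx]

theorem moment_add (hc : ∀ k, Continuous (c k)) (hab : a ≤ b) {f g : ℝ → ℂ}
    (hf : ContinuousOn f (Icc a b)) (hg : ContinuousOn g (Icc a b)) :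
    moment c a b (fun x => f x + g x) = moment c a b f + moment c a b g := by
  ext k
  simp only [moment, mul_add, Pi.add_apply]
  exact intervalIntegral.integral_add (intervalIntegrable_mul_continuousOn (hc k) hab hf)
    (intervalIntegrable_mul_continuousOn (hc k) hab hg)

/-- After one application of the kernel the function lies in the span of the `c k`, where the
operator acts as the Gram matrix; hence power `n` at index `n + 1`. -/
theorem neumannTerm_succ_finKer (hc : ∀ k, Continuous (c k)) (hab : a ≤ b) {f : ℝ → ℂ}
    (hf : ContinuousOn f (Icc a b)) (n : ℕ) :
    neumannTerm (finKer c) a b f (n + 1) =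
      fun x => cvec c x ⬝ᵥ ((gramMat c a b) ^ n).map Complex.ofRealHom *ᵥ moment c a b f := by
  induction n with
  | zero =>
    funext x
    simp only [neumannTerm, pow_zero]
    rw [integral_finKer_mul hc hab hf, Matrix.map_one _ (map_zero _) (map_one _), one_mulVec]
  | succ n ih =>
    funext x
    rw [neumannTerm, ih]
    beta_reduce
    rw [integral_finKer_mul hc hab (continuous_cvec_dotProduct hc _).continuousOn,
      moment_cvec_dotProduct hc, mulVec_mulVec, pow_succ', Matrix.map_mul]

theorem hasSum_neumannTerm (hc : ∀ k, Continuous (c k)) (hab : a ≤ b)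
    (hpos : (1 - gramMat c a b).PosDef) {f : ℝ → ℂ} (hf : ContinuousOn f (Icc a b)) (x : ℝ) :
    HasSum (fun n => neumannTerm (finKer c) a b f n x) (resApply c a b f x) := by
  -- The zeroth term `f` need not lie in the span and is split off.
  rw [← hasSum_nat_add_iff' 1]
  have h0 : neumannTerm (finKer c) a b f 0 x = f x := rfl
  rw [Finset.range_one, Finset.sum_singleton, h0, resApply, add_sub_cancel_left]
  simp only [neumannTerm_succ_finKer hc hab hf]
  have hG := hasSum_pow_of_posSemidef (gramMat_posSemidef hc hab) hpos
  simp only [dotProduct, mulVec, Matrix.map_apply]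
  refine hasSum_sum fun k _ => HasSum.mul_left _ <| hasSum_sum fun l _ => HasSum.mul_right _ ?_
  have h1 := (Pi.hasSum.mp ((Pi.hasSum.mp hG) k)) l
  exact Complex.hasSum_ofReal.mpr h1

theorem resolventApply_finKer (hc : ∀ k, Continuous (c k)) (hab : a ≤ b)
    (hpos : (1 - gramMat c a b).PosDef) {f : ℝ → ℂ} (hf : ContinuousOn f (Icc a b)) :
    resolventApply (finKer c) a b f = resApply c a b f :=
  funext fun x => (hasSum_neumannTerm hc hab hpos hf x).tsum_eq

theorem mul_resMat (hpos : (1 - gramMat c a b).PosDef) :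
    (1 - gramMat c a b) * resMat c a b = 1 :=
  Matrix.mul_nonsing_inv _ (isUnit_iff_ne_zero.mpr hpos.det_pos.ne')

theorem resMat_mul (hpos : (1 - gramMat c a b).PosDef) :
    resMat c a b * (1 - gramMat c a b) = 1 :=
  Matrix.nonsing_inv_mul _ (isUnit_iff_ne_zero.mpr hpos.det_pos.ne')

theorem map_mul_resMat (hpos : (1 - gramMat c a b).PosDef) :
    (resMat c a b).map Complex.ofRealHom -
      (gramMat c a b).map Complex.ofRealHom * (resMat c a b).map Complex.ofRealHom = 1 := by
  have h := congrArg (fun A => A.map Complex.ofRealHom) (mul_resMat hpos)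
  simpa only [sub_mul, one_mul, Matrix.map_sub _ (map_sub Complex.ofRealHom), Matrix.map_mul,
    Matrix.map_one _ (map_zero Complex.ofRealHom) (map_one _)] using h

theorem map_resMat_mul (hpos : (1 - gramMat c a b).PosDef) :
    (resMat c a b).map Complex.ofRealHom -
      (resMat c a b).map Complex.ofRealHom * (gramMat c a b).map Complex.ofRealHom = 1 := by
  have h := congrArg (fun A => A.map Complex.ofRealHom) (resMat_mul hpos)
  simpa only [mul_sub, mul_one, Matrix.map_sub _ (map_sub Complex.ofRealHom), Matrix.map_mul,
    Matrix.map_one _ (map_zero Complex.ofRealHom) (map_one _)] using h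

theorem continuousOn_resApply (hc : ∀ k, Continuous (c k)) {f : ℝ → ℂ} {s : Set ℝ}
    (hf : ContinuousOn f s) : ContinuousOn (resApply c a b f) s :=
  hf.add (continuous_cvec_dotProduct hc _).continuousOn

/-- The moments of the correction are `G (1 - G)⁻¹ m(f)`, and `1 + G (1 - G)⁻¹ = (1 - G)⁻¹`. -/
theorem moment_resApply (hc : ∀ k, Continuous (c k)) (hab : a ≤ b)
    (hpos : (1 - gramMat c a b).PosDef) {f : ℝ → ℂ} (hf : ContinuousOn f (Icc a b)) :
    moment c a b (resApply c a b f) = (resMat c a b).map Complex.ofRealHom *ᵥ moment c a b f := by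
  unfold resApply
  rw [moment_add hc hab hf (continuous_cvec_dotProduct hc _).continuousOn,
    moment_cvec_dotProduct hc, mulVec_mulVec]
  conv_lhs => rw [← one_mulVec (moment c a b f), ← map_mul_resMat hpos, mulVec_mulVec]
  rw [← add_mulVec]
  congr 1
  have := map_mul_resMat hpos
  rw [this, mul_one, ← map_mul_resMat hpos]
  abel

theorem resApply_solves (hc : ∀ k, Continuous (c k)) (hab : a ≤ b)
    (hpos : (1 - gramMat c a b).PosDef) {f : ℝ → ℂ} (hf : ContinuousOn f (Icc a b)) (x : ℝ) :
    resApply c a b f x - ∫ y in a..b, (finKer c x y : ℂ) * resApply c a b f y = f x := by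
  rw [integral_finKer_mul hc hab (continuousOn_resApply hc hf), moment_resApply hc hab hpos hf]
  simp [resApply]

/-- Taking moments of `g = f + K g` gives `(1 - G) m(g) = m(f)`. So `m(g)` is determined by `f`, and
with it `g`. -/
theorem eq_resApply (hc : ∀ k, Continuous (c k)) (hab : a ≤ b)
    (hpos : (1 - gramMat c a b).PosDef) {f g : ℝ → ℂ} (hf : ContinuousOn f (Icc a b))
    (hg : ContinuousOn g (Icc a b))
    (h : ∀ x ∈ Icc a b, g x - ∫ y in a..b, (finKer c x y : ℂ) * g y = f x) :
    ∀ x ∈ Icc a b, g x = resApply c a b f x := by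
  simp_rw [integral_finKer_mul hc hab hg] at h
  have h1 : ∀ x ∈ Icc a b, g x = f x + cvec c x ⬝ᵥ moment c a b g := fun x hx => by
    rw [← h x hx]; ring
  have h2 := moment_congr (c := c) hab h1
  rw [moment_add hc hab hf (continuous_cvec_dotProduct hc _).continuousOn,
    moment_cvec_dotProduct hc] at h2
  have h3 : (resMat c a b).map Complex.ofRealHom *ᵥ moment c a b f = moment c a b g := by
    have h4 : moment c a b f =
        moment c a b g - (gramMat c a b).map Complex.ofRealHom *ᵥ moment c a b g :=
      eq_sub_of_add_eq h2.symm
    rw [h4, mulVec_sub, mulVec_mulVec, ← sub_mulVec, map_resMat_mul hpos, one_mulVec]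
  intro x hx
  rw [h1 x hx, resApply, h3]

theorem neumannInverts_finKer (hc : ∀ k, Continuous (c k)) (hab : a ≤ b)
    (hpos : (1 - gramMat c a b).PosDef) : NeumannInverts (finKer c) a b := by
  intro f hf
  rw [resolventApply_finKer hc hab hpos hf]
  exact ⟨fun x _ => (hasSum_neumannTerm hc hab hpos hf x).summable, continuousOn_resApply hc hf,
    fun x _ => resApply_solves hc hab hpos hf x, fun g hg h => eq_resApply hc hab hpos hf hg h⟩

end FiniteRank

/-! ### The Dirichlet kernel and the sampling basis -/

section Dirichlet

open Complex (I)

/-- The frequencies run from `-(N-1)/2` to `(N-1)/2` in unit steps, symmetrically about `0`; this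
keeps the Dirichlet kernel real and even. They are half-integers for even `N`. -/
noncomputable def freq (N a : ℕ) : ℝ := a - ((N : ℝ) - 1) / 2

noncomputable def dirichletKer (N : ℕ) (x : ℝ) : ℝ :=
  ∑ a ∈ Finset.range N, Real.cos (freq N a * x)

noncomputable def node (N k : ℕ) : ℝ := 2 * π * k / N

theorem dirichletKer_neg (N : ℕ) (x : ℝ) : dirichletKer N (-x) = dirichletKer N x := by
  simp [dirichletKer]

theorem dirichletKer_zero (N : ℕ) : dirichletKer N 0 = N := by
  simp [dirichletKer]

theorem continuous_dirichletKer (N : ℕ) : Continuous (dirichletKer N) := by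
  unfold dirichletKer; fun_prop

theorem sum_sin_freq (N : ℕ) (x : ℝ) :
    ∑ a ∈ Finset.range N, Real.sin (freq N a * x) = 0 := by
  have h := Finset.sum_range_reflect (fun a => Real.sin (freq N a * x)) N
  have h2 : ∑ a ∈ Finset.range N, Real.sin (freq N (N - 1 - a) * x) =
      -∑ a ∈ Finset.range N, Real.sin (freq N a * x) := by
    rw [← Finset.sum_neg_distrib]
    refine Finset.sum_congr rfl fun a ha => ?_
    have ha' := Finset.mem_range.mp ha
    rw [← Real.sin_neg]
    congr 1
    have : ((N - 1 - a : ℕ) : ℝ) = (N : ℝ) - 1 - a := by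
      rw [Nat.cast_sub (by omega), Nat.cast_sub (by omega)]; simp
    rw [freq, freq, this]; ring
  linarith

theorem dirichletKer_eq_sum_exp (N : ℕ) (x : ℝ) :
    (dirichletKer N x : ℂ) = ∑ a ∈ Finset.range N, Complex.exp (I * (freq N a * x : ℝ)) := by
  have : ∀ a, Complex.exp (I * (freq N a * x : ℝ)) =
      (Real.cos (freq N a * x) : ℂ) + (Real.sin (freq N a * x) : ℂ) * I := by
    intro a
    rw [mul_comm, Complex.exp_mul_I]; push_cast; rfl
  simp_rw [this]
  rw [Finset.sum_add_distrib, ← Finset.sum_mul, ← Complex.ofReal_sum, ← Complex.ofReal_sum,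
    sum_sin_freq]
  simp [dirichletKer]

theorem two_mul_sin_mul_dirichletKer (N : ℕ) (x : ℝ) :
    Real.sin (x / 2) * dirichletKer N x = Real.sin (N * x / 2) := by
  have h : ∀ a : ℕ, 2 * (Real.sin (x / 2) * Real.cos (freq N a * x)) =
      Real.sin ((((a + 1 : ℕ) : ℝ) - N / 2) * x) - Real.sin (((a : ℝ) - N / 2) * x) := by
    intro a
    rw [Real.sin_sub_sin]
    rw [show ((((a + 1 : ℕ) : ℝ) - N / 2) * x - ((a : ℝ) - N / 2) * x) / 2 = x / 2 by
      push_cast; ring]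
    rw [show ((((a + 1 : ℕ) : ℝ) - N / 2) * x + ((a : ℝ) - N / 2) * x) / 2 = freq N a * x by
      rw [freq]; push_cast; ring]
    ring
  have h2 : 2 * (Real.sin (x / 2) * dirichletKer N x) = 2 * Real.sin (N * x / 2) := by
    rw [dirichletKer, Finset.mul_sum, Finset.mul_sum]
    simp_rw [h]
    rw [Finset.sum_range_sub (fun a : ℕ => Real.sin (((a : ℝ) - N / 2) * x))]
    rw [show ((0 : ℕ) - (N : ℝ) / 2) * x = -(((N : ℝ) - N / 2) * x) by push_cast; ring,
      Real.sin_neg, show ((N : ℝ) - N / 2) * x = N * x / 2 by ring]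
    ring
  linarith

theorem cueKernel_eq (N : ℕ) (x y : ℝ) :
    cueKernel N x y = dirichletKer N (x - y) / (2 * π) := by
  unfold cueKernel
  split_ifs with h
  · obtain ⟨j, hj⟩ := Real.sin_eq_zero_iff.mp h
    have hx : x - y = 2 * (j * π) := by rw [hj]; ring
    have hcos : Real.cos ((x - y) / 2) ≠ 0 := by
      intro h0
      have := Real.sin_sq_add_cos_sq ((x - y) / 2)
      rw [h, h0] at this
      norm_num at this
    -- At a removable point `cos ((x - y)/2) = ±1`, and all summands of the Dirichlet kernel
    -- coincide there up to this sign.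
    have hterm : ∀ a : ℕ, Real.cos (freq N a * (x - y)) * Real.cos ((x - y) / 2) =
        Real.cos (N * (x - y) / 2) := by
      intro a
      have h1 : freq N a * (x - y) = (x - y) / 2 - N * (x - y) / 2 + ((a : ℤ) * j : ℤ) * (2 * π) := by
        rw [freq, hx]; push_cast; ring
      rw [h1, Real.cos_add_int_mul_two_pi, Real.cos_sub, h]
      have := Real.sin_sq_add_cos_sq ((x - y) / 2)
      rw [h] at this
      linear_combination Real.cos (N * (x - y) / 2) * this
    have hs : dirichletKer N (x - y) * Real.cos ((x - y) / 2) = N * Real.cos (N * (x - y) / 2) := by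
      rw [dirichletKer, Finset.sum_mul]
      simp_rw [hterm]
      simp
    rw [← hs]
    field_simp
  · rw [← two_mul_sin_mul_dirichletKer]
    field_simp

/-- A sum over the powers of an `N`-th root of unity; `|d| < N` ensures that the root is `1` only
for `d = 0`. -/
theorem sum_exp_node (N : ℕ) (d : ℤ) (hd : |d| < N) :
    ∑ k ∈ Finset.range N, Complex.exp (I * (d * node N k : ℝ)) = if d = 0 then (N : ℂ) else 0 := by
  have hN : (N : ℂ) ≠ 0 := by
    have : 0 < N := by exact_mod_cast (abs_nonneg d).trans_lt hd
    exact_mod_cast this.ne'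
  split_ifs with h
  · simp [h]
  · set z := Complex.exp (2 * π * I * (d / N : ℂ)) with hz
    have hpow : ∀ k : ℕ, Complex.exp (I * (d * node N k : ℝ)) = z ^ k := by
      intro k
      rw [hz, ← Complex.exp_nat_mul, node]
      congr 1
      push_cast
      field_simp
    simp_rw [hpow]
    have hz1 : z ≠ 1 := by
      intro h1
      rw [hz, Complex.exp_eq_one_iff] at h1
      obtain ⟨j, hj⟩ := h1
      have h2 : (d : ℂ) = j * N := by
        have h3 := mul_left_cancel₀ (by simp [Real.pi_ne_zero] : (2 * π * I : ℂ) ≠ 0)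
          (hj.trans (mul_comm _ _))
        field_simp at h3
        rw [h3, mul_comm]
      have h4 : d = j * N := by exact_mod_cast h2
      rcases eq_or_ne j 0 with rfl | hj0
      · exact h (by simpa using h4)
      · rw [h4, abs_mul] at hd
        have : (1 : ℤ) ≤ |j| := Int.one_le_abs hj0
        have h5 : |(N : ℤ)| = N := abs_of_nonneg (by positivity)
        rw [h5] at hd
        nlinarith
    have hzN : z ^ N = 1 := by
      rw [hz, ← Complex.exp_nat_mul, Complex.exp_eq_one_iff]
      exact ⟨d, by field_simp⟩
    rw [geom_sum_eq hz1, hzN, sub_self, zero_div]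

theorem dirichletKer_node_sub_node {N j k : ℕ} (hj : j < N) (hk : k < N) :
    dirichletKer N (node N j - node N k) = if j = k then (N : ℝ) else 0 := by
  rw [← Complex.ofReal_inj, dirichletKer_eq_sum_exp]
  have h := sum_exp_node N ((j : ℤ) - k) (by rw [abs_lt]; constructor <;> omega)
  have hterm : ∀ a : ℕ, Complex.exp (I * (freq N a * (node N j - node N k) : ℝ)) =
      Complex.exp (-I * (((N : ℝ) - 1) / 2 * (node N j - node N k) : ℝ)) *
        Complex.exp (I * ((((j : ℤ) - k : ℤ) : ℝ) * node N a : ℝ)) := by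
    intro a
    rw [← Complex.exp_add]
    congr 1
    rw [freq, node, node, node]
    push_cast
    ring
  simp_rw [hterm]
  rw [← Finset.mul_sum, h]
  by_cases hjk : j = k
  · simp [hjk]
  · have : ((j : ℤ) - k) ≠ 0 := by omega
    simp [hjk, this]

/-- The sampling formula: the `N`-point quadrature at the nodes is exact here because differences of
frequencies are integers smaller than `N` in modulus. -/
theorem sum_dirichletKer_node (N : ℕ) (x y : ℝ) :
    ∑ k ∈ Finset.range N, dirichletKer N (x - node N k) * dirichletKer N (node N k - y) =
      N * dirichletKer N (x - y) := by
  rw [← Complex.ofReal_inj]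
  push_cast
  simp_rw [dirichletKer_eq_sum_exp, Finset.sum_mul_sum]
  rw [Finset.sum_comm, Finset.mul_sum]
  refine Finset.sum_congr rfl fun a ha => ?_
  rw [Finset.sum_comm]
  have hterm : ∀ b k : ℕ, Complex.exp (I * (freq N a * (x - node N k) : ℝ)) *
      Complex.exp (I * (freq N b * (node N k - y) : ℝ)) =
      Complex.exp (I * (freq N a * x - freq N b * y : ℝ)) *
        Complex.exp (I * ((((b : ℤ) - a : ℤ) : ℝ) * node N k : ℝ)) := by
    intro b k
    rw [← Complex.exp_add, ← Complex.exp_add]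
    congr 1
    rw [freq, freq]
    push_cast
    ring
  simp_rw [hterm, ← Finset.mul_sum]
  rw [Finset.sum_eq_single a]
  · rw [sum_exp_node N _ (by
      have := Finset.mem_range.mp ha
      simp; omega)]
    simp [mul_sub]
    ring
  · intro b hb hba
    have h1 := Finset.mem_range.mp ha
    have h2 := Finset.mem_range.mp hb
    rw [sum_exp_node N _ (by rw [abs_lt]; constructor <;> omega),
      if_neg (by omega), mul_zero]
  · intro h; exact absurd ha h

theorem integral_exp_int_mul (d : ℤ) :
    ∫ x in (-π)..π, Complex.exp (I * (d * x : ℝ)) = if d = 0 then (2 * π : ℂ) else 0 := by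
  split_ifs with h
  · simp [h]; ring
  · have hc : (I * d : ℂ) ≠ 0 := mul_ne_zero Complex.I_ne_zero (by exact_mod_cast h)
    have h1 : ∀ x : ℝ, Complex.exp (I * (d * x : ℝ)) = Complex.exp (I * d * x) := by
      intro x; congr 1; push_cast; ring
    simp_rw [h1]
    rw [integral_exp_mul_complex hc, div_eq_zero_iff]
    left
    rw [sub_eq_zero, Complex.exp_eq_exp_iff_exists_int]
    exact ⟨d, by push_cast; ring⟩

theorem integral_dirichletKer_mul (N : ℕ) (α β : ℝ) :
    ∫ x in (-π)..π, dirichletKer N (x - α) * dirichletKer N (x - β) =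
      2 * π * dirichletKer N (α - β) := by
  rw [← Complex.ofReal_inj, ← intervalIntegral.integral_ofReal]
  have hexp : ∀ x : ℝ, ((dirichletKer N (x - α) * dirichletKer N (x - β) : ℝ) : ℂ) =
      ∑ a ∈ Finset.range N, ∑ b ∈ Finset.range N,
        Complex.exp (I * (freq N b * (α - β) + (freq N a - freq N b) * α : ℝ)) *
          Complex.exp (I * ((((b : ℤ) - a : ℤ) : ℝ) * x : ℝ)) := by
    intro x
    rw [← dirichletKer_neg N (x - α), Complex.ofReal_mul, dirichletKer_eq_sum_exp,
      dirichletKer_eq_sum_exp, Finset.sum_mul_sum]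
    refine Finset.sum_congr rfl fun a _ => Finset.sum_congr rfl fun b _ => ?_
    rw [← Complex.exp_add, ← Complex.exp_add]
    congr 1
    simp only [freq]
    push_cast
    ring
  simp_rw [hexp]
  rw [intervalIntegral.integral_finsetSum fun a _ =>
        (by fun_prop : Continuous _).intervalIntegrable _ _]
  push_cast
  rw [dirichletKer_eq_sum_exp, Finset.mul_sum]
  refine Finset.sum_congr rfl fun a ha => ?_
  rw [intervalIntegral.integral_finsetSum fun b _ =>
        (by fun_prop : Continuous _).intervalIntegrable _ _]
  rw [Finset.sum_eq_single a]
  · rw [intervalIntegral.integral_const_mul]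
    have := integral_exp_int_mul ((a : ℤ) - a)
    push_cast at this
    rw [this]
    simp
    ring
  · intro b _ hba
    rw [intervalIntegral.integral_const_mul]
    have := integral_exp_int_mul ((b : ℤ) - a)
    push_cast at this
    rw [this, if_neg (by omega), mul_zero]
  · intro h; exact absurd ha h

/-- The functions `K(x, 2π(k+1)/N) / √(N/2π)`, an orthonormal basis of the space onto which the
conditioned kernel projects. -/
noncomputable def cueBasis (N : ℕ) (k : Fin (N - 1)) (x : ℝ) : ℝ :=
  (√(2 * π * N))⁻¹ * dirichletKer N (x - node N (k + 1))

theorem continuous_cueBasis (N : ℕ) (k : Fin (N - 1)) : Continuous (cueBasis N k) := by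
  unfold cueBasis
  have := continuous_dirichletKer N
  fun_prop

theorem condKernel_eq (N : ℕ) (x y : ℝ) :
    condKernel N x y =
      (dirichletKer N (x - y) - dirichletKer N x * dirichletKer N y / N) / (2 * π) := by
  rw [condKernel, cueKernel_eq, cueKernel_eq, cueKernel_eq, cueKernel_eq]
  simp only [sub_zero, dirichletKer_zero, zero_sub, dirichletKer_neg]
  have := Real.pi_ne_zero
  rcases eq_or_ne (N : ℝ) 0 with h | h
  · simp [h]
  · field_simp

/-- In the sampling formula the node `0` contributes `D(x) D(y)`, with `D = dirichletKer N`, which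
is precisely what conditioning subtracts; the other nodes give the basis. -/
theorem condKernel_eq_finKer {N : ℕ} (hN : 1 ≤ N) : condKernel N = finKer (cueBasis N) := by
  funext x y
  have hN0 : (N : ℝ) ≠ 0 := by positivity
  have h := sum_dirichletKer_node N x y
  obtain ⟨n, rfl⟩ : ∃ n, N = n + 1 := ⟨N - 1, by omega⟩
  rw [Finset.sum_range_succ', Finset.sum_range] at h
  have h0 : node (n + 1) 0 = 0 := by simp [node]
  rw [h0, sub_zero, zero_sub, dirichletKer_neg] at h
  rw [condKernel_eq, finKer]
  simp only [cueBasis]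
  have hs : (√(2 * π * (n + 1 : ℕ)))⁻¹ * (√(2 * π * (n + 1 : ℕ)))⁻¹ =
      (2 * π * (n + 1 : ℕ))⁻¹ := by
    rw [← mul_inv, Real.mul_self_sqrt (by positivity)]
  have hterm : ∀ k : Fin n, (√(2 * π * (n + 1 : ℕ)))⁻¹ *
        dirichletKer (n + 1) (x - node (n + 1) (k + 1)) *
      ((√(2 * π * (n + 1 : ℕ)))⁻¹ * dirichletKer (n + 1) (y - node (n + 1) (k + 1))) =
      (2 * π * (n + 1 : ℕ))⁻¹ * (dirichletKer (n + 1) (x - node (n + 1) (k + 1)) *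
        dirichletKer (n + 1) (node (n + 1) (k + 1) - y)) := by
    intro k
    rw [← hs, ← dirichletKer_neg _ (y - _), neg_sub]
    ring
  have hsum := Finset.sum_congr (rfl : (Finset.univ : Finset (Fin n)) = _) fun k _ => hterm k
  refine Eq.trans ?_ hsum.symm
  rw [← Finset.mul_sum, eq_sub_of_add_eq h]
  have := Real.pi_ne_zero
  field_simp

theorem gramMat_cueBasis_full (N : ℕ) : gramMat (cueBasis N) (-π) π = 1 := by
  ext k l
  have hN : (0 : ℝ) < N := by
    have := k.2
    exact_mod_cast (by omega : 0 < N)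
  simp only [gramMat, cueBasis, Matrix.of_apply]
  have h1 : ∀ x : ℝ, (√(2 * π * N))⁻¹ * dirichletKer N (x - node N (k + 1)) *
      ((√(2 * π * N))⁻¹ * dirichletKer N (x - node N (l + 1))) =
      (2 * π * N)⁻¹ * (dirichletKer N (x - node N (k + 1)) *
        dirichletKer N (x - node N (l + 1))) := by
    intro x
    have hs : (√(2 * π * N))⁻¹ * (√(2 * π * N))⁻¹ = (2 * π * N)⁻¹ := by
      rw [← mul_inv, Real.mul_self_sqrt (by positivity)]
    rw [← hs]; ring
  simp_rw [h1]
  rw [intervalIntegral.integral_const_mul, integral_dirichletKer_mul,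
    dirichletKer_node_sub_node (by omega) (by omega), Matrix.one_apply]
  have := Real.pi_pos
  by_cases hkl : k = l
  · simp only [hkl, if_true]; field_simp
  · rw [if_neg hkl, if_neg (by simpa [Fin.ext_iff] using hkl)]; simp

theorem analyticOnNhd_dirichletKer (N : ℕ) (α : ℝ) :
    AnalyticOnNhd ℝ (fun x => dirichletKer N (x - α)) univ := by
  intro x _
  unfold dirichletKer
  fun_prop

/-- Each basis function vanishes at every node but its own, so nodal values recover the
coefficients. This gives linear independence. -/
theorem sum_cueBasis_node {N : ℕ} (v : Fin (N - 1) → ℝ) (j : Fin (N - 1)) :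
    ∑ k, v k * cueBasis N k (node N (j + 1)) = v j * ((√(2 * π * N))⁻¹ * N) := by
  rw [Finset.sum_eq_single j]
  · rw [cueBasis, dirichletKer_node_sub_node (by omega) (by omega), if_pos rfl]
  · intro k _ hk
    rw [cueBasis, dirichletKer_node_sub_node (by omega) (by omega), if_neg, mul_zero, mul_zero]
    intro h
    exact hk (Fin.ext (by omega))
  · simp

theorem gramMat_add_adjacent {m : Type*} {c : m → ℝ → ℝ} (hc : ∀ k, Continuous (c k))
    (a b d : ℝ) : gramMat c a b + gramMat c b d = gramMat c a d := by
  ext k l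
  simp only [gramMat, Matrix.add_apply, Matrix.of_apply]
  exact intervalIntegral.integral_add_adjacent_intervals
    (((hc k).mul (hc l)).intervalIntegrable _ _) (((hc k).mul (hc l)).intervalIntegrable _ _)

theorem one_sub_gramMat_cueBasis (N : ℕ) (t : ℝ) :
    1 - gramMat (cueBasis N) (-t) t =
      gramMat (cueBasis N) (-π) (-t) + gramMat (cueBasis N) t π := by
  rw [← gramMat_cueBasis_full, ← gramMat_add_adjacent (continuous_cueBasis N) (-π) (-t) π,
    ← gramMat_add_adjacent (continuous_cueBasis N) (-t) t π]
  abel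

/-- If the quadratic form were not positive at `v`, the combination `∑ v k c_k` would vanish on `(t,
π)`, hence everywhere by analyticity, and its values at the nodes would force `v = 0`. -/
theorem posDef_one_sub_gramMat {N : ℕ} {t : ℝ} (ht : t < π) :
    (1 - gramMat (cueBasis N) (-t) t).PosDef := by
  have hc := continuous_cueBasis N
  refine Matrix.PosDef.of_dotProduct_mulVec_pos
    (Matrix.isHermitian_one.sub (gramMat_isHermitian _ _ _)) fun v hv => ?_
  rw [one_sub_gramMat_cueBasis, star_trivial, Matrix.add_mulVec, dotProduct_add,
    dotProduct_gramMat_mulVec hc, dotProduct_gramMat_mulVec hc]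
  refine add_pos_of_nonneg_of_pos
    (intervalIntegral.integral_nonneg (by linarith) fun x _ => sq_nonneg _) ?_
  set f : ℝ → ℝ := fun x => ∑ k, v k * cueBasis N k x with hf
  have hfc : Continuous f := by rw [hf]; fun_prop
  by_contra hneg
  have hzero : ∀ x ∈ Ioo t π, f x = 0 := by
    by_contra! hne
    obtain ⟨x, hx, hfx⟩ := hne
    refine hneg (intervalIntegral.integral_pos ht (by fun_prop) (fun y _ => sq_nonneg _)
      ⟨x, Ioo_subset_Icc_self hx, ?_⟩)
    exact sq_pos_of_ne_zero hfx
  have han : AnalyticOnNhd ℝ f univ := by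
    intro x _
    have h1 : ∀ k : Fin (N - 1), AnalyticAt ℝ (cueBasis N k) x := fun k =>
      analyticAt_const.mul (analyticOnNhd_dirichletKer N _ x (mem_univ x))
    exact Finset.analyticAt_fun_sum _ fun k _ => analyticAt_const.mul (h1 k)
  have hall : EqOn f 0 univ := by
    refine han.eqOn_zero_of_preconnected_of_eventuallyEq_zero isPreconnected_univ
      (mem_univ ((t + π) / 2)) ?_
    have h1 : t < (t + π) / 2 := by linarith
    have h2 : (t + π) / 2 < π := by linarith
    filter_upwards [Ioo_mem_nhds h1 h2] with x hx
    exact hzero x hx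
  refine hv (funext fun j => ?_)
  have h1 := hall (mem_univ (node N (j + 1)))
  simp only [hf, sum_cueBasis_node, Pi.zero_apply] at h1
  have hN : (0 : ℝ) < N := by
    have := j.2
    exact_mod_cast (by omega : 0 < N)
  have := Real.pi_pos
  have h2 : (√(2 * π * N))⁻¹ * (N : ℝ) ≠ 0 := by positivity
  simpa using (mul_eq_zero.mp h1).resolve_right h2

end Dirichlet

/-! ### The conditioned ensemble is the determinantal process of the sampling basis -/

section Ensemble

open Complex (I)

noncomputable def expMat {n : ℕ} (y : Fin n → ℝ) : Matrix (Fin n) (Fin n) ℂ :=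
  Matrix.of fun i a => Complex.exp (I * (freq n a * y i : ℝ))

/-- A unimodular factor taken out of each row, which shifts the frequencies to `0, …, n-1`, leaves a
Vandermonde determinant. -/
theorem norm_sq_det_expMat {n : ℕ} (y : Fin n → ℝ) : ‖(expMat y).det‖ ^ 2 = cueWeight y := by
  have h : expMat y = Matrix.of fun i a =>
      Complex.exp (I * (-(((n : ℝ) - 1) / 2) * y i : ℝ)) *
        Matrix.vandermonde (fun i => Complex.exp (I * (y i : ℂ))) i a := by
    ext i a
    simp only [expMat, Matrix.of_apply, Matrix.vandermonde_apply]
    rw [← Complex.exp_nat_mul, ← Complex.exp_add]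
    congr 1
    rw [freq]
    push_cast
    ring
  rw [h, Matrix.det_mul_column, norm_mul, norm_prod, Matrix.det_vandermonde, norm_prod]
  have h1 : ∀ i, ‖Complex.exp (I * (-(((n : ℝ) - 1) / 2) * y i : ℝ))‖ = 1 := by
    intro i
    rw [mul_comm]
    exact Complex.norm_exp_ofReal_mul_I _
  simp only [h1, Finset.prod_const_one, one_mul, norm_prod, cueWeight, ← Finset.prod_pow]
  refine Finset.prod_congr rfl fun i _ => Finset.prod_congr rfl fun j _ => ?_
  rw [norm_sub_rev]

theorem expMat_mul_conjTranspose {n : ℕ} (y z : Fin n → ℝ) :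
    expMat y * (expMat z).conjTranspose =
      Matrix.of fun i k => (dirichletKer n (y i - z k) : ℂ) := by
  ext i k
  rw [Matrix.mul_apply, Matrix.of_apply, dirichletKer_eq_sum_exp, Finset.sum_range]
  refine Finset.sum_congr rfl fun a _ => ?_
  simp only [expMat, Matrix.conjTranspose_apply, Matrix.of_apply]
  rw [Complex.star_def, ← Complex.exp_conj, ← Complex.exp_add]
  congr 1
  simp only [map_mul, Complex.conj_I, Complex.conj_ofReal]
  push_cast
  ring

theorem sq_det_dirichletKer {n : ℕ} (y z : Fin n → ℝ) :
    (Matrix.of fun i k => dirichletKer n (y i - z k)).det ^ 2 = cueWeight y * cueWeight z := by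
  have h := congrArg (fun A => ‖A.det‖ ^ 2) (expMat_mul_conjTranspose y z)
  simp only [Matrix.det_mul, norm_mul, mul_pow, Matrix.det_conjTranspose, norm_star,
    norm_sq_det_expMat] at h
  rw [h]
  have h2 : (Matrix.of fun i k => (dirichletKer n (y i - z k) : ℂ)) =
      (Matrix.of fun i k => dirichletKer n (y i - z k)).map Complex.ofRealHom := by
    ext i k; rfl
  rw [h2, ← RingHom.mapMatrix_apply, ← RingHom.map_det]
  simp

/-- In `sq_det_dirichletKer` take `z` to be the nodes. The row of the conditioned point `0` is then
`(N, 0, …, 0)`, and expanding along it leaves the determinant of the sampling basis. -/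
theorem exists_cueWeight_cons_eq {N : ℕ} (hN : 1 ≤ N) :
    ∃ C : ℝ, 0 < C ∧ ∀ x : Fin (N - 1) → ℝ,
      cueWeight (Fin.cons 0 x : Fin (N - 1 + 1) → ℝ) =
        C * (Matrix.of fun i k => cueBasis N k (x i)).det ^ 2 := by
  obtain ⟨n, rfl⟩ : ∃ n, N = n + 1 := ⟨N - 1, by omega⟩
  set z : Fin (n + 1) → ℝ := fun k => node (n + 1) k with hz
  have hN0 : (0 : ℝ) < ((n + 1 : ℕ) : ℝ) := by positivity
  have hzz : 0 < cueWeight z := by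
    have h := sq_det_dirichletKer z z
    have h1 : (Matrix.of fun i k => dirichletKer (n + 1) (z i - z k)) =
        Matrix.diagonal fun _ => ((n + 1 : ℕ) : ℝ) := by
      ext i k
      simp only [hz, Matrix.of_apply, Matrix.diagonal_apply]
      rw [dirichletKer_node_sub_node i.2 k.2]
      simp only [Fin.ext_iff]
    rw [h1, Matrix.det_diagonal, Finset.prod_const] at h
    have h2 : 0 ≤ cueWeight z := by unfold cueWeight; positivity
    refine lt_of_le_of_ne h2 fun h0 => ?_
    rw [← h0] at h
    have : 0 < ((((n + 1 : ℕ) : ℝ)) ^ (Finset.univ : Finset (Fin (n + 1))).card) ^ 2 := by positivity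
    rw [h] at this
    simp at this
  have hs : 0 < √(2 * π * (n + 1 : ℕ)) := by positivity
  -- `N` is the corner entry, the power of the square root undoes the normalisation of the `n` basis
  -- functions, and the weight of the nodes is divided out.
  refine ⟨(((n + 1 : ℕ) : ℝ) * (√(2 * π * (n + 1 : ℕ))) ^ n) ^ 2 / cueWeight z, by positivity, ?_⟩
  intro x
  change Fin n → ℝ at x
  have h := sq_det_dirichletKer (Fin.cons 0 x : Fin (n + 1) → ℝ) z
  have hdet : (Matrix.of fun i k =>
        dirichletKer (n + 1) ((Fin.cons 0 x : Fin (n + 1) → ℝ) i - z k)).det =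
      ((n + 1 : ℕ) : ℝ) * (√(2 * π * (n + 1 : ℕ))) ^ n *
        (Matrix.of fun (i k : Fin n) => cueBasis (n + 1) k (x i)).det := by
    rw [Matrix.det_succ_row_zero, Finset.sum_eq_single 0]
    · have h0 : dirichletKer (n + 1) ((Fin.cons 0 x : Fin (n + 1) → ℝ) 0 - z 0) =
          ((n + 1 : ℕ) : ℝ) := by
        simp [hz, node, dirichletKer_zero]
      rw [Matrix.of_apply, h0]
      have h1 : ((Matrix.of fun i k =>
            dirichletKer (n + 1) ((Fin.cons 0 x : Fin (n + 1) → ℝ) i - z k)).submatrix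
            Fin.succ (Fin.succAbove 0)) = (√(2 * π * (n + 1 : ℕ))) •
              (Matrix.of fun (i k : Fin n) => cueBasis (n + 1) k (x i)) := by
        ext i k
        simp only [Matrix.submatrix_apply, Matrix.of_apply, Matrix.smul_apply, smul_eq_mul,
          Fin.cons_succ, Fin.succAbove_zero, hz, cueBasis, Fin.val_succ]
        rw [← mul_assoc, mul_inv_cancel₀ hs.ne', one_mul]
      rw [h1, Matrix.det_smul]
      simp [mul_assoc]
    · intro k _ hk
      have h0 : dirichletKer (n + 1) ((Fin.cons 0 x : Fin (n + 1) → ℝ) 0 - z k) = 0 := by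
        have := dirichletKer_node_sub_node (N := n + 1) (j := 0) (by omega) k.2
        rw [if_neg (fun h => hk (Fin.ext h.symm))] at this
        simpa [node, hz] using this
      rw [Matrix.of_apply, h0]; simp
    · simp
  rw [hdet] at h
  have h' := eq_div_of_mul_eq hzz.ne' h.symm
  refine h'.trans ?_
  change _ = _ * (Matrix.of fun (i k : Fin n) => cueBasis (n + 1) k (x i)).det ^ 2
  rw [mul_pow]
  ring

theorem cueCondWeightMeasure_pi {N : ℕ} {C : ℝ} (hC : 0 < C)
    (hw : ∀ x : Fin (N - 1) → ℝ, cueWeight (Fin.cons 0 x : Fin (N - 1 + 1) → ℝ) =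
        C * (Matrix.of fun i k => cueBasis N k (x i)).det ^ 2)
    {A : Set ℝ} (hA : MeasurableSet A) :
    cueCondWeightMeasure N (univ.pi fun _ => A) =
      ENNReal.ofReal (C * ((N - 1).factorial *
        (Matrix.of fun k l => ∫ x in Ioc (-π) π ∩ A, cueBasis N k x * cueBasis N l x).det)) := by
  have hmA : MeasurableSet (univ.pi fun _ : Fin (N - 1) => A) :=
    MeasurableSet.univ_pi fun _ => hA
  have hint : ∀ (B : Set ℝ) (k l : Fin (N - 1)), B ⊆ Ioc (-π) π →
      Integrable (fun x => cueBasis N k x * cueBasis N l x) (volume.restrict B) := by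
    intro B k l hB
    have h1 : IntegrableOn (fun x => cueBasis N k x * cueBasis N l x) (Icc (-π) π) :=
      ((continuous_cueBasis N k).mul (continuous_cueBasis N l)).continuousOn.integrableOn_compact
        isCompact_Icc
    exact h1.mono_set (hB.trans Ioc_subset_Icc_self)
  have hcont : Continuous fun x : Fin (N - 1) → ℝ =>
      C * (Matrix.of fun i k => cueBasis N k (x i)).det ^ 2 := by
    refine continuous_const.mul (Continuous.pow (Continuous.matrix_det ?_) 2)
    refine continuous_matrix fun i k => ?_
    exact (continuous_cueBasis N k).comp (continuous_apply i)
  rw [cueCondWeightMeasure, withDensity_apply _ hmA, Measure.restrict_restrict hmA,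
    ← Set.pi_inter_distrib, inter_comm A]
  simp_rw [hw]
  rw [← ofReal_integral_eq_lintegral_ofReal, integral_const_mul, volume_pi,
    Measure.restrict_pi_pi, integral_det_sq]
  · exact fun k l => hint _ k l inter_subset_left
  · have h1 : IntegrableOn (fun x : Fin (N - 1) → ℝ =>
        C * (Matrix.of fun i k => cueBasis N k (x i)).det ^ 2)
        (univ.pi fun _ => Icc (-π) π) :=
      hcont.continuousOn.integrableOn_compact (isCompact_univ_pi fun _ => isCompact_Icc)
    exact h1.mono_set (Set.pi_mono fun _ _ => inter_subset_left.trans Ioc_subset_Icc_self)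
  · exact ae_of_all _ fun x => by positivity

/-- The full Gram matrix is the identity, so the total mass is `C (N-1)!`, which cancels the
constant from Andréief's identity. -/
theorem cueCondLaw_pi {N : ℕ} (hN : 1 ≤ N) {A : Set ℝ} (hA : MeasurableSet A) :
    cueCondLaw N (univ.pi fun _ => A) = ENNReal.ofReal
      (Matrix.of fun k l => ∫ x in Ioc (-π) π ∩ A, cueBasis N k x * cueBasis N l x).det := by
  obtain ⟨C, hC, hw⟩ := exists_cueWeight_cons_eq hN
  have huniv : cueCondWeightMeasure N univ = ENNReal.ofReal (C * (N - 1).factorial) := by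
    have h := cueCondWeightMeasure_pi hC hw MeasurableSet.univ
    rw [pi_univ] at h
    rw [h]
    have h1 : (Matrix.of fun k l : Fin (N - 1) =>
        ∫ x in Ioc (-π) π ∩ univ, cueBasis N k x * cueBasis N l x) = 1 := by
      rw [← gramMat_cueBasis_full]
      ext k l
      simp only [gramMat, Matrix.of_apply, inter_univ]
      rw [intervalIntegral.integral_of_le (by linarith [Real.pi_pos])]
    rw [h1, Matrix.det_one, mul_one]
  have hpos : 0 < C * (N - 1).factorial := by positivity
  rw [cueCondLaw, Measure.smul_apply, huniv, cueCondWeightMeasure_pi hC hw hA, ← mul_assoc,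
    ENNReal.ofReal_mul hpos.le, smul_eq_mul, ← mul_assoc, ENNReal.inv_mul_cancel, one_mul]
  · simpa using hpos
  · exact ENNReal.ofReal_ne_top

theorem isProbabilityMeasure_cueCondLaw {N : ℕ} (hN : 1 ≤ N) :
    IsProbabilityMeasure (cueCondLaw N) := by
  constructor
  have h := cueCondLaw_pi hN MeasurableSet.univ
  rw [pi_univ] at h
  rw [h]
  have h1 : (Matrix.of fun k l : Fin (N - 1) =>
      ∫ x in Ioc (-π) π ∩ univ, cueBasis N k x * cueBasis N l x) = 1 := by
    rw [← gramMat_cueBasis_full]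
    ext k l
    simp only [gramMat, Matrix.of_apply, inter_univ]
    rw [intervalIntegral.integral_of_le (by linarith [Real.pi_pos])]
  rw [h1, Matrix.det_one, ENNReal.ofReal_one]

theorem condJanossy_eq_det {N : ℕ} (hN : 1 ≤ N) {t : ℝ} (h0 : 0 ≤ t) (ht : t < π) :
    condJanossy N (-t) t = (1 - gramMat (cueBasis N) (-t) t).det := by
  have hset : {x : Fin (N - 1) → ℝ | ∀ j, x j ∉ Icc (-t) t} = univ.pi fun _ => (Icc (-t) t)ᶜ := by
    ext x; simp [Set.mem_pi]
  have hG : (Matrix.of fun k l : Fin (N - 1) =>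
      ∫ x in Ioc (-π) π ∩ (Icc (-t) t)ᶜ, cueBasis N k x * cueBasis N l x) =
      1 - gramMat (cueBasis N) (-t) t := by
    rw [← gramMat_cueBasis_full]
    ext k l
    have hcont : Continuous fun x => cueBasis N k x * cueBasis N l x :=
      (continuous_cueBasis N k).mul (continuous_cueBasis N l)
    simp only [gramMat, Matrix.of_apply, Matrix.sub_apply]
    rw [intervalIntegral.integral_of_le (by linarith [Real.pi_pos]),
      intervalIntegral.integral_of_le (by linarith), ← integral_Icc_eq_integral_Ioc (x := -t),
      ← sdiff_eq, setIntegral_sdiff measurableSet_Icc]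
    · exact (hcont.continuousOn.integrableOn_compact isCompact_Icc).mono_set Ioc_subset_Icc_self
    · exact fun x hx => ⟨by linarith [hx.1], by linarith [hx.2]⟩
  rw [condJanossy, measureReal_def, hset, cueCondLaw_pi hN measurableSet_Icc.compl, hG,
    ENNReal.toReal_ofReal (posDef_one_sub_gramMat ht).det_pos.le]

end Ensemble

/-! ### Dependence of the resolvent on the end point of a symmetric interval -/

section Deriv

open Matrix

set_option linter.unusedSectionVars false

/-- Jacobi's formula: differentiating the Leibniz expansion one column at a time gives determinants
with a replaced column, which Cramer's rule turns into entries of `adjugate * A'`. -/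
theorem HasDerivAt.matrix_det {m : Type*} [Fintype m] [DecidableEq m] {A : ℝ → Matrix m m ℝ}
    {A' : Matrix m m ℝ} {t : ℝ} (h : ∀ i j, HasDerivAt (fun s => A s i j) (A' i j) t) :
    HasDerivAt (fun s => (A s).det) ((A t).adjugate * A').trace t := by
  have h1 : HasDerivAt (fun s => ∑ σ : Equiv.Perm m, ((Equiv.Perm.sign σ : ℤ) : ℝ) *
      ∏ i, A s (σ i) i) (∑ σ : Equiv.Perm m, ((Equiv.Perm.sign σ : ℤ) : ℝ) *
        ∑ i, (∏ j ∈ Finset.univ.erase i, A t (σ j) j) • A' (σ i) i) t := by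
    refine HasDerivAt.fun_sum fun σ _ => HasDerivAt.const_mul _ ?_
    exact HasDerivAt.fun_finsetProd fun i _ => h (σ i) i
  have h2 : ((A t).adjugate * A').trace = ∑ σ : Equiv.Perm m, ((Equiv.Perm.sign σ : ℤ) : ℝ) *
        ∑ i, (∏ j ∈ Finset.univ.erase i, A t (σ j) j) • A' (σ i) i := by
    simp_rw [Finset.mul_sum]
    rw [Finset.sum_comm, Matrix.trace]
    refine Finset.sum_congr rfl fun i _ => ?_
    have h3 : ((A t).adjugate * A').diag i = ((A t).updateCol i (fun r => A' r i)).det := by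
      rw [← Matrix.cramer_apply, Matrix.cramer_eq_adjugate_mulVec]
      rfl
    rw [h3, Matrix.det_apply']
    refine Finset.sum_congr rfl fun σ _ => ?_
    congr 1
    rw [← Finset.mul_prod_erase _ _ (Finset.mem_univ i), Matrix.updateCol_self, smul_eq_mul,
      mul_comm]
    congr 1
    refine Finset.prod_congr rfl fun j hj => ?_
    rw [Matrix.updateCol_ne (Finset.ne_of_mem_erase hj)]
  rw [h2]
  simpa only [Matrix.det_apply'] using h1

theorem hasDerivAt_integral_symm {E : Type*} [NormedAddCommGroup E] [NormedSpace ℝ E]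
    [CompleteSpace E] {f : ℝ → E} (hf : Continuous f) (t : ℝ) :
    HasDerivAt (fun s => ∫ x in (-s)..s, f x) (f t + f (-t)) t := by
  have h1 : ∀ s, ∫ x in (-s)..s, f x = (∫ x in (0 : ℝ)..s, f x) - ∫ x in (0 : ℝ)..(-s), f x := by
    intro s
    rw [intervalIntegral.integral_interval_sub_left (hf.intervalIntegrable _ _)
      (hf.intervalIntegrable _ _)]
  simp_rw [h1]
  have h2 := intervalIntegral.integral_hasDerivAt_right (hf.intervalIntegrable 0 t)
    hf.aestronglyMeasurable.stronglyMeasurableAtFilter hf.continuousAt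
  have h3 := intervalIntegral.integral_hasDerivAt_right (hf.intervalIntegrable 0 (-t))
    hf.aestronglyMeasurable.stronglyMeasurableAtFilter hf.continuousAt
  have h4 := h3.scomp t (hasDerivAt_neg t)
  exact (h2.sub h4).congr_deriv (by simp)

variable {m : Type*} [Fintype m] [DecidableEq m] {c : m → ℝ → ℝ} {t : ℝ}

theorem hasDerivAt_gramMat (hc : ∀ k, Continuous (c k)) (t : ℝ) (k l : m) :
    HasDerivAt (fun s => gramMat c (-s) s k l) (c k t * c l t + c k (-t) * c l (-t)) t :=
  hasDerivAt_integral_symm ((hc k).mul (hc l)) t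

open scoped Matrix.Norms.L2Operator in
theorem hasDerivAt_resMat (hc : ∀ k, Continuous (c k)) (ht : (1 - gramMat c (-t) t).det ≠ 0) :
    HasDerivAt (fun s => resMat c (-s) s)
      (resMat c (-t) t * (Matrix.of fun k l => c k t * c l t + c k (-t) * c l (-t)) *
        resMat c (-t) t) t := by
  have hG : HasDerivAt (fun s => gramMat c (-s) s)
      (Matrix.of fun k l => c k t * c l t + c k (-t) * c l (-t)) t :=
    hasDerivAt_pi.mpr fun k => hasDerivAt_pi.mpr fun l => hasDerivAt_gramMat hc t k l
  have hu : IsUnit (1 - gramMat c (-t) t) :=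
    (Matrix.isUnit_iff_isUnit_det _).mpr (isUnit_iff_ne_zero.mpr ht)
  obtain ⟨u, hu⟩ := hu
  have h1 := hasFDerivAt_ringInverse (𝕜 := ℝ) u
  rw [hu] at h1
  have h2 := h1.comp_hasDerivAt t (hG.const_sub 1)
  have h3 : (↑u⁻¹ : Matrix m m ℝ) = resMat c (-t) t := by
    rw [resMat, Matrix.nonsing_inv_eq_ringInverse, ← hu, Ring.inverse_unit]
  rw [h3] at h2
  have h4 : (fun s => resMat c (-s) s) = Ring.inverse ∘ fun s => 1 - gramMat c (-s) s := by
    funext s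
    rw [resMat, Matrix.nonsing_inv_eq_ringInverse]; rfl
  rw [h4]
  refine h2.congr_deriv ?_
  rw [_root_.neg_apply, ContinuousLinearMap.mulLeftRight_apply, mul_neg, neg_mul, neg_neg]

/-- The complexified matrix `(1 - G)⁻¹` of the interval `[-t, t]`. -/
noncomputable def resMatC (c : m → ℝ → ℝ) (t : ℝ) : Matrix m m ℂ :=
  (resMat c (-t) t).map Complex.ofRealHom

theorem resApply_eq_resMatC (c : m → ℝ → ℝ) (t : ℝ) (f : ℝ → ℂ) (x : ℝ) :
    resApply c (-t) t f x = f x + cvec c x ⬝ᵥ resMatC c t *ᵥ moment c (-t) t f := rfl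

theorem resKer_eq_resMatC (c : m → ℝ → ℝ) (t x y : ℝ) :
    resKer c (-t) t x y = cvec c x ⬝ᵥ resMatC c t *ᵥ cvec c y := rfl

theorem hasDerivAt_resMatC (hc : ∀ k, Continuous (c k)) (ht : (1 - gramMat c (-t) t).det ≠ 0)
    (k l : m) :
    HasDerivAt (fun s => resMatC c s k l)
      ((resMatC c t * (vecMulVec (cvec c t) (cvec c t) +
        vecMulVec (cvec c (-t)) (cvec c (-t))) * resMatC c t) k l) t := by
  have h1 := hasDerivAt_pi.mp (hasDerivAt_pi.mp (hasDerivAt_resMat hc ht) k) l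
  have h2 := h1.ofReal_comp
  refine h2.congr_deriv ?_
  have h3 : (vecMulVec (cvec c t) (cvec c t) + vecMulVec (cvec c (-t)) (cvec c (-t))) =
      (Matrix.of fun k l => c k t * c l t + c k (-t) * c l (-t)).map Complex.ofRealHom := by
    ext k l; simp [vecMulVec, cvec]
  rw [h3, resMatC, ← Matrix.map_mul, ← Matrix.map_mul]
  rfl

/-- The derivative of the Gram matrix is a sum of two rank one matrices, one for each end point, so
the contribution of the inverse factorises into products of values at `±t`. -/
theorem HasDerivAt.dotProduct_resMatC (hc : ∀ k, Continuous (c k))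
    (ht : (1 - gramMat c (-t) t).det ≠ 0) {X g : ℝ → m → ℂ} {X' g' : m → ℂ}
    (hX : ∀ k, HasDerivAt (fun s => X s k) (X' k) t)
    (hg : ∀ k, HasDerivAt (fun s => g s k) (g' k) t) :
    HasDerivAt (fun s => X s ⬝ᵥ resMatC c s *ᵥ g s)
      (X' ⬝ᵥ resMatC c t *ᵥ g t + X t ⬝ᵥ resMatC c t *ᵥ g' +
        (X t ⬝ᵥ resMatC c t *ᵥ cvec c t) * (cvec c t ⬝ᵥ resMatC c t *ᵥ g t) +
        (X t ⬝ᵥ resMatC c t *ᵥ cvec c (-t)) * (cvec c (-t) ⬝ᵥ resMatC c t *ᵥ g t)) t := by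
  set M := resMatC c t with hM
  set M' := M * (vecMulVec (cvec c t) (cvec c t) + vecMulVec (cvec c (-t)) (cvec c (-t))) * M
    with hM'
  have h1 : HasDerivAt (fun s => X s ⬝ᵥ resMatC c s *ᵥ g s)
      (∑ k, (X' k * (M *ᵥ g t) k + X t k * ∑ l, (M' k l * g t l + M k l * g' l))) t := by
    refine HasDerivAt.fun_sum fun k _ => (hX k).mul ?_
    exact HasDerivAt.fun_sum fun l _ => (hasDerivAt_resMatC hc ht k l).mul (hg l)
  refine h1.congr_deriv ?_
  have h2 : ∑ k, (X' k * (M *ᵥ g t) k + X t k * ∑ l, (M' k l * g t l + M k l * g' l)) =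
      X' ⬝ᵥ M *ᵥ g t + X t ⬝ᵥ M' *ᵥ g t + X t ⬝ᵥ M *ᵥ g' := by
    simp only [dotProduct, mulVec, Finset.sum_add_distrib, mul_add, add_assoc]
  have h3 : ∀ d : m → ℂ, X t ⬝ᵥ (M * vecMulVec d d * M) *ᵥ g t =
      (X t ⬝ᵥ M *ᵥ d) * (d ⬝ᵥ M *ᵥ g t) := by
    intro d
    rw [← mulVec_mulVec, ← mulVec_mulVec, vecMulVec_mulVec, mulVec_smul, dotProduct_smul]
    simp
  rw [h2, hM', mul_add, add_mul, add_mulVec, dotProduct_add, h3, h3]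
  ring

theorem hasDerivAt_moment_symm (hc : ∀ k, Continuous (c k)) {f : ℝ → ℂ} (hf : Continuous f)
    (t : ℝ) (k : m) :
    HasDerivAt (fun s => moment c (-s) s f k)
      ((f t • cvec c t + f (-t) • cvec c (-t)) k) t := by
  have := hasDerivAt_integral_symm (f := fun x => (c k x : ℂ) * f x)
    ((Complex.continuous_ofReal.comp (hc k)).mul hf) t
  exact this.congr_deriv (by simp [cvec, mul_comm])

theorem integral_mul_cvec_dotProduct (hc : ∀ k, Continuous (c k)) {h : ℝ → ℂ} (hh : Continuous h) (w : m → ℂ) (a b : ℝ) :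
    ∫ x in a..b, h x * (cvec c x ⬝ᵥ w) = moment c a b h ⬝ᵥ w := by
  have h1 : ∀ x, h x * (cvec c x ⬝ᵥ w) = ∑ k, ((c k x : ℂ) * h x) * w k := by
    intro x
    simp only [dotProduct, cvec, Finset.mul_sum]
    exact Finset.sum_congr rfl fun k _ => by ring
  simp_rw [h1]
  rw [intervalIntegral.integral_finsetSum fun k _ =>
    (by have := hc k; fun_prop :
      Continuous fun x => (c k x : ℂ) * h x * w k).intervalIntegrable _ _]
  simp only [intervalIntegral.integral_mul_const]
  rfl

theorem dotProduct_resMatC_comm (c : m → ℝ → ℝ) (t : ℝ)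
    (v w : m → ℂ) : v ⬝ᵥ resMatC c t *ᵥ w = w ⬝ᵥ resMatC c t *ᵥ v := by
  rw [Matrix.dotProduct_mulVec, ← Matrix.mulVec_transpose, resMatC, ← Matrix.transpose_map,
    resMat_transpose, dotProduct_comm]

theorem integral_mul_resApply (hc : ∀ k, Continuous (c k)) {f h : ℝ → ℂ} (hf : Continuous f)
    (hh : Continuous h) :
    ∫ x in (-t)..t, h x * resApply c (-t) t f x =
      (∫ x in (-t)..t, h x * f x) +
        moment c (-t) t h ⬝ᵥ resMatC c t *ᵥ moment c (-t) t f := by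
  have hcw := continuous_cvec_dotProduct hc (resMatC c t *ᵥ moment c (-t) t f)
  simp only [resApply_eq_resMatC, mul_add]
  rw [intervalIntegral.integral_add (Continuous.intervalIntegrable (by fun_prop) _ _)
    (Continuous.intervalIntegrable (by fun_prop) _ _), integral_mul_cvec_dotProduct hc hh]

/-- The source of `u'`, `w'` and `v'`: all the terms assemble into products of resolvent values at
the two end points. Both products carry a plus sign since both ends move outward. -/
theorem hasDerivAt_integral_mul_resApply (hc : ∀ k, Continuous (c k))
    (ht : (1 - gramMat c (-t) t).det ≠ 0) {f h : ℝ → ℂ} (hf : Continuous f)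
    (hh : Continuous h) :
    HasDerivAt (fun s => ∫ x in (-s)..s, h x * resApply c (-s) s f x)
      (resApply c (-t) t h t * resApply c (-t) t f t +
        resApply c (-t) t h (-t) * resApply c (-t) t f (-t)) t := by
  simp only [integral_mul_resApply hc hf hh]
  have h1 := (hasDerivAt_integral_symm (hh.mul hf) t).add
    (HasDerivAt.dotProduct_resMatC hc ht (hasDerivAt_moment_symm hc hh t)
      (hasDerivAt_moment_symm hc hf t))
  refine h1.congr_deriv ?_
  have hsymm : ∀ x, moment c (-t) t h ⬝ᵥ resMatC c t *ᵥ cvec c x =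
      cvec c x ⬝ᵥ resMatC c t *ᵥ moment c (-t) t h := fun x => dotProduct_resMatC_comm _ _ _ _
  simp only [add_dotProduct, smul_dotProduct, mulVec_add, mulVec_smul, dotProduct_add,
    dotProduct_smul, hsymm, resApply_eq_resMatC, smul_eq_mul, Pi.mul_apply]
  ring

/-- The argument moves with `t`, giving the derivative in `x`, and the interval grows at both ends,
giving the resolvent kernel times the end point values. -/
theorem hasDerivAt_resApply_diag (hc : ∀ k, Continuous (c k))
    (ht : (1 - gramMat c (-t) t).det ≠ 0) {c' : m → ℝ → ℝ}
    (hc' : ∀ k x, HasDerivAt (c k) (c' k x) x) {f f' : ℝ → ℂ} (hf : ∀ x, HasDerivAt f (f' x) x) :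
    HasDerivAt (fun s => resApply c (-s) s f s)
      (f' t + cvec c' t ⬝ᵥ resMatC c t *ᵥ moment c (-t) t f +
        resKer c (-t) t t t * resApply c (-t) t f t +
        resKer c (-t) t t (-t) * resApply c (-t) t f (-t)) t := by
  have hfc : Continuous f := continuous_iff_continuousAt.mpr fun x => (hf x).continuousAt
  have h1 := (hf t).add (HasDerivAt.dotProduct_resMatC (X := fun s => cvec c s) (X' := cvec c' t)
    hc ht (fun k => (hc' k t).ofReal_comp) (hasDerivAt_moment_symm hc hfc t))
  refine h1.congr_deriv ?_
  simp only [resKer_eq_resMatC, resApply_eq_resMatC, mulVec_add, mulVec_smul, dotProduct_add,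
    dotProduct_smul, smul_eq_mul]
  ring

/-- Jacobi's formula with `adjugate = det • inverse`; the trace against the rank one terms is the
resolvent kernel on the diagonal at `±t`. -/
theorem hasDerivAt_det_one_sub_gramMat (hc : ∀ k, Continuous (c k))
    (ht : (1 - gramMat c (-t) t).det ≠ 0) :
    HasDerivAt (fun s => (1 - gramMat c (-s) s).det)
      (-((1 - gramMat c (-t) t).det *
        ((resKer c (-t) t t t).re + (resKer c (-t) t (-t) (-t)).re))) t := by
  have h1 := HasDerivAt.matrix_det (A := fun s => 1 - gramMat c (-s) s)
    (A' := -(Matrix.of fun k l => c k t * c l t + c k (-t) * c l (-t))) (t := t) (by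
      intro k l
      simpa using (hasDerivAt_gramMat hc t k l).const_sub ((1 : Matrix m m ℝ) k l))
  refine h1.congr_deriv ?_
  have h2 : (1 - gramMat c (-t) t).adjugate = (1 - gramMat c (-t) t).det • resMat c (-t) t := by
    rw [resMat, Matrix.inv_def, smul_smul, Ring.mul_inverse_cancel _ (isUnit_iff_ne_zero.mpr ht),
      one_smul]
  have h3 : ∀ x, (resKer c (-t) t x x).re = ∑ k, ∑ l, resMat c (-t) t k l * (c l x * c k x) := by
    intro x
    simp only [resKer, cvec, dotProduct, mulVec, Matrix.map_apply, Finset.mul_sum, Complex.re_sum]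
    refine Finset.sum_congr rfl fun k _ => Finset.sum_congr rfl fun l _ => ?_
    rw [Complex.ofRealHom_eq_coe, ← Complex.ofReal_mul, ← Complex.ofReal_mul, Complex.ofReal_re]
    ring
  rw [h2, h3, h3, smul_mul_assoc, Matrix.trace_smul, mul_neg, Matrix.trace_neg, smul_eq_mul,
    mul_neg]
  congr 2
  simp only [Matrix.trace, Matrix.diag, Matrix.mul_apply, Matrix.of_apply, mul_add,
    Finset.sum_add_distrib]

end Deriv

/-! ### The functions `φ̃`, `ψ̃` and the structure of the kernel -/

section Structure

open Complex (I)

/-- `e^{ix}`. -/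
noncomputable def unitExp (x : ℝ) : ℂ := Complex.exp (I * x)

/-- `expPlus` and `expMinus` are `e^{ix/2} e^{±iNx/2}`; their difference is `(e^{ix} - 1)` times the
Dirichlet kernel, which removes the quotients from `φ̃` and `ψ̃`. -/
noncomputable def expPlus (N : ℕ) (x : ℝ) : ℂ := Complex.exp (I * (((N : ℂ) + 1) / 2 * x))

noncomputable def expMinus (N : ℕ) (x : ℝ) : ℂ := Complex.exp (-(I * (((N : ℂ) - 1) / 2 * x)))

noncomputable def dirichletKer' (N : ℕ) (x : ℝ) : ℝ :=
  -∑ a ∈ Finset.range N, freq N a * Real.sin (freq N a * x)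

theorem continuous_unitExp : Continuous unitExp := by unfold unitExp; fun_prop

theorem hasDerivAt_unitExp (x : ℝ) : HasDerivAt unitExp (I * unitExp x) x := by
  have h := ((Complex.ofRealCLM.hasDerivAt (x := x)).const_mul I).cexp
  refine h.congr_deriv ?_
  simp [unitExp, mul_comm]

theorem hasDerivAt_expPlus (N : ℕ) (x : ℝ) :
    HasDerivAt (expPlus N) (I * ((N + 1) / 2) * expPlus N x) x := by
  have h := (((Complex.ofRealCLM.hasDerivAt (x := x)).const_mul (((N : ℂ) + 1) / 2)).const_mul
    I).cexp
  refine h.congr_deriv ?_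
  simp [expPlus, mul_comm]

theorem hasDerivAt_expMinus (N : ℕ) (x : ℝ) :
    HasDerivAt (expMinus N) (-(I * ((N - 1) / 2)) * expMinus N x) x := by
  have h := (((Complex.ofRealCLM.hasDerivAt (x := x)).const_mul (((N : ℂ) - 1) / 2)).const_mul
    I).neg.cexp
  refine h.congr_deriv ?_
  simp [expMinus, mul_comm]

theorem hasDerivAt_dirichletKer (N : ℕ) (x : ℝ) :
    HasDerivAt (dirichletKer N) (dirichletKer' N x) x := by
  rw [dirichletKer', ← Finset.sum_neg_distrib]
  refine HasDerivAt.fun_sum fun a _ => ?_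
  have h := ((hasDerivAt_id x).const_mul (freq N a)).cos
  exact h.congr_deriv (by simp; ring)

theorem continuous_dirichletKer' (N : ℕ) : Continuous (dirichletKer' N) := by
  unfold dirichletKer'; fun_prop

theorem unitExp_sub_one_mul_dirichletKer (N : ℕ) (x : ℝ) :
    (unitExp x - 1) * dirichletKer N x = expPlus N x - expMinus N x := by
  have h1 : (dirichletKer N x : ℂ) =
      expMinus N x * ∑ a ∈ Finset.range N, unitExp x ^ a := by
    rw [dirichletKer_eq_sum_exp, Finset.mul_sum]
    refine Finset.sum_congr rfl fun a _ => ?_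
    rw [expMinus, unitExp, ← Complex.exp_nat_mul, ← Complex.exp_add]
    congr 1
    rw [freq]
    push_cast
    ring
  have h2 := mul_geom_sum (unitExp x) N
  have h3 : expMinus N x * unitExp x ^ N = expPlus N x := by
    rw [expMinus, unitExp, expPlus, ← Complex.exp_nat_mul, ← Complex.exp_add]
    congr 1
    ring
  rw [h1, ← h3]
  linear_combination expMinus N x * h2

theorem unitExp_sub_one_mul_dirichletKer' (N : ℕ) (x : ℝ) :
    I * unitExp x * dirichletKer N x + (unitExp x - 1) * dirichletKer' N x =
      I * ((N + 1) / 2) * expPlus N x + I * ((N - 1) / 2) * expMinus N x := by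
  have h1 := ((hasDerivAt_unitExp x).sub_const 1).mul (hasDerivAt_dirichletKer N x).ofReal_comp
  have h2 := (hasDerivAt_expPlus N x).sub (hasDerivAt_expMinus N x)
  have h3 : ((fun x => unitExp x - 1) * fun y => (dirichletKer N y : ℂ)) =
      expPlus N - expMinus N :=
    funext fun y => unitExp_sub_one_mul_dirichletKer N y
  rw [h3] at h1
  have h4 := h1.unique h2
  linear_combination h4

theorem sqrt_two_pi_ne_zero : (√(2 * π) : ℂ) ≠ 0 := by
  have : 0 < √(2 * π) := by positivity
  exact_mod_cast this.ne'

theorem sqrt_two_pi_mul_self : (√(2 * π) : ℂ) * √(2 * π) = 2 * π := by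
  rw [← Complex.ofReal_mul, Real.mul_self_sqrt (by positivity)]; push_cast; rfl

/-- At `e^{ix} = 1` the differentiated identity collapses to these values. They make the closed
forms of `φ̃` and `ψ̃` agree with the prescribed value `0` there. -/
theorem expMinus_eq_dirichletKer_div {N : ℕ} (hN : 1 ≤ N) {x : ℝ} (hx : unitExp x = 1) :
    expPlus N x = dirichletKer N x / N ∧ expMinus N x = dirichletKer N x / N := by
  have hN0 : (N : ℂ) ≠ 0 := by exact_mod_cast (by omega : N ≠ 0)
  have h1 := unitExp_sub_one_mul_dirichletKer N x
  have h2 := unitExp_sub_one_mul_dirichletKer' N x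
  rw [hx] at h1 h2
  have h3 : expPlus N x = expMinus N x := by linear_combination -h1
  rw [h3] at h2
  have h4 : (dirichletKer N x : ℂ) = N * expMinus N x := by
    apply mul_left_cancel₀ Complex.I_ne_zero
    linear_combination h2
  rw [h3, h4]
  field_simp
  simp

theorem phiTilde_eq {N : ℕ} (hN : 1 ≤ N) (x : ℝ) :
    phiTilde N x = (expPlus N x - dirichletKer N x / N) / √(2 * π) := by
  have hN0 : (N : ℂ) ≠ 0 := by exact_mod_cast (by omega : N ≠ 0)
  have hs := sqrt_two_pi_ne_zero
  unfold phiTilde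
  split_ifs with h
  · rw [(expMinus_eq_dirichletKer_div hN h).1]; simp
  · have h1 := unitExp_sub_one_mul_dirichletKer N x
    have hm : unitExp x - 1 ≠ 0 := sub_ne_zero.mpr h
    change _ / _ * (_ - _ / (N * (unitExp x - 1))) = _
    have h2 : expPlus N x = Complex.exp (I * x / 2) * Complex.exp (I * N * x / 2) := by
      rw [expPlus, ← Complex.exp_add]; congr 1; ring
    have h3 : expMinus N x = Complex.exp (I * x / 2) * Complex.exp (-(I * N * x / 2)) := by
      rw [expMinus, ← Complex.exp_add]; congr 1; ring
    rw [eq_div_of_mul_eq hm ((mul_comm _ _).trans h1), h3, h2]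
    field_simp

theorem psiTilde_eq {N : ℕ} (hN : 1 ≤ N) (x : ℝ) :
    psiTilde N x = (expMinus N x - dirichletKer N x / N) / √(2 * π) := by
  have hN0 : (N : ℂ) ≠ 0 := by exact_mod_cast (by omega : N ≠ 0)
  have hs := sqrt_two_pi_ne_zero
  unfold psiTilde
  split_ifs with h
  · rw [(expMinus_eq_dirichletKer_div hN h).2]; simp
  · have h1 := unitExp_sub_one_mul_dirichletKer N x
    have hm : unitExp x - 1 ≠ 0 := sub_ne_zero.mpr h
    change _ / _ * (_ - _ / (N * (unitExp x - 1))) = _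
    have h2 : expPlus N x = Complex.exp (I * x / 2) * Complex.exp (I * N * x / 2) := by
      rw [expPlus, ← Complex.exp_add]; congr 1; ring
    have h3 : expMinus N x = Complex.exp (I * x / 2) * Complex.exp (-(I * N * x / 2)) := by
      rw [expMinus, ← Complex.exp_add]; congr 1; ring
    rw [eq_div_of_mul_eq hm ((mul_comm _ _).trans h1), h3, h2]
    field_simp

noncomputable def phiTilde' (N : ℕ) (x : ℝ) : ℂ :=
  (I * ((N + 1) / 2) * expPlus N x - dirichletKer' N x / N) / √(2 * π)

noncomputable def psiTilde' (N : ℕ) (x : ℝ) : ℂ :=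
  (-(I * ((N - 1) / 2)) * expMinus N x - dirichletKer' N x / N) / √(2 * π)

theorem hasDerivAt_phiTilde {N : ℕ} (hN : 1 ≤ N) (x : ℝ) :
    HasDerivAt (phiTilde N) (phiTilde' N x) x := by
  rw [funext (phiTilde_eq hN)]
  exact ((hasDerivAt_expPlus N x).sub
    ((hasDerivAt_dirichletKer N x).ofReal_comp.div_const _)).div_const _

theorem hasDerivAt_psiTilde {N : ℕ} (hN : 1 ≤ N) (x : ℝ) :
    HasDerivAt (psiTilde N) (psiTilde' N x) x := by
  rw [funext (psiTilde_eq hN)]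
  exact ((hasDerivAt_expMinus N x).sub
    ((hasDerivAt_dirichletKer N x).ofReal_comp.div_const _)).div_const _

theorem continuous_phiTilde {N : ℕ} (hN : 1 ≤ N) : Continuous (phiTilde N) :=
  continuous_iff_continuousAt.mpr fun x => (hasDerivAt_phiTilde hN x).continuousAt

theorem continuous_psiTilde {N : ℕ} (hN : 1 ≤ N) : Continuous (psiTilde N) :=
  continuous_iff_continuousAt.mpr fun x => (hasDerivAt_psiTilde hN x).continuousAt

theorem continuous_phiTilde' (N : ℕ) : Continuous (phiTilde' N) := by
  have := continuous_dirichletKer' N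
  unfold phiTilde' expPlus
  fun_prop

theorem continuous_psiTilde' (N : ℕ) : Continuous (psiTilde' N) := by
  have := continuous_dirichletKer' N
  unfold psiTilde' expMinus
  fun_prop

/-- The first order system satisfied by `φ̃` and `ψ̃`. -/
theorem phiTilde_ode {N : ℕ} (hN : 1 ≤ N) (x : ℝ) :
    I * (1 - unitExp x) * phiTilde' N x =
      (-((N + 1) / 2) * (1 - unitExp x) + 1 / N) * phiTilde N x - (N + 1) / N * psiTilde N x := by
  have hN0 : (N : ℂ) ≠ 0 := by exact_mod_cast (by omega : N ≠ 0)
  have hs := sqrt_two_pi_ne_zero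
  have h1 := unitExp_sub_one_mul_dirichletKer N x
  have h2 := unitExp_sub_one_mul_dirichletKer' N x
  have hr : (N : ℂ) * (N : ℂ)⁻¹ = 1 := mul_inv_cancel₀ hN0
  rw [phiTilde_eq hN, psiTilde_eq hN, phiTilde']
  simp only [mul_div_assoc', ← sub_div]
  congr 1
  simp only [div_eq_mul_inv _ (N : ℂ)]
  -- The custom normaliser substitutes `I ^ 2 = -1` between two passes of `ring_nf`.
  linear_combination (norm := (ring_nf; simp only [Complex.I_sq]; ring_nf)) ((N : ℂ)⁻¹ * I) * h2 +
    (N : ℂ)⁻¹ * ((N + 3) / 2) * h1 - (N : ℂ)⁻¹ * dirichletKer N x * hr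

theorem psiTilde_ode {N : ℕ} (hN : 1 ≤ N) (x : ℝ) :
    I * (1 - unitExp x) * psiTilde' N x =
      ((N - 1) / 2 * (1 - unitExp x) - 1 / N) * psiTilde N x - (N - 1) / N * phiTilde N x := by
  have hN0 : (N : ℂ) ≠ 0 := by exact_mod_cast (by omega : N ≠ 0)
  have hs := sqrt_two_pi_ne_zero
  have h1 := unitExp_sub_one_mul_dirichletKer N x
  have h2 := unitExp_sub_one_mul_dirichletKer' N x
  have hr : (N : ℂ) * (N : ℂ)⁻¹ = 1 := mul_inv_cancel₀ hN0
  rw [phiTilde_eq hN, psiTilde_eq hN, psiTilde']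
  simp only [mul_div_assoc', ← sub_div]
  congr 1
  simp only [div_eq_mul_inv _ (N : ℂ)]
  linear_combination (norm := (ring_nf; simp only [Complex.I_sq]; ring_nf)) ((N : ℂ)⁻¹ * I) * h2 +
    (N : ℂ)⁻¹ * ((3 - N) / 2) * h1 - (N : ℂ)⁻¹ * dirichletKer N x * hr

theorem unitExp_mul_expPlus_sub (N : ℕ) (x y : ℝ) :
    unitExp y * expPlus N (x - y) = expPlus N x * expMinus N y := by
  rw [unitExp, expPlus, expPlus, expMinus, ← Complex.exp_add, ← Complex.exp_add]
  congr 1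
  push_cast
  ring

theorem unitExp_mul_expMinus_sub (N : ℕ) (x y : ℝ) :
    unitExp y * expMinus N (x - y) = expMinus N x * expPlus N y := by
  rw [unitExp, expMinus, expPlus, expMinus, ← Complex.exp_add, ← Complex.exp_add]
  congr 1
  push_cast
  ring

theorem unitExp_mul_unitExp_sub (x y : ℝ) : unitExp y * unitExp (x - y) = unitExp x := by
  rw [unitExp, unitExp, unitExp, ← Complex.exp_add]
  congr 1
  push_cast
  ring

/-- The Christoffel–Darboux form of the conditioned kernel. -/
theorem unitExp_sub_mul_condKernel {N : ℕ} (hN : 1 ≤ N) (x y : ℝ) :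
    (unitExp x - unitExp y) * condKernel N x y =
      phiTilde N x * psiTilde N y - psiTilde N x * phiTilde N y := by
  have hN0 : (N : ℂ) ≠ 0 := by exact_mod_cast (by omega : N ≠ 0)
  have hpi : (π : ℂ) ≠ 0 := by exact_mod_cast Real.pi_ne_zero
  rw [condKernel_eq, phiTilde_eq hN, psiTilde_eq hN, phiTilde_eq hN, psiTilde_eq hN,
    div_mul_div_comm, div_mul_div_comm, sqrt_two_pi_mul_self]
  push_cast
  have h1 := unitExp_sub_one_mul_dirichletKer N x
  have h2 := unitExp_sub_one_mul_dirichletKer N y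
  have h3 := unitExp_sub_one_mul_dirichletKer N (x - y)
  have h4 := unitExp_mul_expPlus_sub N x y
  have h5 := unitExp_mul_expMinus_sub N x y
  have h6 := unitExp_mul_unitExp_sub x y
  simp only [mul_div_assoc', ← sub_div]
  congr 1
  simp only [div_eq_mul_inv _ (N : ℂ)]
  linear_combination unitExp y * h3 - dirichletKer N (x - y) * h6 + h4 - h5 -
    (N : ℂ)⁻¹ * dirichletKer N y * h1 + (N : ℂ)⁻¹ * dirichletKer N x * h2

/-- The partial derivative of the conditioned kernel in its first variable. -/
noncomputable def condKernel' (N : ℕ) (x y : ℝ) : ℝ :=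
  (dirichletKer' N (x - y) - dirichletKer' N x * dirichletKer N y / N) / (2 * π)

theorem dirichletKer'_neg (N : ℕ) (x : ℝ) : dirichletKer' N (-x) = -dirichletKer' N x := by
  simp [dirichletKer']

theorem hasDerivAt_condKernel (N : ℕ) (x y : ℝ) :
    HasDerivAt (fun z => condKernel N z y) (condKernel' N x y) x := by
  have h : (fun z => condKernel N z y) = fun z =>
      (dirichletKer N (z - y) - dirichletKer N z * dirichletKer N y / N) / (2 * π) :=
    funext fun z => condKernel_eq N z y
  rw [h]
  exact (((hasDerivAt_dirichletKer N (x - y)).comp_sub_const x y).sub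
    (((hasDerivAt_dirichletKer N x).mul_const _).div_const _)).div_const _

theorem condKernel_symm (N : ℕ) (x y : ℝ) : condKernel N x y = condKernel N y x := by
  rw [condKernel_eq, condKernel_eq, ← dirichletKer_neg N (x - y), neg_sub]
  ring

theorem condKernel_neg_neg (N : ℕ) (x y : ℝ) : condKernel N (-x) (-y) = condKernel N x y := by
  rw [condKernel_eq, condKernel_eq, show -x - -y = -(x - y) by ring]
  simp only [dirichletKer_neg]

/-- The analogue of Christoffel–Darboux for `i(1 - e^{ix}) d/dx`. The factor `1 - e^{ix}` clears the
denominators of `φ̃` and `ψ̃`, so the identity is polynomial in the exponentials, the Dirichlet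
kernel and its derivative. -/
theorem condKernel_derivation {N : ℕ} (hN : 1 ≤ N) (x y : ℝ) :
    I * (1 - unitExp x) * condKernel' N x y + I * (1 - unitExp y) * condKernel' N y x =
      -((unitExp x + unitExp y) / 2) * condKernel N x y +
        N / 2 * (phiTilde N x * psiTilde N y + psiTilde N x * phiTilde N y) := by
  have hN0 : (N : ℂ) ≠ 0 := by exact_mod_cast (by omega : N ≠ 0)
  have hpi : (π : ℂ) ≠ 0 := by exact_mod_cast Real.pi_ne_zero
  rw [condKernel_eq, condKernel', condKernel', phiTilde_eq hN, psiTilde_eq hN, phiTilde_eq hN,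
    psiTilde_eq hN, div_mul_div_comm, div_mul_div_comm, sqrt_two_pi_mul_self,
    show y - x = -(x - y) by ring, dirichletKer'_neg]
  push_cast
  have h1 := unitExp_sub_one_mul_dirichletKer N x
  have h2 := unitExp_sub_one_mul_dirichletKer N y
  have h1' := unitExp_sub_one_mul_dirichletKer' N x
  have h2' := unitExp_sub_one_mul_dirichletKer' N y
  have h3 := unitExp_sub_one_mul_dirichletKer' N (x - y)
  have h4 := unitExp_mul_expPlus_sub N x y
  have h5 := unitExp_mul_expMinus_sub N x y
  have h6 := unitExp_mul_unitExp_sub x y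
  have h7 := unitExp_sub_one_mul_dirichletKer N (x - y)
  have hr : (N : ℂ) * (N : ℂ)⁻¹ = 1 := mul_inv_cancel₀ hN0
  have h8 : (unitExp x - unitExp y) * dirichletKer N (x - y) =
      expPlus N x * expMinus N y - expMinus N x * expPlus N y := by
    linear_combination unitExp y * h7 - dirichletKer N (x - y) * h6 + h4 - h5
  simp only [← add_div, mul_div_assoc']
  congr 1
  simp only [div_eq_mul_inv _ (N : ℂ)]
  linear_combination (norm := (ring_nf; simp only [Complex.I_sq]; ring_nf))
    -I * unitExp y * h3 + I * (I * dirichletKer N (x - y) + dirichletKer' N (x - y)) * h6 -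
    I * I * ((N + 1) / 2) * h4 - I * I * ((N - 1) / 2) * h5 - 1 / 2 * h8 +
    (N : ℂ)⁻¹ * dirichletKer N y * I * h1' + (N : ℂ)⁻¹ * dirichletKer N x * I * h2' +
    (N : ℂ)⁻¹ / 2 * dirichletKer N y * h1 + (N : ℂ)⁻¹ / 2 * dirichletKer N x * h2 -
    (N : ℂ)⁻¹ * dirichletKer N x * dirichletKer N y * hr

end Structure

/-! ### The integral equation on `[-t, t]` -/

section IntegralEquation

open Complex (I)

theorem continuous_condKernel_right (N : ℕ) (x : ℝ) : Continuous (condKernel N x) := by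
  have := continuous_dirichletKer N
  rw [funext (condKernel_eq N x)]
  fun_prop

theorem continuous_condKernel'_right (N : ℕ) (x : ℝ) : Continuous (condKernel' N x) := by
  have := continuous_dirichletKer N
  have := continuous_dirichletKer' N
  unfold condKernel'
  fun_prop

theorem continuous_condKernel'_left (N : ℕ) (y : ℝ) : Continuous fun x => condKernel' N x y := by
  have := continuous_dirichletKer N
  have := continuous_dirichletKer' N
  unfold condKernel'
  fun_prop

/-- The continuous function `g` satisfies `g - K̃ g = f`, where `K̃` acts on `[-t, t]`. -/
structure Solves (N : ℕ) (t : ℝ) (g f : ℝ → ℂ) : Prop where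
  continuous : Continuous g
  eq : ∀ x, g x - ∫ y in (-t)..t, (condKernel N x y : ℂ) * g y = f x

variable {N : ℕ} {t : ℝ} {f g h f₁ f₂ g₁ g₂ : ℝ → ℂ}

theorem Solves.intervalIntegrable (hg : Solves N t g f) {φ : ℝ → ℂ} (hφ : Continuous φ) (a b : ℝ) :
    IntervalIntegrable (fun y => φ y * g y) volume a b :=
  (hφ.mul hg.continuous).intervalIntegrable a b

theorem Solves.intervalIntegrable_ker (hg : Solves N t g f) (x a b : ℝ) :
    IntervalIntegrable (fun y => (condKernel N x y : ℂ) * g y) volume a b :=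
  hg.intervalIntegrable (Complex.continuous_ofReal.comp (continuous_condKernel_right N x)) a b

theorem Solves.add (h₁ : Solves N t g₁ f₁) (h₂ : Solves N t g₂ f₂) :
    Solves N t (fun x => g₁ x + g₂ x) (fun x => f₁ x + f₂ x) := by
  refine ⟨h₁.continuous.add h₂.continuous, fun x => ?_⟩
  simp only [mul_add]
  rw [intervalIntegral.integral_add (h₁.intervalIntegrable_ker x _ _)
    (h₂.intervalIntegrable_ker x _ _), ← h₁.eq, ← h₂.eq]
  ring

theorem Solves.const_mul (h₁ : Solves N t g f) (a : ℂ) :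
    Solves N t (fun x => a * g x) (fun x => a * f x) := by
  refine ⟨continuous_const.mul h₁.continuous, fun x => ?_⟩
  simp only [mul_left_comm _ a]
  rw [intervalIntegral.integral_const_mul, ← h₁.eq]
  ring

theorem Solves.congr_right (h₁ : Solves N t g f₁) (hf : ∀ x, f₁ x = f₂ x) : Solves N t g f₂ :=
  ⟨h₁.continuous, fun x => (h₁.eq x).trans (hf x)⟩

theorem posDef_cueBasis (ht : t ∈ Ioo 0 π) : (1 - gramMat (cueBasis N) (-t) t).PosDef :=
  posDef_one_sub_gramMat ht.2

theorem det_cueBasis_ne_zero (ht : t ∈ Ioo 0 π) : (1 - gramMat (cueBasis N) (-t) t).det ≠ 0 :=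
  (posDef_cueBasis ht).det_pos.ne'

theorem solves_resApply (hN : 1 ≤ N) (ht : t ∈ Ioo 0 π) (hf : Continuous f) :
    Solves N t (resApply (cueBasis N) (-t) t f) f := by
  have hle : -t ≤ t := by linarith [ht.1]
  refine ⟨?_, fun x => ?_⟩
  · exact hf.add (continuous_cvec_dotProduct (continuous_cueBasis N) _)
  · rw [condKernel_eq_finKer hN]
    exact resApply_solves (continuous_cueBasis N) hle (posDef_cueBasis ht) hf.continuousOn x

/-- On `[-t, t]` uniqueness comes from the invertibility of `1 - G`; elsewhere the equation itself
expresses `g x` by the values on the interval. -/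
theorem Solves.unique (hN : 1 ≤ N) (ht : t ∈ Ioo 0 π) (hf : Continuous f) (h₁ : Solves N t g₁ f)
    (h₂ : Solves N t g₂ f) (x : ℝ) : g₁ x = g₂ x := by
  have hle : -t ≤ t := by linarith [ht.1]
  have key : ∀ {g}, Solves N t g f → ∀ x ∈ Icc (-t) t,
      g x = resApply (cueBasis N) (-t) t f x := fun hg =>
    eq_resApply (continuous_cueBasis N) hle (posDef_cueBasis ht) hf.continuousOn
      hg.continuous.continuousOn fun x _ => by
        rw [← condKernel_eq_finKer hN]; exact hg.eq x
  have h3 : ∫ y in (-t)..t, (condKernel N x y : ℂ) * g₁ y =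
      ∫ y in (-t)..t, (condKernel N x y : ℂ) * g₂ y := by
    refine intervalIntegral.integral_congr fun y hy => ?_
    rw [uIcc_of_le hle] at hy
    simp only [key h₁ y hy, key h₂ y hy]
  have h4 := h₁.eq x
  have h5 := h₂.eq x
  rw [← h5, h3] at h4
  linear_combination h4

/-- Christoffel–Darboux read as a commutator: multiplication by `e^{ix}` commutes with `K̃` up to an
operator of rank at most two. -/
theorem Solves.unitExp_mul (hN : 1 ≤ N) (hg : Solves N t g f) :
    Solves N t (fun x => unitExp x * g x) (fun x => unitExp x * f x +
      phiTilde N x * (∫ y in (-t)..t, psiTilde N y * g y) -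
      psiTilde N x * ∫ y in (-t)..t, phiTilde N y * g y) := by
  refine ⟨continuous_unitExp.mul hg.continuous, fun x => ?_⟩
  have hφ := continuous_phiTilde hN
  have hψ := continuous_psiTilde hN
  have h1 : ∀ y, (condKernel N x y : ℂ) * (unitExp y * g y) =
      unitExp x * ((condKernel N x y : ℂ) * g y) - phiTilde N x * (psiTilde N y * g y) +
        psiTilde N x * (phiTilde N y * g y) := by
    intro y
    linear_combination -g y * unitExp_sub_mul_condKernel hN x y
  simp_rw [h1]
  rw [intervalIntegral.integral_add (((hg.intervalIntegrable_ker x _ _).const_mul _).sub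
      ((hg.intervalIntegrable hψ _ _).const_mul _)) ((hg.intervalIntegrable hφ _ _).const_mul _),
    intervalIntegral.integral_sub ((hg.intervalIntegrable_ker x _ _).const_mul _)
      ((hg.intervalIntegrable hψ _ _).const_mul _), intervalIntegral.integral_const_mul,
    intervalIntegral.integral_const_mul, intervalIntegral.integral_const_mul, ← hg.eq]
  ring

theorem hasDerivAt_integral_condKernel_mul (hg : Continuous g) (x : ℝ) :
    HasDerivAt (fun x => ∫ y in (-t)..t, (condKernel N x y : ℂ) * g y)
      (∫ y in (-t)..t, (condKernel' N x y : ℂ) * g y) x := by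
  obtain ⟨B, hB⟩ : ∃ B : ℝ, ∀ p ∈ Icc (x - 1) (x + 1) ×ˢ uIcc (-t) t,
      ‖(condKernel' N p.1 p.2 : ℂ) * g p.2‖ ≤ B := by
    have hc : Continuous fun p : ℝ × ℝ => (condKernel' N p.1 p.2 : ℂ) * g p.2 := by
      have := continuous_dirichletKer N
      have := continuous_dirichletKer' N
      unfold condKernel'
      fun_prop
    exact (isCompact_Icc.prod isCompact_uIcc).exists_bound_of_continuousOn hc.continuousOn
  have hcont : ∀ z, Continuous fun y => (condKernel N z y : ℂ) * g y := fun z =>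
    (Complex.continuous_ofReal.comp (continuous_condKernel_right N z)).mul hg
  have hcont' : Continuous fun y => (condKernel' N x y : ℂ) * g y :=
    (Complex.continuous_ofReal.comp (continuous_condKernel'_right N x)).mul hg
  refine (intervalIntegral.hasDerivAt_integral_of_dominated_loc_of_deriv_le
    (F := fun z y => (condKernel N z y : ℂ) * g y)
    (F' := fun z y => (condKernel' N z y : ℂ) * g y) (bound := fun _ => B)
    (s := Icc (x - 1) (x + 1)) (Icc_mem_nhds (by linarith) (by linarith))
    (Eventually.of_forall fun z => (hcont z).aestronglyMeasurable)
    ((hcont x).intervalIntegrable _ _) hcont'.aestronglyMeasurable ?_ ?_ ?_).2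
  · exact ae_of_all _ fun y hy z hz => hB (z, y) ⟨hz, uIoc_subset_uIcc hy⟩
  · exact intervalIntegrable_const
  · exact ae_of_all _ fun y _ z _ => (hasDerivAt_condKernel N z y).ofReal_comp.mul_const _

/-- The commutator of `i (1 - e^{ix}) d/dx` with the integral operator on `[-t, t]`. -/
theorem Solves.deriv (hN : 1 ≤ N) (hg : Solves N t g f) {g' f' : ℝ → ℂ}
    (hg' : ∀ x, HasDerivAt g (g' x) x) (hgc : Continuous g') (hf' : ∀ x, HasDerivAt f (f' x) x) :
    Solves N t (fun x => I * (1 - unitExp x) * g' x) (fun x => I * (1 - unitExp x) * f' x +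
      (N - 1) / 2 * phiTilde N x * (∫ y in (-t)..t, psiTilde N y * g y) +
      (N + 1) / 2 * psiTilde N x * (∫ y in (-t)..t, phiTilde N y * g y) -
      I * (1 - unitExp t) * condKernel N x t * g t +
      I * (1 - unitExp (-t)) * condKernel N x (-t) * g (-t)) := by
  have hφ := continuous_phiTilde hN
  have hψ := continuous_psiTilde hN
  have hm := continuous_unitExp
  refine ⟨(continuous_const.mul (continuous_const.sub hm)).mul hgc, fun x => ?_⟩
  have hK := Complex.continuous_ofReal.comp (continuous_condKernel_right N x)
  have hK1 := Complex.continuous_ofReal.comp (continuous_condKernel'_right N x)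
  have hK2 := Complex.continuous_ofReal.comp (continuous_condKernel'_left N x)
  simp only [Function.comp_def] at hK hK1 hK2
  have hgx : g' x - ∫ y in (-t)..t, (condKernel' N x y : ℂ) * g y = f' x := by
    have h1 := (hg' x).sub (hasDerivAt_integral_condKernel_mul (N := N) (t := t) hg.continuous x)
    have h2 : (g - fun x => ∫ y in (-t)..t, (condKernel N x y : ℂ) * g y) = f :=
      funext fun x => hg.eq x
    rw [h2] at h1
    exact h1.unique (hf' x)
  -- Integration by parts moves the derivative from `g` to the kernel and leaves the boundary terms
  -- at `±t`.
  have hparts : ∫ y in (-t)..t, (condKernel N x y : ℂ) * (I * (1 - unitExp y) * g' y) =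
      condKernel N x t * (I * (1 - unitExp t)) * g t -
        condKernel N x (-t) * (I * (1 - unitExp (-t))) * g (-t) -
        ∫ y in (-t)..t, ((condKernel' N y x : ℂ) * (I * (1 - unitExp y)) +
          (condKernel N x y : ℂ) * unitExp y) * g y := by
    have hu : ∀ y ∈ uIcc (-t) t, HasDerivAt
        (fun y => (condKernel N x y : ℂ) * (I * (1 - unitExp y)))
        ((condKernel' N y x : ℂ) * (I * (1 - unitExp y)) +
          (condKernel N x y : ℂ) * unitExp y) y := by
      intro y _
      have h1 := (hasDerivAt_condKernel N y x).ofReal_comp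
      simp only [condKernel_symm N _ x] at h1
      refine (h1.mul (((hasDerivAt_unitExp y).const_sub 1).const_mul I)).congr_deriv ?_
      linear_combination -(condKernel N x y : ℂ) * unitExp y * Complex.I_mul_I
    have h2 := intervalIntegral.integral_mul_deriv_eq_deriv_mul hu (fun y _ => hg' y)
      (Continuous.intervalIntegrable (by fun_prop) _ _) (hgc.intervalIntegrable _ _)
    rw [← h2]
    refine intervalIntegral.integral_congr fun y _ => ?_
    ring
  -- Differentiating `1 - e^{iy}` adds `e^{iy} K̃`, so `-(e^{ix} - e^{iy})/2 · K̃` remains. Half of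
  -- Christoffel–Darboux removes it and turns the coefficients `N/2` into `(N ∓ 1)/2`.
  have hcomb : (I * (1 - unitExp x)) * (∫ y in (-t)..t, (condKernel' N x y : ℂ) * g y) +
      ∫ y in (-t)..t, ((condKernel' N y x : ℂ) * (I * (1 - unitExp y)) +
          (condKernel N x y : ℂ) * unitExp y) * g y =
      (N - 1) / 2 * phiTilde N x * (∫ y in (-t)..t, psiTilde N y * g y) +
      (N + 1) / 2 * psiTilde N x * (∫ y in (-t)..t, phiTilde N y * g y) := by
    have hgc0 := hg.continuous
    rw [← intervalIntegral.integral_const_mul, ← intervalIntegral.integral_const_mul,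
      ← intervalIntegral.integral_const_mul, ← intervalIntegral.integral_add
        (Continuous.intervalIntegrable (by fun_prop) _ _)
        (Continuous.intervalIntegrable (by fun_prop) _ _),
      ← intervalIntegral.integral_add
        (Continuous.intervalIntegrable (by fun_prop) _ _)
        (Continuous.intervalIntegrable (by fun_prop) _ _)]
    refine intervalIntegral.integral_congr fun y _ => ?_
    have h1 := condKernel_derivation hN x y
    have h2 := unitExp_sub_mul_condKernel hN x y
    linear_combination g y * h1 - g y / 2 * h2
  rw [hparts, ← hgx]
  linear_combination hcomb

theorem conj_unitExp (x : ℝ) : conj (unitExp x) = unitExp (-x) := by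
  rw [unitExp, unitExp, ← Complex.exp_conj]
  simp

theorem conj_phiTilde (hN : 1 ≤ N) (x : ℝ) : conj (phiTilde N x) = phiTilde N (-x) := by
  rw [phiTilde_eq hN, phiTilde_eq hN, dirichletKer_neg]
  simp [expPlus, ← Complex.exp_conj, map_ofNat]

theorem conj_psiTilde (hN : 1 ≤ N) (x : ℝ) : conj (psiTilde N x) = psiTilde N (-x) := by
  rw [psiTilde_eq hN, psiTilde_eq hN, dirichletKer_neg]
  simp [expMinus, ← Complex.exp_conj, map_ofNat]

/-- The kernel is real and invariant under `(x, y) ↦ (-x, -y)`. Together with `Solves.conj` and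
uniqueness this yields `q₁ = conj q₂`. -/
theorem Solves.comp_neg (hg : Solves N t g f) :
    Solves N t (fun x => g (-x)) (fun x => f (-x)) := by
  refine ⟨hg.continuous.comp continuous_neg, fun x => ?_⟩
  rw [← hg.eq (-x)]
  congr 1
  have h := intervalIntegral.integral_comp_neg (a := -t) (b := t)
    fun y => (condKernel N (-x) y : ℂ) * g y
  rw [neg_neg] at h
  rw [← h]
  simp only [condKernel_neg_neg]

theorem Solves.conj (hg : Solves N t g f) :
    Solves N t (fun x => conj (g x)) (fun x => conj (f x)) := by
  refine ⟨Complex.continuous_conj.comp hg.continuous, fun x => ?_⟩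
  rw [← hg.eq x, map_sub]
  congr 1
  rw [← intervalIntegral.intervalIntegral_conj]
  simp

end IntegralEquation

/-! ### The Tracy–Widom equations -/

section TracyWidom

open Complex (I)
open Matrix

variable {N : ℕ} {t : ℝ}

noncomputable def cueBasis' (N : ℕ) (k : Fin (N - 1)) (x : ℝ) : ℝ :=
  (√(2 * π * N))⁻¹ * dirichletKer' N (x - node N (k + 1))

theorem hasDerivAt_cueBasis (N : ℕ) (k : Fin (N - 1)) (x : ℝ) :
    HasDerivAt (cueBasis N k) (cueBasis' N k x) x :=
  ((hasDerivAt_dirichletKer N _).comp_sub_const x _).const_mul _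

theorem continuous_cueBasis' (N : ℕ) (k : Fin (N - 1)) : Continuous (cueBasis' N k) := by
  have := continuous_dirichletKer' N
  unfold cueBasis'
  fun_prop

theorem hasDerivAt_cvec_dotProduct (w : Fin (N - 1) → ℂ) (x : ℝ) :
    HasDerivAt (fun x => cvec (cueBasis N) x ⬝ᵥ w) (cvec (cueBasis' N) x ⬝ᵥ w) x :=
  HasDerivAt.fun_sum fun k _ => (hasDerivAt_cueBasis N k x).ofReal_comp.mul_const _

/-- `(1 - K̃)⁻¹ f` on `[-t, t]`. -/
noncomputable def cueRes (N : ℕ) (t : ℝ) (f : ℝ → ℂ) : ℝ → ℂ := resApply (cueBasis N) (-t) t f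

/-- The derivative of `cueRes N t f`, when `f'` is the derivative of `f`. -/
noncomputable def cueRes' (N : ℕ) (t : ℝ) (f f' : ℝ → ℂ) (x : ℝ) : ℂ :=
  f' x + cvec (cueBasis' N) x ⬝ᵥ resMatC (cueBasis N) t *ᵥ moment (cueBasis N) (-t) t f

/-- The resolvent kernel of `K̃` on `[-t, t]`. -/
noncomputable def cueResKer (N : ℕ) (t x y : ℝ) : ℂ := resKer (cueBasis N) (-t) t x y

theorem resolventApply_condKernel (hN : 1 ≤ N) (ht : t ∈ Ioo 0 π) {f : ℝ → ℂ}
    (hf : Continuous f) : resolventApply (condKernel N) (-t) t f = cueRes N t f := by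
  rw [condKernel_eq_finKer hN]
  exact resolventApply_finKer (continuous_cueBasis N) (by linarith [ht.1]) (posDef_cueBasis ht)
    hf.continuousOn

theorem hasDerivAt_cueRes {f f' : ℝ → ℂ} (hf : ∀ x, HasDerivAt f (f' x) x) (x : ℝ) :
    HasDerivAt (cueRes N t f) (cueRes' N t f f' x) x := by
  have h1 : HasDerivAt (fun x => cvec (cueBasis N) x ⬝ᵥ
      resMatC (cueBasis N) t *ᵥ moment (cueBasis N) (-t) t f)
      (cvec (cueBasis' N) x ⬝ᵥ
        resMatC (cueBasis N) t *ᵥ moment (cueBasis N) (-t) t f) x :=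
    hasDerivAt_cvec_dotProduct _ x
  exact (hf x).add h1

theorem continuous_cueRes' {f f' : ℝ → ℂ} (hf' : Continuous f') :
    Continuous (cueRes' N t f f') :=
  hf'.add (continuous_cvec_dotProduct (continuous_cueBasis' N) _)

theorem solves_cueRes (hN : 1 ≤ N) (ht : t ∈ Ioo 0 π) {f : ℝ → ℂ} (hf : Continuous f) :
    Solves N t (cueRes N t f) f := solves_resApply hN ht hf

theorem solves_cueResKer (hN : 1 ≤ N) (ht : t ∈ Ioo 0 π) (y : ℝ) :
    Solves N t (fun x => cueResKer N t x y) (fun x => (condKernel N x y : ℂ)) := by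
  have hle : -t ≤ t := by linarith [ht.1]
  have hcont : Continuous fun x => cueResKer N t x y :=
    continuous_cvec_dotProduct (continuous_cueBasis N) _
  refine ⟨hcont, fun x => ?_⟩
  rw [condKernel_eq_finKer hN, integral_finKer_mul (continuous_cueBasis N) hle hcont.continuousOn]
  have h1 : moment (cueBasis N) (-t) t (fun x => cueResKer N t x y) =
      (gramMat (cueBasis N) (-t) t).map Complex.ofRealHom *ᵥ
        (resMat (cueBasis N) (-t) t).map Complex.ofRealHom *ᵥ cvec (cueBasis N) y :=
    moment_cvec_dotProduct (continuous_cueBasis N) _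
  rw [h1, cueResKer, resKer, ← dotProduct_sub, mulVec_mulVec, ← sub_mulVec,
    map_mul_resMat (posDef_cueBasis ht), one_mulVec]
  simp [finKer, dotProduct, cvec]

theorem integral_mul_cueResKer {h : ℝ → ℂ} (hh : Continuous h) (y : ℝ) :
    ∫ x in (-t)..t, h x * cueResKer N t x y = cueRes N t h y - h y := by
  simp only [cueResKer, resKer_eq_resMatC]
  rw [integral_mul_cvec_dotProduct (continuous_cueBasis N) hh, dotProduct_resMatC_comm, cueRes,
    resApply_eq_resMatC, add_sub_cancel_left]

/-- Symmetry of the resolvent; in particular `∫ φ̃ P = ∫ ψ̃ Q = v`. -/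
theorem integral_mul_cueRes_comm {f h : ℝ → ℂ} (hf : Continuous f) (hh : Continuous h) :
    ∫ x in (-t)..t, h x * cueRes N t f x = ∫ x in (-t)..t, f x * cueRes N t h x := by
  simp only [cueRes]
  rw [integral_mul_resApply (continuous_cueBasis N) hf hh,
    integral_mul_resApply (continuous_cueBasis N) hh hf, dotProduct_resMatC_comm]
  simp only [mul_comm]

/-- Applying `Solves.unitExp_mul` to a column of `R`, whose integrals against `φ̃, ψ̃` are `Q - φ̃`
and `P - ψ̃`, shows that both sides solve the same integral equation. -/
theorem unitExp_sub_mul_cueResKer (hN : 1 ≤ N) (ht : t ∈ Ioo 0 π) (x y : ℝ) :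
    (unitExp x - unitExp y) * cueResKer N t x y =
      cueRes N t (phiTilde N) x * cueRes N t (psiTilde N) y -
        cueRes N t (psiTilde N) x * cueRes N t (phiTilde N) y := by
  have hφ := continuous_phiTilde hN
  have hψ := continuous_psiTilde hN
  have hR := solves_cueResKer hN ht y
  have h1 := (hR.unitExp_mul hN).add (hR.const_mul (-unitExp y))
  have h2 := ((solves_cueRes hN ht hφ).const_mul (cueRes N t (psiTilde N) y)).add
    ((solves_cueRes hN ht hψ).const_mul (-cueRes N t (phiTilde N) y))
  rw [integral_mul_cueResKer hφ, integral_mul_cueResKer hψ] at h1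
  have h3 := h1.congr_right fun x => (by
    linear_combination unitExp_sub_mul_condKernel hN x y :
      _ = cueRes N t (psiTilde N) y * phiTilde N x + -cueRes N t (phiTilde N) y * psiTilde N x)
  have h4 := Solves.unique hN ht (by fun_prop) h3 h2 x
  linear_combination h4

/-- The differential equation in `x` of `Q` and `P`. -/
theorem cueRes_phiTilde_ode (hN : 1 ≤ N) (ht : t ∈ Ioo 0 π) (x : ℝ) :
    I * (1 - unitExp x) * cueRes' N t (phiTilde N) (phiTilde' N) x =
      (-((N + 1) / 2) * (1 - unitExp x) + 1 / N -
        ∫ y in (-t)..t, psiTilde N y * cueRes N t (phiTilde N) y) *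
          cueRes N t (phiTilde N) x +
      (N + 1) * ((∫ y in (-t)..t, phiTilde N y * cueRes N t (phiTilde N) y) - 1 / N) *
          cueRes N t (psiTilde N) x -
      I * (1 - unitExp t) * cueResKer N t x t * cueRes N t (phiTilde N) t +
      I * (1 - unitExp (-t)) * cueResKer N t x (-t) * cueRes N t (phiTilde N) (-t) := by
  have hφ := continuous_phiTilde hN
  have hψ := continuous_psiTilde hN
  have hK1 := Complex.continuous_ofReal.comp (continuous_condKernel_right N t)
  have hK2 := Complex.continuous_ofReal.comp (continuous_condKernel_right N (-t))
  have hm := continuous_unitExp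
  have hQ := solves_cueRes hN ht hφ
  have hP := solves_cueRes hN ht hψ
  have h1 := hQ.deriv hN (hasDerivAt_cueRes (hasDerivAt_phiTilde hN))
    (continuous_cueRes' (continuous_phiTilde' N)) (hasDerivAt_phiTilde hN)
  set u := ∫ y in (-t)..t, phiTilde N y * cueRes N t (phiTilde N) y
  set v := ∫ y in (-t)..t, psiTilde N y * cueRes N t (phiTilde N) y
  -- The claimed right-hand side, built from known solutions. The source of `e^{ix} Q` contains `φ̃
  -- v - ψ̃ u`, which shifts the coefficients of `v φ̃` and `u ψ̃` to the ones in `h1`.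
  have h2 := ((((hQ.const_mul (-((N + 1) / 2) + 1 / N - v)).add
    ((hQ.unitExp_mul hN).const_mul ((N + 1) / 2))).add
    (hP.const_mul ((N + 1) * (u - 1 / N)))).add
    ((solves_cueResKer hN ht t).const_mul
      (-(I * (1 - unitExp t) * cueRes N t (phiTilde N) t)))).add
    ((solves_cueResKer hN ht (-t)).const_mul
      (I * (1 - unitExp (-t)) * cueRes N t (phiTilde N) (-t)))
  have h3 := h1.congr_right (f₂ := fun x => (-((N + 1) / 2) + 1 / N - v) * phiTilde N x +
      (N + 1) / 2 * (unitExp x * phiTilde N x + phiTilde N x * v - psiTilde N x * u) +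
      (N + 1) * (u - 1 / N) * psiTilde N x +
      -(I * (1 - unitExp t) * cueRes N t (phiTilde N) t) * condKernel N x t +
      I * (1 - unitExp (-t)) * cueRes N t (phiTilde N) (-t) * condKernel N x (-t)) fun x => by
    rw [phiTilde_ode hN]; ring
  have h4 := Solves.unique hN ht (by
    simp only [condKernel_symm N _ t, condKernel_symm N _ (-t)]
    simp only [Function.comp_def] at hK1 hK2
    fun_prop) h3 h2 x
  linear_combination h4

theorem cueRes_psiTilde_ode (hN : 1 ≤ N) (ht : t ∈ Ioo 0 π) (x : ℝ) :
    I * (1 - unitExp x) * cueRes' N t (psiTilde N) (psiTilde' N) x =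
      ((N - 1) / 2 * (1 - unitExp x) - 1 / N +
        ∫ y in (-t)..t, psiTilde N y * cueRes N t (phiTilde N) y) *
          cueRes N t (psiTilde N) x +
      (N - 1) * ((∫ y in (-t)..t, psiTilde N y * cueRes N t (psiTilde N) y) - 1 / N) *
          cueRes N t (phiTilde N) x -
      I * (1 - unitExp t) * cueResKer N t x t * cueRes N t (psiTilde N) t +
      I * (1 - unitExp (-t)) * cueResKer N t x (-t) * cueRes N t (psiTilde N) (-t) := by
  have hφ := continuous_phiTilde hN
  have hψ := continuous_psiTilde hN
  have hK1 := Complex.continuous_ofReal.comp (continuous_condKernel_right N t)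
  have hK2 := Complex.continuous_ofReal.comp (continuous_condKernel_right N (-t))
  have hm := continuous_unitExp
  have hQ := solves_cueRes hN ht hφ
  have hP := solves_cueRes hN ht hψ
  have h1 := hP.deriv hN (hasDerivAt_cueRes (hasDerivAt_psiTilde hN))
    (continuous_cueRes' (continuous_psiTilde' N)) (hasDerivAt_psiTilde hN)
  have h0 := hP.unitExp_mul hN
  rw [integral_mul_cueRes_comm hψ hφ] at h0 h1
  set w := ∫ y in (-t)..t, psiTilde N y * cueRes N t (psiTilde N) y
  set v := ∫ y in (-t)..t, psiTilde N y * cueRes N t (phiTilde N) y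
  have h2 := ((((hP.const_mul ((N - 1) / 2 - 1 / N + v)).add
    (h0.const_mul (-((N - 1) / 2)))).add
    (hQ.const_mul ((N - 1) * (w - 1 / N)))).add
    ((solves_cueResKer hN ht t).const_mul
      (-(I * (1 - unitExp t) * cueRes N t (psiTilde N) t)))).add
    ((solves_cueResKer hN ht (-t)).const_mul
      (I * (1 - unitExp (-t)) * cueRes N t (psiTilde N) (-t)))
  have h3 := h1.congr_right (f₂ := fun x => ((N - 1) / 2 - 1 / N + v) * psiTilde N x +
      -((N - 1) / 2) * (unitExp x * psiTilde N x + phiTilde N x * w - psiTilde N x * v) +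
      (N - 1) * (w - 1 / N) * phiTilde N x +
      -(I * (1 - unitExp t) * cueRes N t (psiTilde N) t) * condKernel N x t +
      I * (1 - unitExp (-t)) * cueRes N t (psiTilde N) (-t) * condKernel N x (-t)) fun x => by
    rw [psiTilde_ode hN]; ring
  have h4 := Solves.unique hN ht (by
    simp only [condKernel_symm N _ t, condKernel_symm N _ (-t)]
    simp only [Function.comp_def] at hK1 hK2
    fun_prop) h3 h2 x
  linear_combination h4

theorem conj_cueRes_neg (hN : 1 ≤ N) (ht : t ∈ Ioo 0 π) {f : ℝ → ℂ} (hf : Continuous f)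
    (hsymm : ∀ x, conj (f x) = f (-x)) (x : ℝ) :
    conj (cueRes N t f x) = cueRes N t f (-x) := by
  have h := solves_cueRes hN ht hf
  have h1 := h.conj.congr_right hsymm
  exact Solves.unique hN ht (hf.comp continuous_neg) h1 h.comp_neg x

theorem conj_integral_mul_cueRes (hN : 1 ≤ N) (ht : t ∈ Ioo 0 π) {f h : ℝ → ℂ}
    (hf : Continuous f) (hfs : ∀ x, conj (f x) = f (-x)) (hhs : ∀ x, conj (h x) = h (-x)) :
    conj (∫ x in (-t)..t, h x * cueRes N t f x) = ∫ x in (-t)..t, h x * cueRes N t f x := by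
  rw [← intervalIntegral.intervalIntegral_conj]
  simp only [map_mul, hhs, conj_cueRes_neg hN ht hf hfs]
  have h := intervalIntegral.integral_comp_neg (a := -t) (b := t)
    fun y => h y * cueRes N t f y
  rw [neg_neg] at h
  exact h

theorem conj_cueResKer (x y : ℝ) : conj (cueResKer N t x y) = cueResKer N t x y :=
  conj_resKer _ _ _ _ _

theorem cueResKer_neg_neg (hN : 1 ≤ N) (ht : t ∈ Ioo 0 π) (x y : ℝ) :
    cueResKer N t (-x) (-y) = cueResKer N t x y := by
  have h1 := (solves_cueResKer hN ht (-y)).comp_neg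
  have h2 := h1.congr_right fun x => congrArg Complex.ofReal (condKernel_neg_neg N x y)
  refine Solves.unique hN ht ?_ h2 (solves_cueResKer hN ht y) x
  simp only [condKernel_symm N _ y]
  exact Complex.continuous_ofReal.comp (continuous_condKernel_right N y)

/-- The diagonal of the resolvent kernel. -/
theorem cueResKer_diag (hN : 1 ≤ N) (ht : t ∈ Ioo 0 π) (x : ℝ) :
    I * unitExp x * cueResKer N t x x =
      cueRes' N t (phiTilde N) (phiTilde' N) x * cueRes N t (psiTilde N) x -
        cueRes' N t (psiTilde N) (psiTilde' N) x * cueRes N t (phiTilde N) x := by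
  have hR : HasDerivAt (fun z => cueResKer N t z x)
      (cvec (cueBasis' N) x ⬝ᵥ resMatC (cueBasis N) t *ᵥ cvec (cueBasis N) x) x :=
    hasDerivAt_cvec_dotProduct _ x
  -- Both sides of Christoffel–Darboux for `R` are differentiated in the first variable at `z = x`,
  -- where the factor `e^{iz} - e^{ix}` vanishes and only its derivative survives.
  have h1 := ((hasDerivAt_unitExp x).sub_const (unitExp x)).mul hR
  have h2 := ((hasDerivAt_cueRes (N := N) (t := t) (hasDerivAt_phiTilde hN) x).mul_const
    (cueRes N t (psiTilde N) x)).sub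
    ((hasDerivAt_cueRes (N := N) (t := t) (hasDerivAt_psiTilde hN) x).mul_const
    (cueRes N t (phiTilde N) x))
  have h3 : ((fun z => unitExp z - unitExp x) * fun z => cueResKer N t z x) =
      (fun z => cueRes N t (phiTilde N) z * cueRes N t (psiTilde N) x) -
        fun z => cueRes N t (psiTilde N) z * cueRes N t (phiTilde N) x :=
    funext fun z => unitExp_sub_mul_cueResKer hN ht z x
  rw [h3] at h1
  have h4 := h1.unique h2
  linear_combination h4

end TracyWidom

/-! ### The differential system on the symmetric interval -/

section Symmetric

open Complex (I)

variable {N : ℕ} {t : ℝ}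

theorem twQ_eq (hN : 1 ≤ N) (ht : t ∈ Ioo 0 π) (x : ℝ) :
    twQ N (-t) t x = cueRes N t (phiTilde N) x := by
  rw [twQ, resolventApply_condKernel hN ht (continuous_phiTilde hN)]

theorem twP_eq (hN : 1 ≤ N) (ht : t ∈ Ioo 0 π) (x : ℝ) :
    twP N (-t) t x = cueRes N t (psiTilde N) x := by
  rw [twP, resolventApply_condKernel hN ht (continuous_psiTilde hN)]

theorem symQ_eq (hN : 1 ≤ N) (ht : t ∈ Ioo 0 π) : symQ N t = cueRes N t (phiTilde N) t :=
  twQ_eq hN ht t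

theorem symP_eq (hN : 1 ≤ N) (ht : t ∈ Ioo 0 π) : symP N t = cueRes N t (psiTilde N) t :=
  twP_eq hN ht t

theorem symU_eq (hN : 1 ≤ N) (ht : t ∈ Ioo 0 π) :
    symU N t = ∫ x in (-t)..t, phiTilde N x * cueRes N t (phiTilde N) x := by
  simp only [symU, twU, twQ_eq hN ht]

theorem symW_eq (hN : 1 ≤ N) (ht : t ∈ Ioo 0 π) :
    symW N t = ∫ x in (-t)..t, psiTilde N x * cueRes N t (psiTilde N) x := by
  simp only [symW, twW, twP_eq hN ht]

theorem symV_eq (hN : 1 ≤ N) (ht : t ∈ Ioo 0 π) :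
    symV N t = ∫ x in (-t)..t, psiTilde N x * cueRes N t (phiTilde N) x := by
  simp only [symV, twV, twQ_eq hN ht]

theorem symJ_eq (hN : 1 ≤ N) (h0 : 0 ≤ t) (ht : t < π) :
    symJ N t = (1 - gramMat (cueBasis N) (-t) t).det := condJanossy_eq_det hN h0 ht

theorem conj_symQ (hN : 1 ≤ N) (ht : t ∈ Ioo 0 π) :
    conj (symQ N t) = cueRes N t (phiTilde N) (-t) := by
  rw [symQ_eq hN ht, conj_cueRes_neg hN ht (continuous_phiTilde hN) (conj_phiTilde hN)]

theorem conj_symP (hN : 1 ≤ N) (ht : t ∈ Ioo 0 π) :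
    conj (symP N t) = cueRes N t (psiTilde N) (-t) := by
  rw [symP_eq hN ht, conj_cueRes_neg hN ht (continuous_psiTilde hN) (conj_psiTilde hN)]

theorem hasDerivAt_cueRes_diag {f f' : ℝ → ℂ} (ht : t ∈ Ioo 0 π)
    (hf : ∀ x, HasDerivAt f (f' x) x) :
    HasDerivAt (fun s => cueRes N s f s) (cueRes' N t f f' t +
      cueResKer N t t t * cueRes N t f t + cueResKer N t t (-t) * cueRes N t f (-t)) t :=
  hasDerivAt_resApply_diag (continuous_cueBasis N) (det_cueBasis_ne_zero ht)
    (hasDerivAt_cueBasis N) hf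

/-- The derivative of `symQ`. -/
noncomputable def symQ' (N : ℕ) (t : ℝ) : ℂ :=
  cueRes' N t (phiTilde N) (phiTilde' N) t + cueResKer N t t t * symQ N t +
    cueResKer N t t (-t) * conj (symQ N t)

/-- The derivative of `symP`. -/
noncomputable def symP' (N : ℕ) (t : ℝ) : ℂ :=
  cueRes' N t (psiTilde N) (psiTilde' N) t + cueResKer N t t t * symP N t +
    cueResKer N t t (-t) * conj (symP N t)

theorem hasDerivAt_symQ (hN : 1 ≤ N) (ht : t ∈ Ioo 0 π) : HasDerivAt (symQ N) (symQ' N t) t := by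
  rw [symQ', conj_symQ hN ht, symQ_eq hN ht]
  refine (hasDerivAt_cueRes_diag ht (hasDerivAt_phiTilde hN)).congr_of_eventuallyEq ?_
  filter_upwards [isOpen_Ioo.mem_nhds ht] with s hs using symQ_eq hN hs

theorem hasDerivAt_symP (hN : 1 ≤ N) (ht : t ∈ Ioo 0 π) : HasDerivAt (symP N) (symP' N t) t := by
  rw [symP', conj_symP hN ht, symP_eq hN ht]
  refine (hasDerivAt_cueRes_diag ht (hasDerivAt_psiTilde hN)).congr_of_eventuallyEq ?_
  filter_upwards [isOpen_Ioo.mem_nhds ht] with s hs using symP_eq hN hs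

theorem hasDerivAt_symU (hN : 1 ≤ N) (ht : t ∈ Ioo 0 π) :
    HasDerivAt (symU N) (symQ N t ^ 2 + conj (symQ N t) ^ 2) t := by
  have h := hasDerivAt_integral_mul_resApply (continuous_cueBasis N) (det_cueBasis_ne_zero ht)
    (continuous_phiTilde hN) (continuous_phiTilde hN)
  rw [conj_symQ hN ht, symQ_eq hN ht, pow_two, pow_two]
  refine h.congr_of_eventuallyEq ?_
  filter_upwards [isOpen_Ioo.mem_nhds ht] with s hs using symU_eq hN hs

theorem hasDerivAt_symW (hN : 1 ≤ N) (ht : t ∈ Ioo 0 π) :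
    HasDerivAt (symW N) (symP N t ^ 2 + conj (symP N t) ^ 2) t := by
  have h := hasDerivAt_integral_mul_resApply (continuous_cueBasis N) (det_cueBasis_ne_zero ht)
    (continuous_psiTilde hN) (continuous_psiTilde hN)
  rw [conj_symP hN ht, symP_eq hN ht, pow_two, pow_two]
  refine h.congr_of_eventuallyEq ?_
  filter_upwards [isOpen_Ioo.mem_nhds ht] with s hs using symW_eq hN hs

theorem hasDerivAt_symV (hN : 1 ≤ N) (ht : t ∈ Ioo 0 π) :
    HasDerivAt (symV N) (symQ N t * symP N t + conj (symQ N t) * conj (symP N t)) t := by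
  have h := hasDerivAt_integral_mul_resApply (continuous_cueBasis N) (det_cueBasis_ne_zero ht)
    (continuous_phiTilde hN) (continuous_psiTilde hN)
  rw [conj_symQ hN ht, symQ_eq hN ht, conj_symP hN ht, symP_eq hN ht, mul_comm,
    mul_comm (cueRes N t (phiTilde N) (-t))]
  refine h.congr_of_eventuallyEq ?_
  filter_upwards [isOpen_Ioo.mem_nhds ht] with s hs using symV_eq hN hs

theorem unitExp_sub_neg (t : ℝ) : unitExp t - unitExp (-t) = 2 * I * Real.sin t := by
  have h1 : unitExp t = Complex.cos t + Complex.sin t * I := by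
    rw [unitExp, mul_comm, Complex.exp_mul_I]
  have h2 : unitExp (-t) = Complex.cos t - Complex.sin t * I := by
    rw [unitExp, mul_comm, Complex.exp_mul_I]
    simp [sub_eq_add_neg]
  rw [h1, h2]; push_cast; ring

theorem unitExp_add_neg (t : ℝ) : unitExp t + unitExp (-t) = 2 * Real.cos t := by
  have h1 : unitExp t = Complex.cos t + Complex.sin t * I := by
    rw [unitExp, mul_comm, Complex.exp_mul_I]
  have h2 : unitExp (-t) = Complex.cos t - Complex.sin t * I := by
    rw [unitExp, mul_comm, Complex.exp_mul_I]
    simp [sub_eq_add_neg]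
  rw [h1, h2]; push_cast; ring

theorem unitExp_mul_neg (t : ℝ) : unitExp t * unitExp (-t) = 1 := by
  rw [unitExp, unitExp, ← Complex.exp_add]; simp

/-- The right side is `i(1 - e^{it}) + i(1 - e^{-it})`, the total coefficient of `R(t, -t)` in the
equations for `q` and `p`. -/
theorem tan_half_mul_unitExp_sub (ht : t ∈ Ioo 0 π) :
    Real.tan (t / 2) * (unitExp t - unitExp (-t)) = I * (2 - (unitExp t + unitExp (-t))) := by
  have hc : 0 < Real.cos (t / 2) := Real.cos_pos_of_mem_Ioo ⟨by linarith [ht.1, Real.pi_pos],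
    by linarith [ht.2]⟩
  have h1 : Real.tan (t / 2) * Real.sin t = 1 - Real.cos t := by
    have hs : Real.sin t = 2 * Real.sin (t / 2) * Real.cos (t / 2) := by
      rw [← Real.sin_two_mul]; ring_nf
    have hcos : Real.cos t = 1 - 2 * Real.sin (t / 2) ^ 2 := by
      rw [show t = 2 * (t / 2) by ring, Real.cos_two_mul']
      rw [show 2 * (t / 2) / 2 = t / 2 by ring]
      linarith [Real.sin_sq_add_cos_sq (t / 2)]
    rw [Real.tan_eq_sin_div_cos, hs, hcos]
    field_simp
    ring
  have h2 : (Real.tan (t / 2) : ℂ) * Real.sin t = 1 - Real.cos t := by exact_mod_cast h1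
  rw [unitExp_sub_neg, unitExp_add_neg]
  linear_combination 2 * I * h2

theorem cot_mul_unitExp_sub (ht : t ∈ Ioo 0 π) :
    Real.cot t * (unitExp t - unitExp (-t)) = I * (unitExp t + unitExp (-t)) := by
  have h1 : Real.cot t * Real.sin t = Real.cos t := by
    rw [Real.cot_eq_cos_div_sin, div_mul_cancel₀ _ (Real.sin_pos_of_mem_Ioo ht).ne']
  have h2 : (Real.cot t : ℂ) * Real.sin t = Real.cos t := by exact_mod_cast h1
  rw [unitExp_sub_neg, unitExp_add_neg]
  linear_combination 2 * I * h2

theorem cueResKer_antidiag (hN : 1 ≤ N) (ht : t ∈ Ioo 0 π) :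
    (unitExp t - unitExp (-t)) * cueResKer N t t (-t) =
      symQ N t * conj (symP N t) - symP N t * conj (symQ N t) := by
  rw [conj_symQ hN ht, conj_symP hN ht, symQ_eq hN ht, symP_eq hN ht]
  exact unitExp_sub_mul_cueResKer hN ht t (-t)

/-- The `R(t, t)` term from the moving end point cancels the boundary term of the equation in `x`.
The two `R(t, -t)` terms combine, and Christoffel–Darboux rewrites them by `q` and `p`. -/
theorem symQ_ode (hN : 1 ≤ N) (ht : t ∈ Ioo 0 π) :
    I * (1 - unitExp t) * symQ' N t =
      -(((N : ℂ) + 1) / 2 * (1 - unitExp t) + symV N t - 1 / N) * symQ N t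
        + ((N : ℂ) + 1) * (symU N t - 1 / N) * symP N t
        + (Real.tan (t / 2) : ℂ) *
          (symQ N t * conj (symP N t) - symP N t * conj (symQ N t)) * conj (symQ N t) := by
  have h1 := cueRes_phiTilde_ode hN ht t
  rw [← symV_eq hN ht, ← symU_eq hN ht, ← symQ_eq hN ht, ← symP_eq hN ht, ← conj_symQ hN ht] at h1
  have h2 := cueResKer_antidiag hN ht
  have h3 := tan_half_mul_unitExp_sub ht
  rw [symQ']
  linear_combination h1 + (Real.tan (t / 2) : ℂ) * conj (symQ N t) * h2 -
    cueResKer N t t (-t) * conj (symQ N t) * h3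

theorem symP_ode (hN : 1 ≤ N) (ht : t ∈ Ioo 0 π) :
    I * (1 - unitExp t) * symP' N t =
      (((N : ℂ) - 1) / 2 * (1 - unitExp t) + symV N t - 1 / N) * symP N t
        + ((N : ℂ) - 1) * (symW N t - 1 / N) * symQ N t
        + (Real.tan (t / 2) : ℂ) *
          (symQ N t * conj (symP N t) - symP N t * conj (symQ N t)) * conj (symP N t) := by
  have h1 := cueRes_psiTilde_ode hN ht t
  rw [← symV_eq hN ht, ← symW_eq hN ht, ← symQ_eq hN ht, ← symP_eq hN ht, ← conj_symP hN ht] at h1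
  have h2 := cueResKer_antidiag hN ht
  have h3 := tan_half_mul_unitExp_sub ht
  rw [symP']
  linear_combination h1 + (Real.tan (t / 2) : ℂ) * conj (symP N t) * h2 -
    cueResKer N t t (-t) * conj (symP N t) * h3

/-- The logarithmic derivative of `symJ`. -/
noncomputable def symL (N : ℕ) (t : ℝ) : ℝ := -(2 * (cueResKer N t t t).re)

theorem hasDerivAt_symJ (hN : 1 ≤ N) (ht : t ∈ Ioo 0 π) :
    HasDerivAt (symJ N) (symJ N t * symL N t) t := by
  have h := hasDerivAt_det_one_sub_gramMat (continuous_cueBasis N)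
    (det_cueBasis_ne_zero (N := N) ht)
  refine (h.congr_of_eventuallyEq ?_).congr_deriv ?_
  · filter_upwards [isOpen_Ioo.mem_nhds ht] with s hs using symJ_eq hN hs.1.le hs.2
  · rw [symJ_eq hN ht.1.le ht.2, symL]
    change -(_ * ((cueResKer N t t t).re + (cueResKer N t (-t) (-t)).re)) = _
    rw [cueResKer_neg_neg hN ht t t]
    ring

theorem symJ_pos (hN : 1 ≤ N) (h0 : 0 ≤ t) (ht : t < π) : 0 < symJ N t := by
  rw [symJ_eq hN h0 ht]
  exact (posDef_one_sub_gramMat ht).det_pos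

theorem hasDerivAt_log_symJ (hN : 1 ≤ N) (ht : t ∈ Ioo 0 π) :
    HasDerivAt (fun s => Real.log (symJ N s)) (symL N t) t := by
  have hpos := symJ_pos hN ht.1.le ht.2
  refine ((hasDerivAt_symJ hN ht).log hpos.ne').congr_deriv ?_
  field_simp

theorem nnSpacingDensity_eq (hN : 1 ≤ N) (ht : t ∈ Ioo 0 π) :
    nnSpacingDensity N t = -(symJ N t * symL N t) := by
  rw [nnSpacingDensity]
  exact congrArg Neg.neg (hasDerivAt_symJ hN ht).deriv

/-- With `X = q p̄ - p q̄`, the `R(t, t)` parts of `q'` and `p'` cancel in `p q' - q p'` and the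
`R(t, -t)` parts leave `-R(t, -t) X`. In the full expression these pieces are cancelled by the
cotangent term, leaving `-2 R(t, t)`. -/
theorem symL_eq (hN : 1 ≤ N) (ht : t ∈ Ioo 0 π) :
    (symL N t : ℂ) =
      I * unitExp (-t) * (symP N t * symQ' N t - symQ N t * symP' N t)
        - I * unitExp t *
          (conj (symP N t) * conj (symQ' N t) - conj (symQ N t) * conj (symP' N t))
        + (Real.cot t : ℂ) *
          (symQ N t * conj (symP N t) - symP N t * conj (symQ N t)) ^ 2 := by
  have hre : (((cueResKer N t t t).re : ℝ) : ℂ) = cueResKer N t t t :=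
    Complex.conj_eq_iff_re.mp (conj_cueResKer t t)
  have h1 : symP N t * symQ' N t - symQ N t * symP' N t =
      I * unitExp t * cueResKer N t t t - cueResKer N t t (-t) *
        (symQ N t * conj (symP N t) - symP N t * conj (symQ N t)) := by
    have h := cueResKer_diag hN ht t
    rw [← symQ_eq hN ht, ← symP_eq hN ht] at h
    rw [symQ', symP']
    linear_combination -h
  have h2 := congrArg conj h1
  simp only [map_sub, map_mul, Complex.conj_I, conj_unitExp, conj_cueResKer,
    Complex.conj_conj] at h2
  have h3 := cueResKer_antidiag hN ht
  have h4 := cot_mul_unitExp_sub ht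
  have h5 := unitExp_mul_neg t
  rw [h1, h2, symL, Complex.ofReal_neg, Complex.ofReal_mul, Complex.ofReal_ofNat, hre]
  set X := symQ N t * conj (symP N t) - symP N t * conj (symQ N t) with hX
  have hX' : conj (symQ N t) * symP N t - conj (symP N t) * symQ N t = -X := by rw [hX]; ring
  rw [hX']
  linear_combination (norm := (ring_nf; simp only [Complex.I_sq]; ring_nf))
    2 * cueResKer N t t t * h5 - cueResKer N t t (-t) * X * h4 + Real.cot t * X * h3

end Symmetric

/-! ### Expansions at `t = 0` -/

section Expansion

open Complex (I)
open Matrix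

variable {N : ℕ}

/-- The mean value inequality on the segment from `0` to `t`: a bound on the derivative integrates
to one more power. -/
theorem isBigO_pow_succ_of_hasDerivAt {E : Type*} [NormedAddCommGroup E] [NormedSpace ℝ E]
    {F F' : ℝ → E} {n : ℕ} (hF : ∀ᶠ s in 𝓝 (0 : ℝ), HasDerivAt F (F' s) s) (h0 : F 0 = 0)
    (hO : F' =O[𝓝 0] fun s : ℝ => s ^ n) : F =O[𝓝 0] fun s : ℝ => s ^ (n + 1) := by
  obtain ⟨C, hC⟩ := hO.bound
  obtain ⟨ε, hε, hball⟩ := Metric.eventually_nhds_iff.mp (hF.and hC)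
  refine IsBigO.of_bound C ?_
  filter_upwards [Metric.ball_mem_nhds (0 : ℝ) hε] with t ht
  have hsub : ∀ s ∈ uIcc 0 t, |s| ≤ |t| := fun s hs => by
    simpa using abs_sub_left_of_mem_uIcc hs
  have ht' : |t| < ε := by simpa using ht
  have h1 : ∀ s ∈ uIcc 0 t, HasDerivWithinAt F (F' s) (uIcc 0 t) s := fun s hs =>
    (hball (by simpa using (hsub s hs).trans_lt ht')).1.hasDerivWithinAt
  have hC0 : 0 ≤ C * |t| ^ n := by
    have h2 := (hball (y := t) (by simpa using ht')).2
    rw [norm_pow, Real.norm_eq_abs] at h2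
    exact (norm_nonneg _).trans h2
  have h2 : ∀ s ∈ uIcc 0 t, ‖F' s‖ ≤ C * |t| ^ n := by
    intro s hs
    have h3 := (hball (y := s) (by simpa using (hsub s hs).trans_lt ht')).2
    rw [norm_pow, Real.norm_eq_abs] at h3
    rcases le_or_gt 0 C with hC1 | hC1
    · exact h3.trans (by have := hsub s hs; gcongr)
    · have h4 : ‖F' s‖ ≤ 0 := h3.trans (mul_nonpos_of_nonpos_of_nonneg hC1.le (by positivity))
      exact h4.trans hC0
  have h3 := (convex_uIcc 0 t).norm_image_sub_le_of_norm_hasDerivWithin_le h1 h2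
    left_mem_uIcc right_mem_uIcc
  rw [h0, sub_zero, sub_zero] at h3
  rw [norm_pow, Real.norm_eq_abs, pow_succ]
  rw [Real.norm_eq_abs] at h3
  linarith

theorem isBigO_comp_neg {E : Type*} [NormedAddCommGroup E] {f : ℝ → E} {n : ℕ}
    (hf : f =O[𝓝 0] fun s : ℝ => s ^ n) : (fun s => f (-s)) =O[𝓝 0] fun s : ℝ => s ^ n := by
  have hneg : Tendsto (fun s : ℝ => -s) (𝓝 0) (𝓝 0) := by
    simpa using (continuous_neg (G := ℝ)).tendsto 0
  refine (hf.comp_tendsto hneg).trans (IsBigO.of_bound 1 (Eventually.of_forall fun s => ?_))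
  simp

theorem isBigO_integral_symm {f : ℝ → ℂ} (hf : Continuous f) {n : ℕ}
    (hO : f =O[𝓝 0] fun s : ℝ => s ^ n) :
    (fun t => ∫ x in (-t)..t, f x) =O[𝓝 0] fun t : ℝ => t ^ (n + 1) :=
  isBigO_pow_succ_of_hasDerivAt (Eventually.of_forall fun s => hasDerivAt_integral_symm hf s)
    (by simp) (hO.add (isBigO_comp_neg hO))

theorem isBigO_of_hasDerivAt_zero {E : Type*} [NormedAddCommGroup E] [NormedSpace ℝ E]
    {f : ℝ → E} {f' : E} (hf : HasDerivAt f f' 0) (h0 : f 0 = 0) :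
    f =O[𝓝 0] fun s : ℝ => s ^ 1 := by
  simpa [h0] using hf.isBigO_sub

/-- The conditioned phase is the node `0`, which is none of the nodes of the basis. This first order
vanishing governs all expansions below. -/
theorem cueBasis_zero (k : Fin (N - 1)) : cueBasis N k 0 = 0 := by
  have hk := k.2
  have h := dirichletKer_node_sub_node (N := N) (j := 0) (k := (k : ℕ) + 1) (by omega) (by omega)
  rw [if_neg (Nat.succ_ne_zero _).symm] at h
  have h0 : node N 0 = 0 := by simp [node]
  rw [h0] at h
  rw [cueBasis, h, mul_zero]

theorem isBigO_cueBasis (k : Fin (N - 1)) :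
    (fun x => (cueBasis N k x : ℂ)) =O[𝓝 0] fun x : ℝ => x ^ 1 :=
  isBigO_of_hasDerivAt_zero (hasDerivAt_cueBasis N k 0).ofReal_comp (by simp [cueBasis_zero])

theorem isBigO_phiTilde (hN : 1 ≤ N) : phiTilde N =O[𝓝 0] fun x : ℝ => x ^ 1 :=
  isBigO_of_hasDerivAt_zero (hasDerivAt_phiTilde hN 0) (by simp [phiTilde])

theorem isBigO_psiTilde (hN : 1 ≤ N) : psiTilde N =O[𝓝 0] fun x : ℝ => x ^ 1 :=
  isBigO_of_hasDerivAt_zero (hasDerivAt_psiTilde hN 0) (by simp [psiTilde])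

theorem isBigO_moment {f : ℝ → ℂ} (hf : Continuous f) (hO : f =O[𝓝 0] fun x : ℝ => x ^ 1)
    (k : Fin (N - 1)) :
    (fun t => moment (cueBasis N) (-t) t f k) =O[𝓝 0] fun t : ℝ => t ^ 3 :=
  isBigO_integral_symm (n := 2)
    ((Complex.continuous_ofReal.comp (continuous_cueBasis N k)).mul hf)
    (((isBigO_cueBasis k).mul hO).congr_right fun x => by ring)

theorem gramMat_self {m : Type*} (c : m → ℝ → ℝ) : gramMat c (-0) 0 = 0 := by
  ext k l; simp [gramMat]

theorem det_one_sub_gramMat_zero {m : Type*} [Fintype m] [DecidableEq m] (c : m → ℝ → ℝ) :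
    (1 - gramMat c (-0) 0).det = 1 := by
  rw [gramMat_self, sub_zero, Matrix.det_one]

/-- A crude bound from differentiability at `0`; a single power of `t` is all the diagonal of `R`
needs. -/
theorem isBigO_resMatC_sub_one (k l : Fin (N - 1)) :
    (fun t => resMatC (cueBasis N) t k l - (1 : Matrix (Fin (N - 1)) (Fin (N - 1)) ℂ) k l)
      =O[𝓝 0] fun t : ℝ => t ^ 1 := by
  have h := hasDerivAt_resMatC (t := 0) (continuous_cueBasis N)
    (by rw [det_one_sub_gramMat_zero]; exact one_ne_zero) k l
  refine isBigO_of_hasDerivAt_zero (h.sub_const _) ?_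
  rw [resMatC, resMat, gramMat_self, sub_zero, inv_one,
    Matrix.map_one _ (map_zero Complex.ofRealHom) (map_one _), sub_self]

theorem isBigO_resMatC (k l : Fin (N - 1)) :
    (fun t => resMatC (cueBasis N) t k l) =O[𝓝 0] fun t : ℝ => t ^ 0 := by
  have h := hasDerivAt_resMatC (t := 0) (continuous_cueBasis N)
    (by rw [det_one_sub_gramMat_zero]; exact one_ne_zero) k l
  simpa using h.continuousAt.isBigO_one ℝ

theorem IsBigO.dotProduct_mulVec {m : Type*} [Fintype m] {v w : ℝ → m → ℂ}
    {A : ℝ → Matrix m m ℂ} {i j k : ℕ}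
    (hv : ∀ a, (fun t => v t a) =O[𝓝 0] fun t : ℝ => t ^ i)
    (hA : ∀ a b, (fun t => A t a b) =O[𝓝 0] fun t : ℝ => t ^ j)
    (hw : ∀ a, (fun t => w t a) =O[𝓝 0] fun t : ℝ => t ^ k) :
    (fun t => v t ⬝ᵥ A t *ᵥ w t) =O[𝓝 0] fun t : ℝ => t ^ (i + j + k) := by
  simp only [dotProduct, mulVec]
  refine IsBigO.fun_sum fun a _ => ?_
  refine ((hv a).mul (IsBigO.fun_sum (g := fun t : ℝ => t ^ (j + k)) fun b _ => ?_)).congr_right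
    fun t => by ring
  exact ((hA a b).mul (hw b)).congr_right fun t => by ring

/-- The basis contributes `t` and the moments `t³`, so `q` and `p` share the expansions of `φ̃` and
`ψ̃` up to `O(t⁴)`. -/
theorem isBigO_cueRes_sub {f : ℝ → ℂ} (hf : Continuous f)
    (hO : f =O[𝓝 0] fun x : ℝ => x ^ 1) :
    (fun t => cueRes N t f t - f t) =O[𝓝 0] fun t : ℝ => t ^ 4 := by
  have h := IsBigO.dotProduct_mulVec (v := cvec (cueBasis N)) isBigO_cueBasis isBigO_resMatC
    (isBigO_moment (N := N) hf hO)
  refine h.congr_left fun t => ?_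
  rw [cueRes, resApply_eq_resMatC, add_sub_cancel_left]

theorem isBigO_pow_of_le {m n : ℕ} (h : m ≤ n) :
    (fun t : ℝ => t ^ n) =O[𝓝 0] fun t : ℝ => t ^ m := by
  refine IsBigO.of_bound 1 ?_
  filter_upwards [Metric.ball_mem_nhds (0 : ℝ) one_pos] with t ht
  rw [norm_pow, norm_pow, one_mul]
  exact pow_le_pow_of_le_one (norm_nonneg _) (by simpa using (mem_ball_zero_iff.mp ht).le) h

/-- The resolvent correction is `O(t⁶)`; the leading term is `∫ α β x² dx` over `[-t, t]`. -/
theorem isBigO_integral_mul_cueRes {f h : ℝ → ℂ} (hf : Continuous f) (hh : Continuous h)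
    (hfO : f =O[𝓝 0] fun x : ℝ => x ^ 1) (hhO : h =O[𝓝 0] fun x : ℝ => x ^ 1) {α β : ℂ}
    (hα : (fun x : ℝ => f x - α * x) =O[𝓝 0] fun x : ℝ => x ^ 2)
    (hβ : (fun x : ℝ => h x - β * x) =O[𝓝 0] fun x : ℝ => x ^ 2) :
    (fun t : ℝ => (∫ x in (-t)..t, h x * cueRes N t f x) - 2 / 3 * (α * β) * (t : ℂ) ^ 3)
      =O[𝓝 0] fun t : ℝ => t ^ 4 := by
  have h1 := (IsBigO.dotProduct_mulVec (isBigO_moment (N := N) hh hhO) isBigO_resMatC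
    (isBigO_moment (N := N) hf hfO)).trans (isBigO_pow_of_le (by norm_num : 4 ≤ 3 + 0 + 3))
  have hx : (fun x : ℝ => β * (x : ℂ)) =O[𝓝 0] fun x : ℝ => x ^ 1 :=
    (IsBigO.of_bound 1 (Eventually.of_forall fun x => by simp)).const_mul_left β
  have h2 : (fun x : ℝ => h x * f x - α * β * (x : ℂ) ^ 2) =O[𝓝 0] fun x : ℝ => x ^ 3 := by
    have h3 := (hβ.mul hfO).add ((hx.mul hα).congr_right (g₂ := fun x : ℝ => x ^ 2 * x ^ 1)
      fun x => by ring)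
    exact (h3.congr_left fun x => by ring).congr_right fun x => by ring
  have h4 := (isBigO_integral_symm (by fun_prop) h2).add h1
  refine h4.congr_left fun t => ?_
  simp only [cueRes]
  rw [integral_mul_resApply (continuous_cueBasis N) hf hh, intervalIntegral.integral_sub
    (Continuous.intervalIntegrable (by fun_prop) _ _)
    (Continuous.intervalIntegrable (by fun_prop) _ _), intervalIntegral.integral_const_mul]
  have h5 : ∫ x in (-t)..t, (x : ℂ) ^ 2 = 2 / 3 * (t : ℂ) ^ 3 := by
    have h6 : ∫ x in (-t)..t, (x : ℂ) ^ 2 = ((∫ x in (-t)..t, x ^ 2 : ℝ) : ℂ) := by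
      rw [← intervalIntegral.integral_ofReal]; simp
    rw [h6, integral_pow]
    push_cast
    ring
  rw [h5]
  ring

theorem sum_sq_sub (μ : ℝ) (N : ℕ) : ∑ a ∈ Finset.range N, ((a : ℝ) - μ) ^ 2 =
    (N : ℝ) * (N - 1) * (2 * N - 1) / 6 - μ * (N * (N - 1)) + N * μ ^ 2 := by
  induction N with
  | zero => simp
  | succ n ih => rw [Finset.sum_range_succ, ih]; push_cast; ring

theorem sum_freq_sq (N : ℕ) :
    ∑ a ∈ Finset.range N, freq N a ^ 2 = (N : ℝ) * ((N : ℝ) ^ 2 - 1) / 12 := by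
  simp only [freq]
  rw [sum_sq_sub]
  ring

theorem isBigO_dirichletKer_sub (N : ℕ) :
    (fun x : ℝ => dirichletKer N x - (N - (N : ℝ) * ((N : ℝ) ^ 2 - 1) / 24 * x ^ 2))
      =O[𝓝 0] fun x : ℝ => x ^ 4 := by
  have hcos : (fun y : ℝ => Real.cos y - (1 - y ^ 2 / 2)) =O[𝓝 0] fun y : ℝ => y ^ 4 := by
    refine IsBigO.of_bound (5 / 96) ?_
    filter_upwards [Metric.ball_mem_nhds (0 : ℝ) one_pos] with y hy
    have h := Real.cos_bound (x := y) (by simpa using (mem_ball_zero_iff.mp hy).le)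
    rw [Real.norm_eq_abs, norm_pow, Real.norm_eq_abs]
    linarith
  have hterm : ∀ a ∈ Finset.range N,
      (fun x : ℝ => Real.cos (freq N a * x) - (1 - (freq N a * x) ^ 2 / 2))
        =O[𝓝 0] fun x : ℝ => x ^ 4 := by
    intro a _
    have ht : Tendsto (fun x : ℝ => freq N a * x) (𝓝 0) (𝓝 0) := by
      simpa using (continuous_const_mul (freq N a)).tendsto 0
    refine (hcos.comp_tendsto ht).trans ?_
    refine ((isBigO_refl (fun x : ℝ => x ^ 4) (𝓝 0)).const_mul_left (freq N a ^ 4)).congr_left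
      fun x => ?_
    simp only [Function.comp_apply]
    ring
  refine (IsBigO.fun_sum hterm).congr_left fun x => ?_
  rw [Finset.sum_sub_distrib, ← dirichletKer, Finset.sum_sub_distrib]
  have h1 : ∑ a ∈ Finset.range N, (freq N a * x) ^ 2 / 2 =
      (∑ a ∈ Finset.range N, freq N a ^ 2) * (x ^ 2 / 2) := by
    rw [Finset.sum_mul]
    exact Finset.sum_congr rfl fun a _ => by ring
  rw [h1, sum_freq_sq]
  simp
  ring

theorem isBigO_exp_sub (z : ℂ) :
    (fun x : ℝ => Complex.exp (z * x) -
      (1 + z * x + (z * x) ^ 2 / 2 + (z * x) ^ 3 / 6)) =O[𝓝 0] fun x : ℝ => x ^ 4 := by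
  have ht : Tendsto (fun x : ℝ => z * (x : ℂ)) (𝓝 0) (𝓝 0) := by
    have : Continuous fun x : ℝ => z * (x : ℂ) := by fun_prop
    simpa using this.tendsto 0
  have h := (Complex.exp_sub_sum_range_isBigO_pow 4).comp_tendsto ht
  have h2 : ((fun w : ℂ => w ^ 4) ∘ fun x : ℝ => z * (x : ℂ)) =O[𝓝 0] fun x : ℝ => x ^ 4 := by
    refine IsBigO.of_bound (‖z‖ ^ 4) (Eventually.of_forall fun x => ?_)
    simp [mul_pow]
  refine (h.trans h2).congr_left fun x => ?_
  simp [Finset.sum_range_succ, Nat.factorial]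

theorem isBigO_phiTilde_sub (hN : 1 ≤ N) :
    (fun t : ℝ => phiTilde N t -
        (I * (((N : ℂ) + 1) / (2 * (√(2 * π) : ℂ))) * t
          - ((N : ℂ) + 1) * (N + 2) / (12 * (√(2 * π) : ℂ)) * (t : ℂ) ^ 2
          - I * (((N : ℂ) + 1) ^ 3 / (48 * (√(2 * π) : ℂ))) * (t : ℂ) ^ 3))
        =O[𝓝 0] fun t : ℝ => t ^ 4 := by
  have hN0 : (N : ℂ) ≠ 0 := by exact_mod_cast (by omega : N ≠ 0)
  have hs := sqrt_two_pi_ne_zero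
  have h1 := isBigO_exp_sub (I * (((N : ℂ) + 1) / 2))
  have h2 := (Complex.isBigO_ofReal_left.mpr (isBigO_dirichletKer_sub N))
  have h3 := (h1.sub (h2.const_mul_left (N : ℂ)⁻¹)).const_mul_left (√(2 * π) : ℂ)⁻¹
  refine h3.congr_left fun x => ?_
  rw [phiTilde_eq hN, expPlus]
  push_cast
  rw [show I * (((N : ℂ) + 1) / 2 * x) = I * (((N : ℂ) + 1) / 2) * x by ring]
  generalize Complex.exp (I * (((N : ℂ) + 1) / 2) * x) = E
  field_simp
  ring_nf
  simp only [Complex.I_sq, Complex.I_pow_three]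
  ring

theorem isBigO_psiTilde_sub (hN : 1 ≤ N) :
    (fun t : ℝ => psiTilde N t -
        (-(I * (((N : ℂ) - 1) / (2 * (√(2 * π) : ℂ))) * t)
          - ((N : ℂ) - 1) * (N - 2) / (12 * (√(2 * π) : ℂ)) * (t : ℂ) ^ 2
          + I * (((N : ℂ) - 1) ^ 3 / (48 * (√(2 * π) : ℂ))) * (t : ℂ) ^ 3))
        =O[𝓝 0] fun t : ℝ => t ^ 4 := by
  have hN0 : (N : ℂ) ≠ 0 := by exact_mod_cast (by omega : N ≠ 0)
  have hs := sqrt_two_pi_ne_zero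
  have h1 := isBigO_exp_sub (-(I * (((N : ℂ) - 1) / 2)))
  have h2 := (Complex.isBigO_ofReal_left.mpr (isBigO_dirichletKer_sub N))
  have h3 := (h1.sub (h2.const_mul_left (N : ℂ)⁻¹)).const_mul_left (√(2 * π) : ℂ)⁻¹
  refine h3.congr_left fun x => ?_
  rw [psiTilde_eq hN, expMinus]
  push_cast
  rw [show -(I * (((N : ℂ) - 1) / 2 * x)) = -(I * (((N : ℂ) - 1) / 2)) * x by ring]
  generalize Complex.exp (-(I * (((N : ℂ) - 1) / 2)) * x) = E
  field_simp
  ring_nf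
  simp only [Complex.I_sq, Complex.I_pow_three]
  ring

theorem isBigO_sub_linear {f : ℝ → ℂ} {α β γ : ℂ}
    (h : (fun t : ℝ => f t - (α * t + β * (t : ℂ) ^ 2 + γ * (t : ℂ) ^ 3)) =O[𝓝 0]
      fun t : ℝ => t ^ 4) :
    (fun t : ℝ => f t - α * t) =O[𝓝 0] fun t : ℝ => t ^ 2 := by
  have hpow : ∀ n : ℕ, (fun t : ℝ => (t : ℂ) ^ n) =O[𝓝 0] fun t : ℝ => t ^ n := fun n =>
    IsBigO.of_bound 1 (Eventually.of_forall fun x => by simp)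
  have h2 := (hpow 2).const_mul_left β
  have h3 := ((hpow 3).const_mul_left γ).trans (isBigO_pow_of_le (by norm_num : 2 ≤ 3))
  have h4 := h.trans (isBigO_pow_of_le (by norm_num : 2 ≤ 4))
  exact ((h4.add h2).add h3).congr_left fun t => by ring

theorem isBigO_phiTilde_sub_linear (hN : 1 ≤ N) :
    (fun t : ℝ => phiTilde N t - I * (((N : ℂ) + 1) / (2 * (√(2 * π) : ℂ))) * t)
      =O[𝓝 0] fun t : ℝ => t ^ 2 :=
  isBigO_sub_linear (β := -(((N : ℂ) + 1) * (N + 2) / (12 * (√(2 * π) : ℂ))))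
    (γ := -(I * (((N : ℂ) + 1) ^ 3 / (48 * (√(2 * π) : ℂ)))))
    ((isBigO_phiTilde_sub hN).congr_left fun t => by ring)

theorem isBigO_psiTilde_sub_linear (hN : 1 ≤ N) :
    (fun t : ℝ => psiTilde N t - -(I * (((N : ℂ) - 1) / (2 * (√(2 * π) : ℂ)))) * t)
      =O[𝓝 0] fun t : ℝ => t ^ 2 :=
  isBigO_sub_linear (β := -(((N : ℂ) - 1) * (N - 2) / (12 * (√(2 * π) : ℂ))))
    (γ := I * (((N : ℂ) - 1) ^ 3 / (48 * (√(2 * π) : ℂ))))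
    ((isBigO_psiTilde_sub hN).congr_left fun t => by ring)

theorem isBigO_condKernel_diag_sub (hN : 1 ≤ N) :
    (fun t : ℝ => condKernel N t t - (N : ℝ) * ((N : ℝ) ^ 2 - 1) / (24 * π) * t ^ 2)
      =O[𝓝 0] fun t : ℝ => t ^ 3 := by
  have hN0 : (N : ℝ) ≠ 0 := by exact_mod_cast (by omega : N ≠ 0)
  have hpi := Real.pi_ne_zero
  have h1 := isBigO_dirichletKer_sub N
  -- Difference of squares: with `D = N - A t² + O(t⁴)`, the difference `D² - (N - A t²)²` is a
  -- small factor times this bounded one. The term `A² t⁴` is absorbed in `h5`.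
  have hb : (fun t : ℝ => dirichletKer N t +
      (N - (N : ℝ) * ((N : ℝ) ^ 2 - 1) / 24 * t ^ 2)) =O[𝓝 0] fun t : ℝ => t ^ 0 := by
    have hc : Continuous fun t : ℝ => dirichletKer N t +
        (N - (N : ℝ) * ((N : ℝ) ^ 2 - 1) / 24 * t ^ 2) := by
      have := continuous_dirichletKer N
      fun_prop
    simpa using (hc.tendsto 0).isBigO_one ℝ
  have h2 : (fun t : ℝ => t ^ 4 * t ^ 0) =O[𝓝 0] fun t : ℝ => t ^ 3 :=
    (isBigO_pow_of_le (by norm_num : 3 ≤ 4)).congr_left fun t => by ring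
  have h3 := ((h1.mul hb).trans h2).const_mul_left (-(1 / (2 * π * N)))
  have h4 : (fun t : ℝ => t ^ 4) =O[𝓝 0] fun t : ℝ => t ^ 3 :=
    isBigO_pow_of_le (by norm_num : 3 ≤ 4)
  have h5 := h3.add (h4.const_mul_left (-(N : ℝ) * (((N : ℝ) ^ 2 - 1) / 24) ^ 2 / (2 * π)))
  refine h5.congr_left fun t => ?_
  rw [condKernel_eq, sub_self, dirichletKer_zero]
  field_simp
  ring

/-- The function `σ` treats the end points `t` and `-t` at once. -/
theorem isBigO_resKer_diag_sub (hN : 1 ≤ N) {σ : ℝ → ℝ} (hσ : ∀ t, σ t = t ∨ σ t = -t) :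
    (fun t : ℝ => (cueResKer N t (σ t) (σ t)).re -
      (N : ℝ) * ((N : ℝ) ^ 2 - 1) / (24 * π) * t ^ 2) =O[𝓝 0] fun t : ℝ => t ^ 3 := by
  have hc : ∀ k : Fin (N - 1), (fun t => cvec (cueBasis N) (σ t) k) =O[𝓝 0]
      fun t : ℝ => t ^ 1 := by
    intro k
    refine IsBigO.trans (IsBigO.of_bound 1 (Eventually.of_forall fun t => ?_))
      ((isBigO_cueBasis k).norm_left.add (isBigO_comp_neg (isBigO_cueBasis k)).norm_left)
    rw [one_mul, Real.norm_of_nonneg (by positivity)]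
    rcases hσ t with h | h
    · rw [h]; exact le_add_of_nonneg_right (norm_nonneg _)
    · rw [h]; exact le_add_of_nonneg_left (norm_nonneg _)
  have h1 := IsBigO.dotProduct_mulVec hc
    (A := fun t => resMatC (cueBasis N) t - 1) isBigO_resMatC_sub_one hc
  have h2 : (fun t : ℝ => (cueResKer N t (σ t) (σ t)).re - condKernel N t t)
      =O[𝓝 0] fun t : ℝ => t ^ 3 := by
    refine IsBigO.trans (IsBigO.of_bound 1 (Eventually.of_forall fun t => ?_)) h1
    have h3 : cvec (cueBasis N) (σ t) ⬝ᵥ (resMatC (cueBasis N) t - 1) *ᵥ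
        cvec (cueBasis N) (σ t) = cueResKer N t (σ t) (σ t) - condKernel N t t := by
      have h4 : condKernel N t t = condKernel N (σ t) (σ t) := by
        rcases hσ t with h | h
        · rw [h]
        · rw [h, condKernel_neg_neg]
      rw [Matrix.sub_mulVec, dotProduct_sub, one_mulVec, h4, condKernel_eq_finKer hN]
      simp [cueResKer, resKer_eq_resMatC, finKer, dotProduct, cvec]
    rw [h3, one_mul, Real.norm_eq_abs]
    simpa using Complex.abs_re_le_norm (cueResKer N t (σ t) (σ t) - condKernel N t t)
  exact (h2.add (isBigO_condKernel_diag_sub hN)).congr_left fun t => by ring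

theorem isBigO_log_det (hN : 1 ≤ N) :
    (fun t : ℝ => Real.log (1 - gramMat (cueBasis N) (-t) t).det -
      (-((N : ℝ) * ((N : ℝ) ^ 2 - 1) / (36 * π) * t ^ 3))) =O[𝓝 0] fun t : ℝ => t ^ 4 := by
  have hG := hasDerivAt_det_one_sub_gramMat (c := cueBasis N) (t := 0) (continuous_cueBasis N)
    (by rw [det_one_sub_gramMat_zero]; exact one_ne_zero)
  have hne : ∀ᶠ s in 𝓝 (0 : ℝ), (1 - gramMat (cueBasis N) (-s) s).det ≠ 0 :=
    hG.continuousAt.eventually_ne (by rw [det_one_sub_gramMat_zero]; exact one_ne_zero)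
  have h1 := isBigO_resKer_diag_sub hN (σ := fun t => t) fun t => Or.inl rfl
  have h2 := isBigO_resKer_diag_sub hN (σ := fun t => -t) fun t => Or.inr rfl
  refine isBigO_pow_succ_of_hasDerivAt (F' := fun s : ℝ =>
    -((cueResKer N s s s).re - (N : ℝ) * ((N : ℝ) ^ 2 - 1) / (24 * π) * s ^ 2 +
      ((cueResKer N s (-s) (-s)).re - (N : ℝ) * ((N : ℝ) ^ 2 - 1) / (24 * π) * s ^ 2)))
    ?_ ?_ (h1.add h2).neg_left
  · filter_upwards [hne] with s hs
    have h3 := (hasDerivAt_det_one_sub_gramMat (continuous_cueBasis N) hs).log hs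
    have h4 := (((hasDerivAt_pow 3 s).const_mul
      ((N : ℝ) * ((N : ℝ) ^ 2 - 1) / (36 * π))).neg)
    refine (h3.sub h4).congr_deriv ?_
    rw [← mul_neg, mul_div_cancel_left₀ _ hs]
    simp only [cueResKer]
    push_cast
    ring
  · rw [det_one_sub_gramMat_zero]
    simp

end Expansion

/-! ### The law of the distance to the nearest eigenphase -/

section Nearest

variable {N : ℕ} {t : ℝ}

/-- Nonemptiness matters: the infimum of an empty family of reals is `0` by convention. -/
theorem lt_nearestDist_iff {n : ℕ} [Nonempty (Fin n)] (x : Fin n → ℝ) (t : ℝ) :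
    t < nearestDist x ↔ ∀ j, x j ∉ Icc (-t) t := by
  have h1 : ∀ j, x j ∉ Icc (-t) t ↔ t < |x j| := by
    intro j
    rw [mem_Icc, ← abs_le, not_le]
  simp only [h1]
  constructor
  · exact fun h j => h.trans_le (ciInf_le (finite_range _).bddBelow j)
  · intro h
    obtain ⟨j, hj⟩ := exists_eq_ciInf_of_finite (f := fun j => |x j|)
    rw [nearestDist, ← hj]
    exact h j

theorem measurable_nearestDist {n : ℕ} : Measurable (nearestDist (n := n)) := by
  unfold nearestDist
  exact Measurable.iInf fun j => (measurable_pi_apply j).abs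

theorem cueCondLaw_nearestDist_Iic (hN : 2 ≤ N) (t : ℝ) :
    (cueCondLaw N).map nearestDist (Iic t) = ENNReal.ofReal (1 - condJanossy N (-t) t) := by
  have := isProbabilityMeasure_cueCondLaw (N := N) (by omega)
  have : Nonempty (Fin (N - 1)) := ⟨⟨0, by omega⟩⟩
  have hms : MeasurableSet {x : Fin (N - 1) → ℝ | ∀ j, x j ∉ Icc (-t) t} := by
    have : {x : Fin (N - 1) → ℝ | ∀ j, x j ∉ Icc (-t) t} = nearestDist ⁻¹' Ioi t := by
      ext x; exact (lt_nearestDist_iff x t).symm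
    rw [this]
    exact measurable_nearestDist measurableSet_Ioi
  have hset : nearestDist ⁻¹' Iic t = {x : Fin (N - 1) → ℝ | ∀ j, x j ∉ Icc (-t) t}ᶜ := by
    ext x
    rw [mem_preimage, mem_Iic, mem_compl_iff, mem_ofPred_eq, ← lt_nearestDist_iff, not_lt]
  rw [Measure.map_apply measurable_nearestDist measurableSet_Iic, hset, condJanossy,
    ← probReal_compl_eq_one_sub hms, ofReal_measureReal]

theorem condJanossy_of_neg (hN : 1 ≤ N) (ht : t < 0) : condJanossy N (-t) t = 1 := by
  have := isProbabilityMeasure_cueCondLaw hN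
  have h : {x : Fin (N - 1) → ℝ | ∀ j, x j ∉ Icc (-t) t} = univ := by
    ext x
    simp [Icc_eq_empty (show ¬ -t ≤ t by linarith)]
  rw [condJanossy, h, probReal_univ]

theorem condJanossy_antitone (hN : 1 ≤ N) : Antitone fun t => condJanossy N (-t) t := by
  have := isProbabilityMeasure_cueCondLaw hN
  intro s t hst
  refine measureReal_mono fun x hx j hj => hx j ⟨?_, ?_⟩
  · linarith [hj.1]
  · exact hj.2.trans hst

/-- The adjugate form needs no invertibility, so the derivative is continuous on all of `ℝ`,
including `t = π`, where `1 - G` vanishes. -/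
theorem hasDerivAt_det_cueBasis :
    ∃ D : ℝ → ℝ, Continuous D ∧
      ∀ t, HasDerivAt (fun s => (1 - gramMat (cueBasis N) (-s) s).det) (D t) t := by
  refine ⟨fun t => ((1 - gramMat (cueBasis N) (-t) t).adjugate *
    -(Matrix.of fun k l => cueBasis N k t * cueBasis N l t +
      cueBasis N k (-t) * cueBasis N l (-t))).trace, ?_, fun t => ?_⟩
  · have h1 : Continuous fun s => gramMat (cueBasis N) (-s) s :=
      continuous_matrix fun k l => continuous_iff_continuousAt.mpr fun s =>
        (hasDerivAt_gramMat (continuous_cueBasis N) s k l).continuousAt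
    have h2 : Continuous fun t => (Matrix.of fun k l : Fin (N - 1) =>
        cueBasis N k t * cueBasis N l t + cueBasis N k (-t) * cueBasis N l (-t)) :=
      continuous_matrix fun k l => by
        have := continuous_cueBasis N
        simp only [Matrix.of_apply]
        fun_prop
    exact (((continuous_const.sub h1).matrix_adjugate).matrix_mul h2.neg).matrix_trace
  · exact HasDerivAt.matrix_det (A := fun s => 1 - gramMat (cueBasis N) (-s) s) (fun k l => by
      simpa using (hasDerivAt_gramMat (continuous_cueBasis N) t k l).const_sub
        ((1 : Matrix (Fin (N - 1)) (Fin (N - 1)) ℝ) k l))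

theorem map_nearestDist_cueCondLaw (hN : 2 ≤ N) :
    (cueCondLaw N).map nearestDist =
      (volume.restrict (Ioo 0 π)).withDensity
        (fun t => ENNReal.ofReal (nnSpacingDensity N t)) := by
  have hN1 : 1 ≤ N := by omega
  have hprob := isProbabilityMeasure_cueCondLaw hN1
  obtain ⟨D, hDc, hD⟩ := hasDerivAt_det_cueBasis (N := N)
  have hnn : ∀ t ∈ Ioo 0 π, nnSpacingDensity N t = -D t := by
    intro t ht
    rw [nnSpacingDensity]
    congr 1
    refine ((hD t).congr_of_eventuallyEq ?_).deriv
    filter_upwards [isOpen_Ioo.mem_nhds ht] with s hs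
      using condJanossy_eq_det hN1 hs.1.le hs.2
  have hDneg : ∀ t ∈ Ioo 0 π, 0 ≤ -D t := by
    intro t ht
    rw [← hnn t ht, nnSpacingDensity, neg_nonneg]
    exact (condJanossy_antitone hN1).deriv_nonpos
  have hDint : ∀ t ∈ Icc 0 π, ∫⁻ s in Ioo 0 t, ENNReal.ofReal (nnSpacingDensity N s) =
      ENNReal.ofReal (1 - (1 - gramMat (cueBasis N) (-t) t).det) := by
    intro t ht
    have h1 : ∫⁻ s in Ioo 0 t, ENNReal.ofReal (nnSpacingDensity N s) =
        ∫⁻ s in Ioo 0 t, ENNReal.ofReal (-D s) :=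
      setLIntegral_congr_fun measurableSet_Ioo fun s hs => by
        simp only [hnn s ⟨hs.1, hs.2.trans_le ht.2⟩]
    rw [h1, ← ofReal_integral_eq_lintegral_ofReal, ← integral_Ioc_eq_integral_Ioo,
      ← intervalIntegral.integral_of_le ht.1, intervalIntegral.integral_neg,
      intervalIntegral.integral_eq_sub_of_hasDerivAt (fun s _ => hD s)
        (hDc.intervalIntegrable _ _), det_one_sub_gramMat_zero]
    · congr 1; ring
    · exact (hDc.neg.continuousOn.integrableOn_compact isCompact_Icc).mono_set
        Ioo_subset_Icc_self
    · exact (ae_restrict_iff' measurableSet_Ioo).mpr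
        (ae_of_all _ fun s hs => hDneg s ⟨hs.1, hs.2.trans_le ht.2⟩)
  -- The matrix is zero and, as `N ≥ 2`, not of size `0`; so the density has total mass `1`.
  have hdetpi : (1 - gramMat (cueBasis N) (-π) π).det = 0 := by
    have : Nonempty (Fin (N - 1)) := ⟨⟨0, by omega⟩⟩
    rw [gramMat_cueBasis_full, sub_self, Matrix.det_zero]
  have hle : ∀ t, (cueCondLaw N).map nearestDist (Iic t) =
      (volume.restrict (Ioo 0 π)).withDensity
        (fun t => ENNReal.ofReal (nnSpacingDensity N t)) (Iic t) := by
    intro t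
    rw [cueCondLaw_nearestDist_Iic hN, withDensity_apply _ measurableSet_Iic,
      Measure.restrict_restrict measurableSet_Iic]
    rcases lt_or_ge t 0 with h0 | h0
    · have : Iic t ∩ Ioo 0 π = ∅ := by
        ext s; simp only [mem_inter_iff, mem_Iic, mem_Ioo, mem_empty_iff_false, iff_false]
        intro h; linarith [h.1, h.2.1]
      rw [condJanossy_of_neg hN1 h0, this]; simp
    rcases lt_or_ge t π with hπ | hπ
    · have : Iic t ∩ Ioo 0 π = Ioc 0 t := by
        ext s; simp only [mem_inter_iff, mem_Iic, mem_Ioo, mem_Ioc]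
        exact ⟨fun h => ⟨h.2.1, h.1⟩, fun h => ⟨h.2, h.1, h.2.trans_lt hπ⟩⟩
      rw [this, condJanossy_eq_det hN1 h0 hπ, ← hDint t ⟨h0, hπ.le⟩,
        restrict_Ioo_eq_restrict_Ioc]
    · have : Iic t ∩ Ioo 0 π = Ioo 0 π :=
        inter_eq_right.mpr fun s hs => hs.2.le.trans hπ
      rw [this, hDint π ⟨Real.pi_pos.le, le_rfl⟩, hdetpi]
      -- The determinant formula stops at `π`; beyond it, monotonicity bounds the probability by
      -- values tending to `0`.
      have h1 : condJanossy N (-t) t = 0 := by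
        refine le_antisymm ?_ measureReal_nonneg
        have hlim : Tendsto (fun s => (1 - gramMat (cueBasis N) (-s) s).det) (𝓝[<] π) (𝓝 0) := by
          have := (hD π).continuousAt.tendsto
          rw [hdetpi] at this
          exact this.mono_left nhdsWithin_le_nhds
        refine ge_of_tendsto hlim ?_
        filter_upwards [Ioo_mem_nhdsLT Real.pi_pos] with s hs
        rw [← condJanossy_eq_det hN1 hs.1.le hs.2]
        exact condJanossy_antitone hN1 (hs.2.le.trans hπ)
      rw [h1]
  have : IsFiniteMeasure ((cueCondLaw N).map nearestDist) := by infer_instance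
  exact Measure.ext_of_Iic _ _ hle

end Nearest

theorem mainTheorem4 (N : ℕ) (hN : 1 ≤ N) :
    (∀ t ∈ Set.Ioo (0 : ℝ) π,
      NeumannInverts (condKernel N) (-t) t ∧
      HasSum (fredholmTerm (condKernel N) (-t) t) (symJ N t) ∧
      0 < symJ N t ∧
      symQ N t = conj (twQ N (-t) t (-t)) ∧
      symP N t = conj (twP N (-t) t (-t)) ∧
      (symU N t).im = 0 ∧ (symW N t).im = 0 ∧ (symV N t).im = 0 ∧
      ∃ (q' p' : ℂ) (L : ℝ),
        HasDerivAt (symQ N) q' t ∧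
        HasDerivAt (symP N) p' t ∧
        Complex.I * (1 - Complex.exp (Complex.I * t)) * q' =
          -(((N : ℂ) + 1) / 2 * (1 - Complex.exp (Complex.I * t)) + symV N t - 1 / N) * symQ N t
            + ((N : ℂ) + 1) * (symU N t - 1 / N) * symP N t
            + (Real.tan (t / 2) : ℂ) *
              (symQ N t * conj (symP N t) - symP N t * conj (symQ N t)) * conj (symQ N t) ∧
        Complex.I * (1 - Complex.exp (Complex.I * t)) * p' =
          (((N : ℂ) - 1) / 2 * (1 - Complex.exp (Complex.I * t)) + symV N t - 1 / N) * symP N t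
            + ((N : ℂ) - 1) * (symW N t - 1 / N) * symQ N t
            + (Real.tan (t / 2) : ℂ) *
              (symQ N t * conj (symP N t) - symP N t * conj (symQ N t)) * conj (symP N t) ∧
        HasDerivAt (symU N) (symQ N t ^ 2 + conj (symQ N t) ^ 2) t ∧
        HasDerivAt (symW N) (symP N t ^ 2 + conj (symP N t) ^ 2) t ∧
        HasDerivAt (symV N) (symQ N t * symP N t + conj (symQ N t) * conj (symP N t)) t ∧
        (L : ℂ) =
          Complex.I * Complex.exp (-(Complex.I * t)) * (symP N t * q' - symQ N t * p')
            - Complex.I * Complex.exp (Complex.I * t) *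
              (conj (symP N t) * conj q' - conj (symQ N t) * conj p')
            + (Real.cot t : ℂ) *
              (symQ N t * conj (symP N t) - symP N t * conj (symQ N t)) ^ 2 ∧
        HasDerivAt (fun s => Real.log (symJ N s)) L t ∧
        nnSpacingDensity N t = -(symJ N t * L)) ∧
    ((fun t : ℝ => symQ N t -
        (Complex.I * (((N : ℂ) + 1) / (2 * (Real.sqrt (2 * π) : ℂ))) * t
          - ((N : ℂ) + 1) * (N + 2) / (12 * (Real.sqrt (2 * π) : ℂ)) * (t : ℂ) ^ 2
          - Complex.I * (((N : ℂ) + 1) ^ 3 / (48 * (Real.sqrt (2 * π) : ℂ))) * (t : ℂ) ^ 3))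
        =O[𝓝[>] 0] (fun t : ℝ => t ^ 4) ∧
      (fun t : ℝ => symP N t -
        (-(Complex.I * (((N : ℂ) - 1) / (2 * (Real.sqrt (2 * π) : ℂ))) * t)
          - ((N : ℂ) - 1) * (N - 2) / (12 * (Real.sqrt (2 * π) : ℂ)) * (t : ℂ) ^ 2
          + Complex.I * (((N : ℂ) - 1) ^ 3 / (48 * (Real.sqrt (2 * π) : ℂ))) * (t : ℂ) ^ 3))
        =O[𝓝[>] 0] (fun t : ℝ => t ^ 4) ∧
      (fun t : ℝ => symU N t - (-(((N : ℂ) + 1) ^ 2 / (12 * π) * (t : ℂ) ^ 3)))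
        =O[𝓝[>] 0] (fun t : ℝ => t ^ 4) ∧
      (fun t : ℝ => symW N t - (-(((N : ℂ) - 1) ^ 2 / (12 * π) * (t : ℂ) ^ 3)))
        =O[𝓝[>] 0] (fun t : ℝ => t ^ 4) ∧
      (fun t : ℝ => symV N t - ((N : ℂ) ^ 2 - 1) / (12 * π) * (t : ℂ) ^ 3)
        =O[𝓝[>] 0] (fun t : ℝ => t ^ 4) ∧
      (fun t : ℝ => Real.log (symJ N t) - (-((N : ℝ) * ((N : ℝ) ^ 2 - 1) / (36 * π) * t ^ 3)))
        =O[𝓝[>] 0] (fun t : ℝ => t ^ 4)) ∧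
    (2 ≤ N →
      (cueCondLaw N).map nearestDist =
        (volume.restrict (Set.Ioo 0 π)).withDensity
          (fun t => ENNReal.ofReal (nnSpacingDensity N t))) := by
  -- The finite rank expressions expand in a two-sided neighbourhood of `0`, but they are identified
  -- with `q, p, …` only on `(0, π)`.
  have hsub : ∀ {E F : Type} [NormedAddCommGroup E] [NormedAddCommGroup F] {f g : ℝ → E}
      {k : ℝ → F}, (∀ t ∈ Set.Ioo (0 : ℝ) π, f t = g t) → f =O[𝓝 0] k → g =O[𝓝[>] 0] k := by
    intro E F _ _ f g k hfg hf
    refine (hf.mono nhdsWithin_le_nhds).congr' ?_ EventuallyEq.rfl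
    filter_upwards [Ioo_mem_nhdsGT Real.pi_pos] with t ht using hfg t ht
  have hs2 := sqrt_two_pi_mul_self
  have hs := sqrt_two_pi_ne_zero
  have hpi : (π : ℂ) ≠ 0 := by exact_mod_cast Real.pi_ne_zero
  have hφ := continuous_phiTilde hN
  have hψ := continuous_psiTilde hN
  refine ⟨fun t ht => ?_, ⟨?_, ?_, ?_, ?_, ?_, ?_⟩, map_nearestDist_cueCondLaw⟩
  · have hle : -t ≤ t := by linarith [ht.1]
    have hexp : Complex.exp (-(Complex.I * t)) = unitExp (-t) := by
      rw [unitExp]; congr 1; push_cast; ring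
    refine ⟨?_, ?_, symJ_pos hN ht.1.le ht.2, ?_, ?_, ?_, ?_, ?_, symQ' N t, symP' N t, symL N t,
      hasDerivAt_symQ hN ht, hasDerivAt_symP hN ht, symQ_ode hN ht, symP_ode hN ht,
      hasDerivAt_symU hN ht, hasDerivAt_symW hN ht, hasDerivAt_symV hN ht, ?_,
      hasDerivAt_log_symJ hN ht, nnSpacingDensity_eq hN ht⟩
    · rw [condKernel_eq_finKer hN]
      exact neumannInverts_finKer (continuous_cueBasis N) hle (posDef_cueBasis ht)
    · rw [symJ_eq hN ht.1.le ht.2]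
      exact hasSum_fredholmTerm _ _ (continuous_cueBasis N)
        (fun x y => congrFun (congrFun (condKernel_eq_finKer hN) x) y) hle
    · rw [twQ_eq hN ht, ← conj_symQ hN ht, Complex.conj_conj]
    · rw [twP_eq hN ht, ← conj_symP hN ht, Complex.conj_conj]
    · rw [symU_eq hN ht]
      exact Complex.conj_eq_iff_im.mp
        (conj_integral_mul_cueRes hN ht hφ (conj_phiTilde hN) (conj_phiTilde hN))
    · rw [symW_eq hN ht]
      exact Complex.conj_eq_iff_im.mp
        (conj_integral_mul_cueRes hN ht hψ (conj_psiTilde hN) (conj_psiTilde hN))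
    · rw [symV_eq hN ht]
      exact Complex.conj_eq_iff_im.mp
        (conj_integral_mul_cueRes hN ht hφ (conj_phiTilde hN) (conj_psiTilde hN))
    · rw [hexp]
      exact symL_eq hN ht
  · refine hsub (fun t ht => ?_)
      ((isBigO_cueRes_sub (N := N) hφ (isBigO_phiTilde hN)).add (isBigO_phiTilde_sub hN))
    rw [symQ_eq hN ht]; ring
  · refine hsub (fun t ht => ?_)
      ((isBigO_cueRes_sub (N := N) hψ (isBigO_psiTilde hN)).add (isBigO_psiTilde_sub hN))
    rw [symP_eq hN ht]; ring
  · refine hsub (fun t ht => ?_) (isBigO_integral_mul_cueRes (N := N) hφ hφ (isBigO_phiTilde hN)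
      (isBigO_phiTilde hN) (isBigO_phiTilde_sub_linear hN) (isBigO_phiTilde_sub_linear hN))
    rw [symU_eq hN ht]
    congr 1
    field_simp
    -- The coefficient is `2/3 · (i(N+1)/(2√(2π)))² = -(N+1)²/(12π)`.
    rw [pow_two (√(2 * π) : ℂ), hs2, Complex.I_sq]
    ring
  · refine hsub (fun t ht => ?_) (isBigO_integral_mul_cueRes (N := N) hψ hψ (isBigO_psiTilde hN)
      (isBigO_psiTilde hN) (isBigO_psiTilde_sub_linear hN) (isBigO_psiTilde_sub_linear hN))
    rw [symW_eq hN ht]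
    congr 1
    field_simp
    rw [pow_two (√(2 * π) : ℂ), hs2, Complex.I_sq]
    ring
  · refine hsub (fun t ht => ?_) (isBigO_integral_mul_cueRes (N := N) hφ hψ (isBigO_phiTilde hN)
      (isBigO_psiTilde hN) (isBigO_phiTilde_sub_linear hN) (isBigO_psiTilde_sub_linear hN))
    rw [symV_eq hN ht]
    congr 1
    field_simp
    rw [pow_two (√(2 * π) : ℂ), hs2, Complex.I_sq]
    ring
  · refine hsub (fun t ht => ?_) (isBigO_log_det hN)
    rw [symJ_eq hN ht.1.le ht.2]
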